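/- Let $n\ge 2$, let $p\le 1$ be real, and let $K\subset\mathbb R^n$ be an origin-symmetric convex body with the origin in its interior and with $C^\infty$ boundary of strictly positive curvature ($K\in\mathcal K^\infty_{+,e}$). Let $h_K$ be its support function, and equip $\partial K$, parametrized on the unit sphere $S^{n-1}$ by the inverse Gauss map $x=\nabla h_K$, with its centro-affine normalization: the transversal normal is $x$ itself and the conormal is $x^*=\theta/h_K(\theta)$, $\theta\in S^{n-1}$. Put $g_K(u,v)=\langle dx^*(u),dx(v)\rangle$ (the centro-affine metric); let $\nu_K$ be the measure with density $|\det(dx(e_1),\dots,dx(e_{n-1}),x)|$ with respect to the surface measure of $S^{n-1}$, where $e_1,\dots,e_{n-1}$ is a Euclidean orthonormal basis of the tangent space; let $\nabla^*_K$ be the connection determined by the Gauss equation $D_U\,dx^*(V)=dx^*((\nabla_K^*)_UV)-g_K(U,V)\,x^*$; and put $\mathrm{Hess}^*_Kf(U,V)=U(Vf)-((\nabla_K^*)_UV)f$ and $\Delta_Kf=\mathrm{tr}_{g_K}\mathrm{Hess}_K^*f$. Norms and gradients are taken with respect to $g_K$. Let $C^2_e$ be the space of even $C^2$ functions on $S^{n-1}$.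 Consider the statements: 1. (even local $L^p$-Brunn–Minkowski inequality) for all $f\in C^2_e$ with $\int f\,d\nu_K=0$, $\ \int|\mathrm{grad}_{g_K}f|^2d\nu_K=\int(-\Delta_Kf)f\,d\nu_K\ge(n-p)\int f^2d\nu_K$; 2. for all $f\in C^2_e$, $\ \int(\Delta_Kf)^2d\nu_K\ge(n-p)\int|\mathrm{grad}_{g_K}f|^2d\nu_K=(n-p)\int(-\Delta_Kf)f\,d\nu_K$; 3. for all $f\in C^2_e$, $\ \int\|\mathrm{Hess}^*_Kf\|_{g_K}^2d\nu_K\ge\frac{2-p}{n-p}\int(\Delta_Kf)^2d\nu_K$; 4. for all $f\in C^2_e$, $\ \int\|\mathrm{Hess}^*_Kf\|_{g_K}^2d\nu_K\ge(2-p)\int|\mathrm{grad}_{g_K}f|^2d\nu_K$; 5. for all $f\in C^2_e$, $\ \int\|\mathrm{Hess}^*_Kf+f\,g_K\|_{g_K}^2d\nu_K\ge(n-1)\int f^2d\nu_K$. Then 1, 2 and 4 are equivalent. If $n\ge3$ or $p\ge0$, then 1, 2, 3 and 4 are equivalent. If $p=0$, then all of 1–5 are equivalent. -/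

import Mathlib

open scoped Manifold ContDiff Topology RealInnerProductSpace

noncomputable section

namespace CentroAffine

/-- Euclidean space of dimension `n = d + 1`, identified with its dual by the scalar product. -/
abbrev Euc (d : ℕ) : Type := EuclideanSpace ℝ (Fin (d + 1))

/-- The Euclidean unit sphere, of dimension `d = n - 1`. -/
abbrev Sph (d : ℕ) : Type := Metric.sphere (0 : Euc d) 1

variable {d : ℕ}

/-! ### Convex bodies -/

/-- Near the point `x`, the set `K` is the sublevel set of a smooth function with non-zero
differential, whose second derivative is positive definite on the tangent space of the boundary.
(With respect to the outer unit normal, the second fundamental form of the boundary is this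
restricted second derivative divided by the norm of the differential.) -/
def SmoothStronglyConvexAt (K : Set (Euc d)) (x : Euc d) : Prop :=
  ∃ (U : Set (Euc d)) (φ : Euc d → ℝ), IsOpen U ∧ x ∈ U ∧ ContDiffOn ℝ ∞ φ U ∧
    (∀ y ∈ U, y ∈ K ↔ φ y ≤ 0) ∧ fderiv ℝ φ x ≠ 0 ∧
    ∀ u : Euc d, u ≠ 0 → fderiv ℝ φ x u = 0 → 0 < fderiv ℝ (fderiv ℝ φ) x u u

/-- Origin-symmetric convex bodies with the origin in the interior and with a smooth boundary of
strictly positive curvature. -/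
structure IsSmoothEvenBody (K : Set (Euc d)) : Prop where
  convex : Convex ℝ K
  isCompact : IsCompact K
  zero_mem_interior : (0 : Euc d) ∈ interior K
  boundary : ∀ x ∈ frontier K, SmoothStronglyConvexAt K x
  neg_mem : ∀ x ∈ K, -x ∈ K

/-- The support function `h_K`. -/
def supportFn (K : Set (Euc d)) (y : Euc d) : ℝ := sSup ((fun x : Euc d => ⟪y, x⟫) '' K)

/-! ### The parametrization by the sphere

The boundary of `K` is parametrized on the unit sphere by the inverse Gauss map. It carries the
centro-affine normalization, in which the position vector is the transversal normal. Both the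
position and the conormal are written as functions on the whole space, homogeneous of degree
zero. -/

/-- The position (and centro-affine normal) `x = D h_K`. -/
def position (K : Set (Euc d)) (y : Euc d) : Euc d := gradient (supportFn K) y

/-- The conormal `x* = y / h_K(y)`, a parametrization of the boundary of the dual body. -/
def conormal (K : Set (Euc d)) (y : Euc d) : Euc d := (supportFn K y)⁻¹ • y

/-- The extension of a function on the sphere to a function homogeneous of degree zero. -/
def radialExt (f : Sph d → ℝ) (y : Euc d) : ℝ :=
  if hy : y ≠ 0 then f ⟨‖y‖⁻¹ • y, by simp [norm_smul, hy]⟩ else 0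

/-- The tangent space of the sphere at `θ`. -/
def tangent (θ : Sph d) : Submodule ℝ (Euc d) := (ℝ ∙ (θ : Euc d))ᗮ

/-- A Euclidean orthonormal basis of the tangent space of the sphere at `θ`. -/
def frame (θ : Sph d) (i : Fin (Module.finrank ℝ (tangent θ))) : Euc d :=
  (stdOrthonormalBasis ℝ (tangent θ) i : Euc d)

/-- The tangential vector field on the sphere which at each `y` is the orthogonal projection of
`v` to the tangent space at `y`. -/
def tangentField (v y : Euc d) : Euc d := v - ⟪y, v⟫ • y

/-! ### Centro-affine structures -/

/-- The centro-affine metric `g_K(u, v) = ⟨dx*(u), dx(v)⟩`. -/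
def metric (K : Set (Euc d)) (θ : Sph d) (u v : Euc d) : ℝ :=
  ⟪fderiv ℝ (conormal K) θ u, fderiv ℝ (position K) θ v⟫

/-- The Gauss structure equation for the conormal:
`D_U (dx*(V)) = dx*(W) - c x*` at `θ`, where `U = u` is tangent, `V` is a tangential vector field,
and `W = w` is tangent. It determines `w` and `c`. -/
def ConormalGauss (K : Set (Euc d)) (θ : Sph d) (u : Euc d) (V : Euc d → Euc d)
    (w : Euc d) (c : ℝ) : Prop :=
  w ∈ tangent θ ∧
    fderiv ℝ (fun y => fderiv ℝ (conormal K) y (V y)) θ u =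
      fderiv ℝ (conormal K) θ w - c • conormal K θ

open Classical in
/-- The conjugate centro-affine connection `(∇_K^*)_u V`: the tangent vector given by the Gauss
structure equation for the conormal. -/
def conjConnection (K : Set (Euc d)) (θ : Sph d) (u : Euc d) (V : Euc d → Euc d) : Euc d :=
  if h : ∃ w, ∃ c, ConormalGauss K θ u V w c then h.choose else 0

/-- The Hessian `Hess_K^* f (u, v) = u(V f) - ((∇_K^*)_u V) f` of the conjugate connection, where
`V` is a tangential vector field with value `v` at `θ`. -/
def conjHess (K : Set (Euc d)) (f : Sph d → ℝ) (θ : Sph d) (u v : Euc d) : ℝ :=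
  fderiv ℝ (fun y => fderiv ℝ (radialExt f) y (tangentField v y)) θ u -
    fderiv ℝ (radialExt f) θ (conjConnection K θ u (tangentField v))

/-- The matrix `g_ij` of the metric in the frame. -/
def metricMatrix (K : Set (Euc d)) (θ : Sph d) :
    Matrix (Fin (Module.finrank ℝ (tangent θ))) (Fin (Module.finrank ℝ (tangent θ))) ℝ :=
  Matrix.of fun i j => metric K θ (frame θ i) (frame θ j)

/-- The matrix of `Hess_K^* f` in the frame. -/
def hessMatrix (K : Set (Euc d)) (f : Sph d → ℝ) (θ : Sph d) :
    Matrix (Fin (Module.finrank ℝ (tangent θ))) (Fin (Module.finrank ℝ (tangent θ))) ℝ :=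
  Matrix.of fun i j => conjHess K f θ (frame θ i) (frame θ j)

/-- The components `g^{ij} f_j` of the metric gradient in the frame. -/
def gradVec (K : Set (Euc d)) (f : Sph d → ℝ) (θ : Sph d) :
    Fin (Module.finrank ℝ (tangent θ)) → ℝ :=
  Matrix.mulVec (metricMatrix K θ)⁻¹ fun j => fderiv ℝ (radialExt f) θ (frame θ j)

/-- `|grad f|² = g_K(grad f, grad f)`. -/
def gradSq (K : Set (Euc d)) (f : Sph d → ℝ) (θ : Sph d) : ℝ :=
  gradVec K f θ ⬝ᵥ Matrix.mulVec (metricMatrix K θ) (gradVec K f θ)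

/-- The centro-affine Laplacian (Hilbert--Brunn--Minkowski operator)
`Δ_K f = tr_g Hess_K^* f = g^{ij} (Hess_K^* f)_{ij}`. -/
def laplacian (K : Set (Euc d)) (f : Sph d → ℝ) (θ : Sph d) : ℝ :=
  ((metricMatrix K θ)⁻¹ * hessMatrix K f θ).trace

/-- The squared norm `g^{ij} g^{kl} B_{ik} B_{jl}` of a covariant two-tensor `B`. -/
def tensorNormSq (K : Set (Euc d)) (θ : Sph d)
    (B : Matrix (Fin (Module.finrank ℝ (tangent θ))) (Fin (Module.finrank ℝ (tangent θ))) ℝ) : ℝ :=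
  ((metricMatrix K θ)⁻¹ * B * (metricMatrix K θ)⁻¹ * B.transpose).trace

/-- The absolute value of the volume form, `|Det(dx(e_1), …, dx(e_{n-1}), x)|`, on a Euclidean
orthonormal frame. Here `|Det(v_1, …, v_n)|` is the square root of the Gram determinant. -/
def volumeDensity (K : Set (Euc d)) (θ : Sph d) : ℝ :=
  Real.sqrt (Matrix.gram ℝ (Sum.elim
    (fun i : Fin (Module.finrank ℝ (tangent θ)) => fderiv ℝ (position K) θ (frame θ i))
    (fun _ : Unit => position K θ))).det

/-- The centro-affine volume measure `ν_K` on the sphere. -/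
def nu (K : Set (Euc d)) : MeasureTheory.Measure (Sph d) :=
  ((MeasureTheory.volume : MeasureTheory.Measure (Euc d)).toSphere).withDensity
    fun θ => ENNReal.ofReal (volumeDensity K θ)

/-! ### The inequalities -/

/-- Even functions of class `C²` on the sphere. -/
def IsC2Even (f : Sph d → ℝ) : Prop :=
  ContMDiff (𝓡 d) 𝓘(ℝ, ℝ) 2 f ∧ ∀ θ, f (-θ) = f θ

/-- The even local `L^p`-Brunn--Minkowski inequality for `K`. -/
def LocalLpBrunnMinkowski (K : Set (Euc d)) (p : ℝ) : Prop :=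
  ∀ f : Sph d → ℝ, IsC2Even f → ∫ θ, f θ ∂(nu K) = 0 →
    ∫ θ, gradSq K f θ ∂(nu K) = ∫ θ, -laplacian K f θ * f θ ∂(nu K) ∧
    ∫ θ, -laplacian K f θ * f θ ∂(nu K) ≥ (((d + 1 : ℕ) : ℝ) - p) * ∫ θ, f θ ^ 2 ∂(nu K)

/-- `∫ (Δ f)² ≥ (n - p) ∫ |grad f|² = (n - p) ∫ (-Δ f) f` for even `f`. -/
def LaplacianGradInequality (K : Set (Euc d)) (p : ℝ) : Prop :=
  ∀ f : Sph d → ℝ, IsC2Even f →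
    ∫ θ, laplacian K f θ ^ 2 ∂(nu K) ≥ (((d + 1 : ℕ) : ℝ) - p) * ∫ θ, gradSq K f θ ∂(nu K) ∧
    (((d + 1 : ℕ) : ℝ) - p) * ∫ θ, gradSq K f θ ∂(nu K) =
      (((d + 1 : ℕ) : ℝ) - p) * ∫ θ, -laplacian K f θ * f θ ∂(nu K)

/-- `∫ ‖Hess* f‖² ≥ (2 - p) / (n - p) ∫ (Δ f)²` for even `f`. -/
def HessLaplacianInequality (K : Set (Euc d)) (p : ℝ) : Prop :=
  ∀ f : Sph d → ℝ, IsC2Even f →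
    ∫ θ, tensorNormSq K θ (hessMatrix K f θ) ∂(nu K) ≥
      (2 - p) / (((d + 1 : ℕ) : ℝ) - p) * ∫ θ, laplacian K f θ ^ 2 ∂(nu K)

/-- `∫ ‖Hess* f‖² ≥ (2 - p) ∫ |grad f|²` for even `f`. -/
def HessGradInequality (K : Set (Euc d)) (p : ℝ) : Prop :=
  ∀ f : Sph d → ℝ, IsC2Even f →
    ∫ θ, tensorNormSq K θ (hessMatrix K f θ) ∂(nu K) ≥ (2 - p) * ∫ θ, gradSq K f θ ∂(nu K)

/-- `∫ ‖Hess* f + f g‖² ≥ (n - 1) ∫ f²` for even `f`. -/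
def ShiftedHessInequality (K : Set (Euc d)) : Prop :=
  ∀ f : Sph d → ℝ, IsC2Even f →
    ∫ θ, tensorNormSq K θ (hessMatrix K f θ + f θ • metricMatrix K θ) ∂(nu K) ≥
      (((d + 1 : ℕ) : ℝ) - 1) * ∫ θ, f θ ^ 2 ∂(nu K)

end CentroAffine

end

open scoped Manifold ContDiff Topology RealInnerProductSpace

noncomputable section

namespace CentroAffine

variable {d : ℕ}

section


/-! ### Partial derivatives of functions away from the origin -/

/-! Everything is moved to homogeneous functions on the punctured space. Let `h` be the support
function, of degree one; extend functions on the sphere to degree zero, and let `G = h D²h + dh ⊗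
dh` be the Hessian of `h² / 2`. Then `G` is positive definite, `G⁻¹ dh = y / h`, the centro-affine
Laplacian is `h² tr(G⁻¹ D²F)`, and the measure has density `h ^ (-n) det G`. Frames tilted so that
`h` is constant along them make `G` block diagonal and turn the flat Hessian `D²F` into `Hess* f`
bordered by `-df`. With the norm given by `h⁻² G` this reads `‖D²F‖² = ‖Hess* f‖² + 2 |grad f|²`
(`tensorNormSq_hess`).

Integration by parts rests on two facts: the divergence of a field of degree `1 - n` has spherical
integral zero (`integral_sph_div_eq_zero`), and the cofactor matrix of a Hessian is divergence free
(`Adm.piola`). They give Green's formula (`Adm.integral_mul_lap`) and the Bochner formula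
(`Adm.integral_hs`), which for smooth `f` says `∫ ‖Hess* f‖² = ∫ (Δ f)² - (n - 2) ∫ |grad f|²`.
Through it statements 2, 3 and 4 are compared by linear arithmetic, and expanding the square in 5
gives 4 for `p = 0`. Statement 2 follows from 1 by completing a square (`Adm.gam_le_of_poincare`).
The converse (`Adm.poincare_of_gam_le`) is dual to this: a mean-zero function has to be approximated
in `L²` by Laplacians of smooth even functions.

That density (`rangeDense`) is a method of continuity. For the ball it follows from an explicit
recursion for powers of linear forms and Stone-Weierstrass. It is carried along the segment of
support functions from the ball to `K` by the a priori bound `∫ ‖D²u‖² ≤ 2 ∫ (Δ u)²`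
(`Adm.integral_hs_le`). For `n ≥ 3` the bound comes from Bochner and `2 |grad u|² ≤ ‖D²u‖²`. Density
also extends Bochner, as an inequality in the useful direction, to functions that are only `C²`
(`Adm.bochner_le`).

For `n = 2` the bound needs the even planar inequality (`Adm.planar`), that is, statement 1 with `p
= 0`. A Picone argument against the eigenfunctions `⟨a, y⟩ / h` handles even functions with a zero;
applying it to `f - f(φ)` and averaging over `φ` improves the constant from `1` to `2`. The same
inequality settles 3 ⇒ 1 for `n = 2` and `p ≥ 0`, where 3 itself carries no information. -/

/-- The `i`-th partial derivative. -/
def pd (i : Fin (d + 1)) (F : Euc d → ℝ) (y : Euc d) : ℝ :=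
  fderiv ℝ F y (EuclideanSpace.single i 1)

/-- Functions of class `C^m` away from the origin. -/
def CD (m : WithTop ℕ∞) (F : Euc d → ℝ) : Prop := ContDiffOn ℝ m F {0}ᶜ

/-- Functions positively homogeneous of degree `r` away from the origin. -/
def Hom (r : ℤ) (F : Euc d → ℝ) : Prop :=
  ∀ c : ℝ, 0 < c → ∀ y, y ≠ 0 → F (c • y) = c ^ r * F y

variable {m k : WithTop ℕ∞} {F G : Euc d → ℝ} {y : Euc d} {i j : Fin (d + 1)} {r s : ℤ}

theorem compl_zero_mem_nhds (hy : y ≠ 0) : ({0}ᶜ : Set (Euc d)) ∈ 𝓝 y :=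
  isOpen_compl_singleton.mem_nhds hy

theorem CD.contDiffAt (h : CD m F) (hy : y ≠ 0) : ContDiffAt ℝ m F y :=
  ContDiffOn.contDiffAt h (compl_zero_mem_nhds hy)

theorem cd_of_contDiffAt (h : ∀ y, y ≠ 0 → ContDiffAt ℝ m F y) : CD m F :=
  fun y hy => (h y hy).contDiffWithinAt

theorem CD.of_le (h : CD m F) (hk : k ≤ m) : CD k F := ContDiffOn.of_le h hk

theorem CD.diff (h : CD m F) (hm : 1 ≤ m) (hy : y ≠ 0) : DifferentiableAt ℝ F y :=
  (h.contDiffAt hy).differentiableAt (by rintro rfl; simp at hm)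

theorem CD.contAt (h : CD m F) (hy : y ≠ 0) : ContinuousAt F y := (h.contDiffAt hy).continuousAt

theorem CD.add (hF : CD m F) (hG : CD m G) : CD m (fun y => F y + G y) := ContDiffOn.add hF hG
theorem CD.sub (hF : CD m F) (hG : CD m G) : CD m (fun y => F y - G y) := ContDiffOn.sub hF hG
theorem CD.neg (hF : CD m F) : CD m (fun y => -F y) := ContDiffOn.neg hF
theorem CD.mul (hF : CD m F) (hG : CD m G) : CD m (fun y => F y * G y) := ContDiffOn.mul hF hG
theorem CD.pow (hF : CD m F) (e : ℕ) : CD m (fun y => F y ^ e) := ContDiffOn.pow hF e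
theorem CD.sum {ι : Type*} {s : Finset ι} {F : ι → Euc d → ℝ} (hF : ∀ a ∈ s, CD m (F a)) :
    CD m (fun y => ∑ a ∈ s, F a y) := ContDiffOn.sum hF
theorem CD.prod {ι : Type*} {s : Finset ι} {F : ι → Euc d → ℝ} (hF : ∀ a ∈ s, CD m (F a)) :
    CD m (fun y => ∏ a ∈ s, F a y) := contDiffOn_prod hF
theorem cd_const (c : ℝ) : CD (d := d) m (fun _ => c) := contDiffOn_const
theorem CD.inv (hF : CD m F) (h0 : ∀ y, y ≠ 0 → F y ≠ 0) : CD m (fun y => (F y)⁻¹) :=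
  ContDiffOn.inv hF fun y hy => h0 y hy

theorem CD.zpow (hF : CD m F) (h0 : ∀ y, y ≠ 0 → F y ≠ 0) (e : ℤ) : CD m (fun y => F y ^ e) := by
  cases e with
  | ofNat e => simpa using hF.pow e
  | negSucc e => simpa using (hF.pow (e + 1)).inv fun y hy => pow_ne_zero _ (h0 y hy)

theorem CD.pd (h : CD m F) (hk : k + 1 ≤ m) (i : Fin (d + 1)) : CD k (pd i F) := by
  have h1 : ContDiffOn ℝ k (fderiv ℝ F) {0}ᶜ :=
    ContDiffOn.fderiv_of_isOpen h isOpen_compl_singleton hk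
  exact h1.clm_apply contDiffOn_const

theorem cd_coord (i : Fin (d + 1)) : CD (d := d) m (fun y => y i) :=
  ContDiff.contDiffOn (EuclideanSpace.proj (𝕜 := ℝ) i).contDiff

theorem pd_congr (hFG : ∀ y, y ≠ 0 → F y = G y) (hy : y ≠ 0) : pd i F y = pd i G y := by
  have : F =ᶠ[𝓝 y] G := Filter.eventually_of_mem (compl_zero_mem_nhds hy) hFG
  simp [pd, this.fderiv_eq]

theorem pd_const (c : ℝ) : pd i (fun _ : Euc d => c) y = 0 := by simp [pd]

theorem pd_add (hF : CD m F) (hG : CD m G) (hm : 1 ≤ m) (hy : y ≠ 0) :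
    pd i (fun y => F y + G y) y = pd i F y + pd i G y := by
  have := fderiv_add (hF.diff hm hy) (hG.diff hm hy)
  simp only [pd]
  rw [show (fun y => F y + G y) = F + G from rfl, this]; rfl

theorem pd_sub (hF : CD m F) (hG : CD m G) (hm : 1 ≤ m) (hy : y ≠ 0) :
    pd i (fun y => F y - G y) y = pd i F y - pd i G y := by
  have := fderiv_sub (hF.diff hm hy) (hG.diff hm hy)
  simp only [pd]
  rw [show (fun y => F y - G y) = F - G from rfl, this]; rfl

theorem pd_neg : pd i (fun y => -F y) y = -pd i F y := by
  have := fderiv_neg (f := F) (𝕜 := ℝ) (x := y)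
  simp only [pd]
  rw [show (fun y => -F y) = -F from rfl, this]; rfl

theorem pd_mul (hF : CD m F) (hG : CD m G) (hm : 1 ≤ m) (hy : y ≠ 0) :
    pd i (fun y => F y * G y) y = pd i F y * G y + F y * pd i G y := by
  have := fderiv_mul (hF.diff hm hy) (hG.diff hm hy)
  simp only [pd]
  rw [show (fun y => F y * G y) = F * G from rfl, this]; simp; ring

theorem pd_const_mul (c : ℝ) (hF : CD m F) (hm : 1 ≤ m) (hy : y ≠ 0) :
    pd i (fun y => c * F y) y = c * pd i F y := by
  rw [pd_mul (cd_const c) hF hm hy, pd_const]; ring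

theorem pd_sum {ι : Type*} {s : Finset ι} {F : ι → Euc d → ℝ} (hF : ∀ a ∈ s, CD m (F a))
    (hm : 1 ≤ m) (hy : y ≠ 0) :
    pd i (fun y => ∑ a ∈ s, F a y) y = ∑ a ∈ s, pd i (F a) y := by
  have := fderiv_fun_sum (u := s) (A := F) (𝕜 := ℝ) (x := y) fun a ha => (hF a ha).diff hm hy
  simp only [pd]
  rw [this]; simp

theorem pd_comp {g : ℝ → ℝ} {g' : ℝ} (hF : CD m F) (hm : 1 ≤ m) (hy : y ≠ 0)
    (hg : HasDerivAt g g' (F y)) :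
    pd i (fun y => g (F y)) y = g' * pd i F y := by
  have := (hg.comp_hasFDerivAt y (hF.diff hm hy).hasFDerivAt).fderiv
  simp only [pd]
  rw [show (fun y => g (F y)) = g ∘ F from rfl, this]; simp

theorem pd_inv (hF : CD m F) (hm : 1 ≤ m) (hy : y ≠ 0) (h0 : F y ≠ 0) :
    pd i (fun y => (F y)⁻¹) y = -(F y ^ 2)⁻¹ * pd i F y :=
  pd_comp hF hm hy (hasDerivAt_inv h0)

theorem pd_zpow (hF : CD m F) (hm : 1 ≤ m) (hy : y ≠ 0) (h0 : F y ≠ 0) (e : ℤ) :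
    pd i (fun y => F y ^ e) y = e * F y ^ (e - 1) * pd i F y :=
  pd_comp hF hm hy (hasDerivAt_zpow e (F y) (Or.inl h0))

theorem pd_pow (hF : CD m F) (hm : 1 ≤ m) (hy : y ≠ 0) (e : ℕ) :
    pd i (fun y => F y ^ e) y = e * F y ^ (e - 1) * pd i F y :=
  pd_comp hF hm hy (hasDerivAt_pow e (F y))

theorem pd_coord : pd i (fun y : Euc d => y j) y = if i = j then 1 else 0 := by
  have := (EuclideanSpace.proj (𝕜 := ℝ) j : Euc d →L[ℝ] ℝ).fderiv (x := y)
  simp only [pd]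
  rw [show (fun y : Euc d => y j) = (EuclideanSpace.proj (𝕜 := ℝ) j : Euc d →L[ℝ] ℝ) from rfl,
    this]
  simp [eq_comm]

theorem euc_eq_sum (v : Euc d) : v = ∑ i, v i • EuclideanSpace.single i (1 : ℝ) := by
  have := (EuclideanSpace.basisFun (Fin (d + 1)) ℝ).sum_repr v
  simpa using this.symm

theorem fderiv_eq_sum (F : Euc d → ℝ) (y v : Euc d) : fderiv ℝ F y v = ∑ i, v i * pd i F y := by
  conv_lhs => rw [euc_eq_sum v]
  simp [pd]

theorem CD.diff_fderiv (h : CD m F) (hm : 2 ≤ m) (hy : y ≠ 0) :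
    DifferentiableAt ℝ (fderiv ℝ F) y :=
  ((h.contDiffAt hy).fderiv_right (m := 1) (by simpa [one_add_one_eq_two] using hm)).differentiableAt
    one_ne_zero

theorem pd_pd_eq (h : CD m F) (hm : 2 ≤ m) (hy : y ≠ 0) (i j : Fin (d + 1)) :
    pd i (pd j F) y = fderiv ℝ (fderiv ℝ F) y (EuclideanSpace.single i 1)
      (EuclideanSpace.single j 1) := by
  have := fderiv_clm_apply (h.diff_fderiv hm hy)
    (differentiableAt_const (c := (EuclideanSpace.single j 1 : Euc d)))
  simp only [pd]
  change fderiv ℝ (fun y => fderiv ℝ F y (EuclideanSpace.single j 1)) y _ = _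
  rw [this]; simp

theorem pd_comm (h : CD m F) (hm : 2 ≤ m) (hy : y ≠ 0) (i j : Fin (d + 1)) :
    pd i (pd j F) y = pd j (pd i F) y := by
  rw [pd_pd_eq h hm hy, pd_pd_eq h hm hy]
  exact ((h.contDiffAt hy).isSymmSndFDerivAt (by simpa using hm)).eq _ _

theorem fderiv_fderiv_eq_sum (h : CD m F) (hm : 2 ≤ m) (hy : y ≠ 0) (u v : Euc d) :
    fderiv ℝ (fderiv ℝ F) y u v = ∑ i, ∑ j, u i * v j * pd i (pd j F) y := by
  conv_lhs => rw [euc_eq_sum u, euc_eq_sum v]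
  simp only [map_sum, map_smul, _root_.sum_apply, _root_.smul_apply,
    smul_eq_mul, pd_pd_eq h hm hy, Finset.mul_sum]
  rw [Finset.sum_comm]
  refine Finset.sum_congr rfl fun i _ => Finset.sum_congr rfl fun j _ => by ring

/-- Differentiating `F (c • y) = c ^ r * F y` in `y` puts a factor `c` on the left, which lowers the
degree by one. -/
theorem Hom.pd (hF : Hom r F) (i : Fin (d + 1)) : Hom (r - 1) (pd i F) := by
  intro c hc y hy
  have h1 : (fun z => F (c • z)) =ᶠ[𝓝 y] fun z => c ^ r * F z :=
    Filter.eventually_of_mem (compl_zero_mem_nhds hy) fun z hz => hF c hc z hz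
  have h2 := h1.fderiv_eq (𝕜 := ℝ)
  rw [fderiv_comp_smul, show (fun z => c ^ r * F z) = c ^ r • F from rfl, fderiv_const_smul_field] at h2
  have h3 := congrArg (fun L => L (EuclideanSpace.single i 1)) h2
  simp only [_root_.smul_apply, smul_eq_mul] at h3
  change c * CentroAffine.pd i F (c • y) = c ^ r * CentroAffine.pd i F y at h3
  rw [zpow_sub_one₀ hc.ne']
  field_simp
  linarith

theorem Hom.mul (hF : Hom r F) (hG : Hom s G) : Hom (r + s) (fun y => F y * G y) := by
  intro c hc y hy
  simp only [hF c hc y hy, hG c hc y hy, zpow_add₀ hc.ne']; ring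

theorem Hom.cast (hF : Hom r F) (h : r = s) : Hom s F := h ▸ hF

theorem Hom.add (hF : Hom r F) (hG : Hom r G) : Hom r (fun y => F y + G y) := by
  intro c hc y hy
  simp only [hF c hc y hy, hG c hc y hy]; ring

theorem Hom.sub (hF : Hom r F) (hG : Hom r G) : Hom r (fun y => F y - G y) := by
  intro c hc y hy
  simp only [hF c hc y hy, hG c hc y hy]; ring

theorem hom_const (c : ℝ) : Hom (d := d) 0 (fun _ => c) := by
  intro c hc y hy
  simp

theorem Hom.sum {ι : Type*} {s : Finset ι} {F : ι → Euc d → ℝ} (hF : ∀ a ∈ s, Hom r (F a)) :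
    Hom r (fun y => ∑ a ∈ s, F a y) := by
  intro c hc y hy
  simp only [Finset.mul_sum]
  exact Finset.sum_congr rfl fun a ha => hF a ha c hc y hy

theorem Hom.prod_zero {ι : Type*} {s : Finset ι} {F : ι → Euc d → ℝ}
    (hF : ∀ a ∈ s, Hom 0 (F a)) : Hom 0 (fun y => ∏ a ∈ s, F a y) := by
  intro c hc y hy
  simp only [zpow_zero, one_mul]
  exact Finset.prod_congr rfl fun a ha => by simpa using hF a ha c hc y hy

theorem Hom.zpow (hF : Hom r F) (e : ℤ) : Hom (r * e) (fun y => F y ^ e) := by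
  intro c hc y hy
  simp only [hF c hc y hy, mul_zpow, zpow_mul]

theorem Hom.inv (hF : Hom r F) : Hom (-r) (fun y => (F y)⁻¹) := by
  intro c hc y hy
  simp only [hF c hc y hy, mul_inv, zpow_neg]

theorem hom_coord (i : Fin (d + 1)) : Hom (d := d) 1 (fun y => y i) := by
  intro c hc y hy
  simp

/-- Euler's identity for homogeneous functions. -/
theorem Hom.euler (hF : Hom r F) (hc : CD m F) (hm : 1 ≤ m) (hy : y ≠ 0) :
    ∑ i, y i * CentroAffine.pd i F y = r * F y := by
  rw [← fderiv_eq_sum]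
  have h1 : HasDerivAt (fun c : ℝ => F (c • y)) (fderiv ℝ F y y) 1 := by
    have h2 : HasDerivAt (fun c : ℝ => c • y) y 1 := by
      simpa using (hasDerivAt_id (1 : ℝ)).smul_const y
    have h3 : HasFDerivAt F (fderiv ℝ F y) ((1 : ℝ) • y) := by
      simpa using (hc.diff hm hy).hasFDerivAt
    exact h3.comp_hasDerivAt (1 : ℝ) h2
  have h2 : HasDerivAt (fun c : ℝ => c ^ r * F y) (r * F y) 1 := by
    simpa using (hasDerivAt_zpow r (1 : ℝ) (Or.inl one_ne_zero)).mul_const (F y)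
  refine h1.unique (h2.congr_of_eventuallyEq ?_)
  filter_upwards [lt_mem_nhds (zero_lt_one' ℝ)] with c hc
  exact hF c hc y hy

end

section


/-! ### Integration over the sphere -/

open MeasureTheory Set

/-- The surface measure of the unit sphere. -/
abbrev sig (d : ℕ) : Measure (Sph d) := (volume : Measure (Euc d)).toSphere

variable {m : WithTop ℕ∞} {F G : Euc d → ℝ} {y : Euc d} {i j : Fin (d + 1)} {r s : ℤ}

theorem sph_ne_zero (θ : Sph d) : (θ : Euc d) ≠ 0 := by
  intro h
  have := θ.2
  simp [h] at this

theorem sph_norm (θ : Sph d) : ‖(θ : Euc d)‖ = 1 := by simp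

theorem sph_sum_sq (θ : Sph d) : ∑ i, (θ : Euc d) i * (θ : Euc d) i = 1 := by
  have := EuclideanSpace.real_norm_sq_eq (θ : Euc d)
  rw [sph_norm] at this
  simp only [← pow_two, ← this]; norm_num

theorem CD.continuous_sph (h : CD m F) : Continuous fun θ : Sph d => F θ :=
  (ContDiffOn.continuousOn h).comp_continuous continuous_subtype_val fun θ => sph_ne_zero θ

theorem integrable_sph {f : Sph d → ℝ} (hf : Continuous f) : Integrable f (sig d) :=
  hf.integrable_of_hasCompactSupport (HasCompactSupport.of_compactSpace f)

/-- Polar coordinates for homogeneous functions. -/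
theorem integral_radial_mul (χ : ℝ → ℝ) (hF : Hom r F) :
    ∫ y, χ ‖y‖ * F y = (∫ t in Ioi (0 : ℝ), t ^ d * (χ t * t ^ r)) * ∫ θ, F θ ∂(sig d) := by
  have hdim : Module.finrank ℝ (Euc d) - 1 = d := by simp
  calc ∫ y, χ ‖y‖ * F y
      = ∫ y : ({(0 : Euc d)}ᶜ : Set (Euc d)), χ ‖y.1‖ * F y ∂((volume : Measure (Euc d)).comap (↑)) := by
        rw [integral_subtype_comap (measurableSet_singleton _).compl fun y : Euc d => χ ‖y‖ * F y,
          restrict_compl_singleton]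
    _ = ∫ x, F x.1 * (χ x.2 * (x.2 : ℝ) ^ r)
          ∂(sig d).prod (.volumeIoiPow (Module.finrank ℝ (Euc d) - 1)) := by
        rw [← (volume : Measure (Euc d)).measurePreserving_homeomorphUnitSphereProd.integral_comp
          (Homeomorph.measurableEmbedding _)]
        refine integral_congr_ae (Filter.Eventually.of_forall fun y => ?_)
        have hy : 0 < ‖(y : Euc d)‖ := norm_pos_iff.2 y.2
        simp only [homeomorphUnitSphereProd_apply_fst_coe, homeomorphUnitSphereProd_apply_snd_coe]
        -- Homogeneity writes `F (y / ‖y‖)` as `‖y‖ ^ (-r) * F y`, so in polar coordinates the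
        -- integrand is a product of an angular and a radial factor.
        rw [hF _ (inv_pos.2 hy) _ y.2, inv_zpow]
        field_simp
    _ = (∫ θ, F θ ∂(sig d)) *
          ∫ t : Ioi (0 : ℝ), χ t * (t : ℝ) ^ r ∂(.volumeIoiPow (Module.finrank ℝ (Euc d) - 1)) :=
        integral_prod_mul (fun θ : Sph d => F θ) fun t : Ioi (0 : ℝ) => χ t * (t : ℝ) ^ r
    _ = _ := by
        rw [mul_comm]
        congr 1
        simp only [Measure.volumeIoiPow, ENNReal.ofReal]
        rw [integral_withDensity_eq_integral_smul,
          integral_subtype_comap measurableSet_Ioi fun a : ℝ =>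
            Real.toNNReal (a ^ (Module.finrank ℝ (Euc d) - 1)) • (χ a * a ^ r),
          setIntegral_congr_fun measurableSet_Ioi fun x hx ↦ ?_]
        · rw [NNReal.smul_def, Real.coe_toNNReal _ (pow_nonneg hx.out.le _), hdim, smul_eq_mul]
        · exact (measurable_subtype_coe.pow_const _).real_toNNReal

/-- A bump function on the line with support away from zero. -/
def radialBump : ContDiffBump (3 / 2 : ℝ) := ⟨1 / 8, 1 / 4, by norm_num, by norm_num⟩

theorem radialBump_zero {t : ℝ} (ht : t ≤ 1) : radialBump t = 0 := by
  apply radialBump.zero_of_le_dist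
  rw [Real.dist_eq, abs_sub_comm, abs_of_nonneg (by linarith)]
  simp only [radialBump]; linarith

theorem radialBump_eventually_zero {t : ℝ} (ht : t < 1) : radialBump =ᶠ[𝓝 t] fun _ => (0 : ℝ) := by
  filter_upwards [Iio_mem_nhds ht] with s hs
  exact radialBump_zero (le_of_lt hs)

theorem radialBump_comp_norm_contDiff : ContDiff ℝ 1 fun y : Euc d => radialBump ‖y‖ := by
  rw [contDiff_iff_contDiffAt]
  intro y
  by_cases hy : y = 0
  · have : (fun y : Euc d => radialBump ‖y‖) =ᶠ[𝓝 y] fun _ => (0 : ℝ) := by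
      subst hy
      have h0 : Filter.Tendsto (fun y : Euc d => ‖y‖) (𝓝 0) (𝓝 0) := by
        simpa using (continuous_norm (E := Euc d)).tendsto 0
      exact h0.eventually (radialBump_eventually_zero zero_lt_one)
    exact contDiffAt_const.congr_of_eventuallyEq this
  · exact radialBump.contDiff.contDiffAt.comp y (contDiffAt_norm ℝ hy)

theorem radialBump_comp_norm_support : HasCompactSupport fun y : Euc d => radialBump ‖y‖ := by
  refine HasCompactSupport.intro (isCompact_closedBall (0 : Euc d) 2) fun y hy => ?_
  apply radialBump.zero_of_le_dist
  simp only [Metric.mem_closedBall, dist_zero_right, not_le] at hy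
  rw [Real.dist_eq, abs_of_nonneg (by linarith)]
  simp only [radialBump]; linarith

theorem contDiff_radialBump_mul (h : CD 1 F) :
    ContDiff ℝ 1 fun y : Euc d => radialBump ‖y‖ * F y := by
  rw [contDiff_iff_contDiffAt]
  intro y
  by_cases hy : y = 0
  · have : (fun y : Euc d => radialBump ‖y‖ * F y) =ᶠ[𝓝 y] fun _ => (0 : ℝ) := by
      subst hy
      have h0 : Filter.Tendsto (fun y : Euc d => ‖y‖) (𝓝 0) (𝓝 0) := by
        simpa using (continuous_norm (E := Euc d)).tendsto 0
      filter_upwards [h0.eventually (radialBump_eventually_zero zero_lt_one)] with z hz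
      rw [hz, zero_mul]
    exact contDiffAt_const.congr_of_eventuallyEq this
  · exact radialBump_comp_norm_contDiff.contDiffAt.mul (h.contDiffAt hy)

/-- Integration by parts against the constant function `1`; compact support supplies the
integrability. -/
theorem integral_pd_eq_zero {F : Euc d → ℝ} (hF : ContDiff ℝ 1 F) (hs : HasCompactSupport F)
    (i : Fin (d + 1)) : ∫ y, pd i F y = 0 := by
  have hc : Continuous (pd i F) := (hF.continuous_fderiv one_ne_zero).clm_apply continuous_const
  have hi : Integrable (pd i F) :=
    hc.integrable_of_hasCompactSupport ((hs.fderiv ℝ).comp_left (g := fun L : Euc d →L[ℝ] ℝ =>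
      L (EuclideanSpace.single i 1)) rfl)
  have hF' : Integrable F := hF.continuous.integrable_of_hasCompactSupport hs
  have := integral_mul_fderiv_eq_neg_fderiv_mul_of_integrable (μ := (volume : Measure (Euc d)))
    (f := fun _ : Euc d => (1 : ℝ)) (g := F) (v := EuclideanSpace.single i 1)
    (by simp) (by simp only [one_mul]; exact hi) (by simpa using hF') (fun x _ => differentiableAt_const _)
    (fun x _ => hF.differentiable one_ne_zero x)
  simpa [pd] using this

theorem cd_norm : CD (d := d) m fun y => ‖y‖ := by
  refine cd_of_contDiffAt fun y hy => ?_
  exact contDiffAt_norm ℝ hy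

theorem hom_norm : Hom (d := d) 1 fun y => ‖y‖ := by
  intro c hc y hy
  simp [norm_smul, abs_of_pos hc]

theorem norm_sq_eq_sum (y : Euc d) : ‖y‖ ^ 2 = ∑ i, y i * y i := by
  rw [EuclideanSpace.real_norm_sq_eq]; simp only [pow_two]

theorem pd_norm (hy : y ≠ 0) : pd i (fun y : Euc d => ‖y‖) y = y i * ‖y‖⁻¹ := by
  have h1 : pd i (fun y : Euc d => ‖y‖ ^ 2) y = 2 * y i := by
    rw [pd_congr (G := fun y => ∑ j, y j * y j) (fun y _ => norm_sq_eq_sum y) hy,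
      pd_sum (m := 1) (fun j _ => (cd_coord j).mul (cd_coord j)) le_rfl hy]
    simp only [pd_mul (m := 1) (cd_coord _) (cd_coord _) le_rfl hy, pd_coord]
    simp [← two_mul]
  rw [pd_pow (m := 1) cd_norm le_rfl hy] at h1
  have : ‖y‖ ≠ 0 := norm_ne_zero_iff.2 hy
  field_simp
  simp at h1
  linarith

/-- The divergence of a homogeneous vector field of degree `1 - n` integrates to zero over the
unit sphere. -/
theorem integral_sph_div_eq_zero {Y : Fin (d + 1) → Euc d → ℝ} (hY : ∀ i, CD 1 (Y i))
    (hh : ∀ i, Hom (-(d : ℤ)) (Y i)) : ∫ θ : Sph d, ∑ i, pd i (Y i) θ ∂(sig d) = 0 := by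
  -- The field times the cutoff `radialBump ‖y‖` is `C¹` with compact support, so its divergence
  -- integrates to zero over the whole space. The product rule splits that divergence into two
  -- terms, each a radial factor times a homogeneous function, and polar coordinates turn each into
  -- a radial integral times a spherical one.
  have hχ1 : ContDiff ℝ 1 (radialBump : ℝ → ℝ) := radialBump.contDiff
  have hint : ∀ i, Integrable (pd i fun y : Euc d => radialBump ‖y‖ * Y i y) := fun i =>
    (((contDiff_radialBump_mul (hY i)).continuous_fderiv one_ne_zero).clm_apply
      continuous_const).integrable_of_hasCompactSupport
      (((radialBump_comp_norm_support.mul_right).fderiv ℝ).comp_left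
        (g := fun L : Euc d →L[ℝ] ℝ => L (EuclideanSpace.single i 1)) rfl)
  have hexp : ∀ (i) (y : Euc d), pd i (fun y : Euc d => radialBump ‖y‖ * Y i y) y
      = deriv radialBump ‖y‖ * (y i * Y i y * ‖y‖⁻¹) + radialBump ‖y‖ * pd i (Y i) y := by
    intro i y
    by_cases hy : y = 0
    · subst hy
      have h0 : Filter.Tendsto (fun y : Euc d => ‖y‖) (𝓝 0) (𝓝 0) := by
        simpa using (continuous_norm (E := Euc d)).tendsto 0
      have h1 : (fun y : Euc d => radialBump ‖y‖ * Y i y) =ᶠ[𝓝 0] fun _ => (0 : ℝ) := by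
        filter_upwards [h0.eventually (radialBump_eventually_zero zero_lt_one)] with z hz
        rw [hz, zero_mul]
      rw [pd, h1.fderiv_eq]
      simp [radialBump_zero zero_le_one]
    · have hc : CD 1 fun y : Euc d => radialBump ‖y‖ :=
        radialBump_comp_norm_contDiff.contDiffOn
      rw [pd_mul hc (hY i) le_rfl hy, pd_comp (m := 1) cd_norm le_rfl hy
        ((hχ1.differentiable one_ne_zero _).hasDerivAt), pd_norm hy]
      ring
  have h1 : ∫ y : Euc d, ∑ i, pd i (fun y : Euc d => radialBump ‖y‖ * Y i y) y = 0 := by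
    rw [integral_finsetSum _ fun i _ => hint i]
    exact Finset.sum_eq_zero fun i _ =>
      integral_pd_eq_zero (contDiff_radialBump_mul (hY i)) radialBump_comp_norm_support.mul_right i
  have h2 : ∀ y : Euc d, ∑ i, pd i (fun y : Euc d => radialBump ‖y‖ * Y i y) y
      = deriv radialBump ‖y‖ * ((∑ i, y i * Y i y) * ‖y‖⁻¹)
        + radialBump ‖y‖ * ∑ i, pd i (Y i) y := by
    intro y
    simp only [hexp, Finset.sum_add_distrib, ← Finset.mul_sum, Finset.sum_mul]
  have hA : Hom (-(d : ℤ)) fun y : Euc d => (∑ i, y i * Y i y) * ‖y‖⁻¹ :=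
    ((Hom.sum fun i _ => (hom_coord i).mul (hh i)).mul hom_norm.inv).cast (by ring)
  have hB : Hom (-(d : ℤ) - 1) fun y : Euc d => ∑ i, pd i (Y i) y :=
    Hom.sum fun i _ => (hh i).pd i
  have hAc : CD 1 fun y : Euc d => (∑ i, y i * Y i y) * ‖y‖⁻¹ :=
    (CD.sum fun i _ => (cd_coord i).mul (hY i)).mul (cd_norm.inv fun y hy => norm_ne_zero_iff.2 hy)
  have hderiv0 : ∀ t : ℝ, t < 1 → deriv radialBump t = 0 := fun t ht => by
    rw [(radialBump_eventually_zero ht).deriv_eq]; simp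
  have hAi : Integrable fun y : Euc d =>
      deriv radialBump ‖y‖ * ((∑ i, y i * Y i y) * ‖y‖⁻¹) := by
    refine Continuous.integrable_of_hasCompactSupport ?_ ?_
    · rw [continuous_iff_continuousAt]
      intro y
      by_cases hy : y = 0
      · subst hy
        have h0 : Filter.Tendsto (fun y : Euc d => ‖y‖) (𝓝 0) (𝓝 0) := by
          simpa using (continuous_norm (E := Euc d)).tendsto 0
        refine (continuousAt_const (y := (0 : ℝ))).congr ?_
        filter_upwards [h0.eventually (gt_mem_nhds zero_lt_one)] with z hz
        rw [hderiv0 _ hz, zero_mul]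
      · exact ((hχ1.continuous_deriv le_rfl).comp continuous_norm).continuousAt.mul (hAc.contAt hy)
    · refine HasCompactSupport.intro (isCompact_closedBall (0 : Euc d) 2) fun y hy => ?_
      have hy' : 2 < ‖y‖ := by simpa using hy
      have : (radialBump : ℝ → ℝ) =ᶠ[𝓝 ‖y‖] fun _ => (0 : ℝ) := by
        filter_upwards [lt_mem_nhds hy'] with t ht
        apply radialBump.zero_of_le_dist
        rw [Real.dist_eq, abs_of_nonneg (by linarith)]
        simp only [radialBump]; linarith
      rw [this.deriv_eq]; simp
  have hTi : Integrable fun y : Euc d =>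
      ∑ i, pd i (fun y : Euc d => radialBump ‖y‖ * Y i y) y := integrable_finsetSum _ fun i _ => hint i
  have hBi : Integrable fun y : Euc d => radialBump ‖y‖ * ∑ i, pd i (Y i) y := by
    refine (hTi.sub hAi).congr (Filter.Eventually.of_forall fun y => ?_)
    simp only [Pi.sub_apply, h2]; ring
  simp only [h2] at h1
  rw [integral_add hAi hBi, integral_radial_mul _ hA, integral_radial_mul _ hB] at h1
  -- The degree `-d` exactly cancels the Jacobian `t ^ d`, and the integral of the derivative of the
  -- bump is zero. This is where the degree matters.
  have h3 : ∫ t in Ioi (0 : ℝ), t ^ d * (deriv radialBump t * t ^ (-(d : ℤ))) = 0 := by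
    have : ∫ t in Ioi (0 : ℝ), deriv radialBump t = 0 := by
      rw [radialBump.hasCompactSupport.integral_Ioi_deriv_eq hχ1, radialBump_zero zero_le_one,
        neg_zero]
    refine Eq.trans ?_ this
    refine setIntegral_congr_fun measurableSet_Ioi fun t ht => ?_
    have : t ^ d ≠ 0 := pow_ne_zero _ (ne_of_gt (mem_Ioi.1 ht))
    simp only [zpow_neg, zpow_natCast]
    field_simp
  -- The factor in front of the spherical integral of the divergence is the integral of `radialBump
  -- t / t`; being positive, it can be cancelled.
  have h4 : 0 < ∫ t in Ioi (0 : ℝ), t ^ d * (radialBump t * t ^ (-(d : ℤ) - 1)) := by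
    have h5 : ∀ t : ℝ, t ∈ Ioi (0 : ℝ) →
        t ^ d * (radialBump t * t ^ (-(d : ℤ) - 1)) = radialBump t * t⁻¹ := fun t ht => by
      have h6 : t ≠ 0 := ne_of_gt ht
      have : t ^ d ≠ 0 := pow_ne_zero _ h6
      rw [zpow_sub_one₀ h6, zpow_neg, zpow_natCast]
      field_simp
    rw [setIntegral_congr_fun measurableSet_Ioi h5]
    have h6 : Continuous fun t : ℝ => radialBump t * t⁻¹ := by
      rw [continuous_iff_continuousAt]
      intro t
      by_cases ht : t = 0
      · subst ht
        refine (continuousAt_const (y := (0 : ℝ))).congr ?_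
        filter_upwards [radialBump_eventually_zero zero_lt_one] with z hz
        rw [hz, zero_mul]
      · exact radialBump.continuous.continuousAt.mul (continuousAt_inv₀ ht)
    have h7 : HasCompactSupport fun t : ℝ => radialBump t * t⁻¹ :=
      radialBump.hasCompactSupport.mul_right
    have h8 : ∀ t : ℝ, 0 ≤ radialBump t * t⁻¹ := fun t => by
      by_cases ht : t ≤ 1
      · rw [radialBump_zero ht, zero_mul]
      · exact mul_nonneg radialBump.nonneg (inv_nonneg.2 (zero_le_one.trans (not_le.1 ht).le))
    have h9 : ∫ t in Ioi (0 : ℝ), radialBump t * t⁻¹ = ∫ t : ℝ, radialBump t * t⁻¹ := by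
      refine setIntegral_eq_integral_of_forall_compl_eq_zero fun t ht => ?_
      rw [radialBump_zero (by simp at ht; linarith), zero_mul]
    rw [h9]
    refine h6.integral_pos_of_hasCompactSupport_nonneg_nonzero h7 h8 (x := 3 / 2) ?_
    have : radialBump (3 / 2 : ℝ) = 1 := radialBump.one_of_mem_closedBall (by
      simp [radialBump])
    rw [this]; norm_num
  rw [h3, zero_mul, zero_add] at h1
  exact (mul_eq_zero.1 h1).resolve_left h4.ne'

end

section


/-! ### Derivatives of matrices of functions -/

variable {m : WithTop ℕ∞} {y : Euc d}

section MatrixFunctions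

variable {ι : Type*} [DecidableEq ι] {A : Euc d → Matrix ι ι ℝ}

theorem pd_prod {F : ι → Euc d → ℝ} (s : Finset ι) (hF : ∀ a, CD m (F a)) (hm : 1 ≤ m) (hy : y ≠ 0)
    (k : Fin (d + 1)) :
    pd k (fun y => ∏ a ∈ s, F a y) y = ∑ a ∈ s, (∏ b ∈ s.erase a, F b y) * pd k (F a) y := by
  induction s using Finset.induction_on with
  | empty => simp [pd_const]
  | insert a s ha ih =>
    simp only [Finset.prod_insert ha, Finset.sum_insert ha, Finset.erase_insert ha]
    rw [pd_mul (hF a) (CD.prod fun b _ => hF b) hm hy, ih, Finset.mul_sum, mul_comm]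
    congr 1
    refine Finset.sum_congr rfl fun b hb => ?_
    have hab : a ≠ b := fun h => ha (h ▸ hb)
    rw [Finset.erase_insert_of_ne hab, Finset.prod_insert (fun h => ha (Finset.mem_of_mem_erase h))]
    ring

variable [Fintype ι]

theorem cd_det (hA : ∀ i j, CD m fun y => A y i j) : CD m fun y => (A y).det := by
  simp only [Matrix.det_apply']
  exact CD.sum fun σ _ => (cd_const _).mul (CD.prod fun a _ => hA _ _)

theorem cd_adjugate (hA : ∀ i j, CD m fun y => A y i j) (i j : ι) :
    CD m fun y => (A y).adjugate i j := by
  simp only [Matrix.adjugate_apply]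
  refine cd_det fun a b => ?_
  simp only [Matrix.updateRow_apply]
  split_ifs
  · exact cd_const _
  · exact hA a b

theorem hom_det (hA : ∀ i j, Hom 0 fun y => A y i j) : Hom 0 fun y => (A y).det := by
  simp only [Matrix.det_apply']
  exact Hom.sum fun σ _ => ((hom_const _).mul (Hom.prod_zero fun a _ => hA _ _)).cast (by simp)

theorem hom_adjugate (hA : ∀ i j, Hom 0 fun y => A y i j) (i j : ι) :
    Hom 0 fun y => (A y).adjugate i j := by
  simp only [Matrix.adjugate_apply]
  refine hom_det fun a b => ?_
  simp only [Matrix.updateRow_apply]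
  split_ifs
  · exact hom_const _
  · exact hA a b

/-- Jacobi's formula. -/
theorem pd_det (hA : ∀ i j, CD m fun y => A y i j) (hm : 1 ≤ m) (hy : y ≠ 0) (k : Fin (d + 1)) :
    pd k (fun y => (A y).det) y =
      ∑ a, ∑ i, (A y).adjugate a i * pd k (fun y => A y i a) y := by
  simp only [Matrix.det_apply']
  rw [pd_sum (m := m) (fun σ _ => (cd_const _).mul (CD.prod fun a _ => hA _ _)) hm hy]
  have h1 : ∀ σ : Equiv.Perm ι,
      pd k (fun y => ((Equiv.Perm.sign σ : ℤ) : ℝ) * ∏ i, A y (σ i) i) y =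
        ∑ a, ((Equiv.Perm.sign σ : ℤ) : ℝ) *
          ((∏ b ∈ Finset.univ.erase a, A y (σ b) b) * pd k (fun y => A y (σ a) a) y) := by
    intro σ
    rw [pd_const_mul _ (CD.prod fun a _ => hA _ _) hm hy,
      pd_prod (F := fun a y => A y (σ a) a) _ (fun a => hA _ _) hm hy, Finset.mul_sum]
  simp only [h1]
  rw [Finset.sum_comm]
  refine Finset.sum_congr rfl fun a _ => ?_
  -- By Cramer's rule, contraction with the adjugate gives the determinant with column `a` replaced
  -- by its derivative; its Leibniz expansion is then matched term by term.
  have h2 : ∑ i, (A y).adjugate a i * pd k (fun y => A y i a) y =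
      ((A y).updateCol a fun i => pd k (fun y => A y i a) y).det := by
    rw [← Matrix.cramer_apply, Matrix.cramer_eq_adjugate_mulVec]; rfl
  rw [h2, Matrix.det_apply']
  refine Finset.sum_congr rfl fun σ _ => ?_
  rw [← Finset.mul_prod_erase _ _ (Finset.mem_univ a)]
  simp only [Matrix.updateCol_apply, if_true]
  rw [Finset.prod_congr rfl fun b hb => if_neg (Finset.ne_of_mem_erase hb)]
  ring

end MatrixFunctions

/-! ### Support functions of smooth even bodies -/

/-- Smooth, even, positive, one-homogeneous functions whose Hessian is positive definite
transversally to the radial direction. -/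
structure Adm (h : Euc d → ℝ) : Prop where
  cd : CD ∞ h
  pos : ∀ y, y ≠ 0 → 0 < h y
  hom : Hom 1 h
  even : ∀ y, h (-y) = h y
  convex : ∀ y v : Euc d, y ≠ 0 → v ≠ 0 → ⟪y, v⟫ = 0 →
    0 < ∑ i, ∑ j, v i * v j * pd i (pd j h) y

/-! ### The metric `D²(h² / 2)`, its inverse and its determinant -/

/-- The Hessian matrix of `h² / 2`. -/
def gm (h : Euc d → ℝ) (y : Euc d) : Matrix (Fin (d + 1)) (Fin (d + 1)) ℝ :=
  Matrix.of fun i j => h y * pd i (pd j h) y + pd i h y * pd j h y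

/-- The inverse of the Hessian matrix of `h² / 2`. -/
def gi (h : Euc d → ℝ) (y : Euc d) : Matrix (Fin (d + 1)) (Fin (d + 1)) ℝ := (gm h y)⁻¹

/-- The Hessian determinant of `h² / 2`. -/
def gd (h : Euc d → ℝ) (y : Euc d) : ℝ := (gm h y).det

theorem gi_eq (h : Euc d → ℝ) (i j) (y : Euc d) : gi h y i j = (gd h y)⁻¹ * (gm h y).adjugate i j := by
  simp [gi, gd, Matrix.inv_def]

theorem one_le_top : (1 : WithTop ℕ∞) ≤ ∞ := by exact_mod_cast le_top
theorem two_le_top : (2 : WithTop ℕ∞) ≤ ∞ := WithTop.coe_le_coe.2 (le_top : (2 : ℕ∞) ≤ ⊤)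
theorem top_add_one_le : (∞ : WithTop ℕ∞) + 1 ≤ ∞ := le_rfl

namespace Adm

variable {h : Euc d → ℝ} (H : Adm h)
include H

theorem ne (hy : y ≠ 0) : h y ≠ 0 := (H.pos y hy).ne'

theorem cd_pd (i) : CD ∞ (pd i h) := H.cd.pd top_add_one_le i

theorem cd_pd2 (i j) : CD ∞ (pd i (pd j h)) := (H.cd_pd j).pd top_add_one_le i

theorem cd_gm (i j) : CD ∞ fun y => gm h y i j :=
  (H.cd.mul (H.cd_pd2 i j)).add ((H.cd_pd i).mul (H.cd_pd j))

theorem hom_gm (i j) : Hom 0 fun y => gm h y i j :=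
  ((H.hom.mul ((H.hom.pd j).pd i)).cast (by ring)).add
    (((H.hom.pd i).mul (H.hom.pd j)).cast (by ring))

theorem cd_gd : CD ∞ (gd h) := cd_det H.cd_gm

theorem hom_gd : Hom 0 (gd h) := hom_det H.hom_gm

theorem gm_symm (hy : y ≠ 0) (i j) : gm h y i j = gm h y j i := by
  simp only [gm, Matrix.of_apply, pd_comm H.cd two_le_top hy i j]; ring

theorem euler (hy : y ≠ 0) : ∑ i, y i * pd i h y = h y := by
  simpa using H.hom.euler H.cd one_le_top hy

theorem euler_pd (hy : y ≠ 0) (j) : ∑ i, y i * pd i (pd j h) y = 0 := by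
  simpa using (H.hom.pd j).euler (H.cd_pd j) one_le_top hy

/-- `h² / 2` has degree two, so its Hessian applied to `y` is its gradient `h dh`. -/
theorem gm_mulVec (hy : y ≠ 0) (i) : ∑ j, gm h y i j * y j = h y * pd i h y := by
  have h1 := H.euler_pd hy i
  have h2 := H.euler hy
  calc ∑ j, gm h y i j * y j
      = h y * (∑ j, y j * pd j (pd i h) y) + pd i h y * ∑ j, y j * pd j h y := by
        simp only [gm, Matrix.of_apply, Finset.mul_sum, ← Finset.sum_add_distrib]
        refine Finset.sum_congr rfl fun j _ => ?_
        rw [pd_comm H.cd two_le_top hy i j]; ring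
    _ = _ := by rw [h1, h2]; ring

/-- The first derivatives of `h` have degree zero, so `y` lies in the kernel of `D²h`. -/
theorem hess_add_smul (hy : y ≠ 0) (c : ℝ) (v : Euc d) :
    ∑ i, ∑ j, (v + c • y) i * (v + c • y) j * pd i (pd j h) y =
      ∑ i, ∑ j, v i * v j * pd i (pd j h) y := by
  have h1 := H.euler_pd hy
  have h2 : ∀ i, ∑ j, y j * pd i (pd j h) y = 0 := fun i => by
    simp only [pd_comm H.cd two_le_top hy i, h1]
  calc _ = ∑ i, ∑ j, v i * v j * pd i (pd j h) y + c * ∑ i, v i * ∑ j, y j * pd i (pd j h) y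
        + c * ∑ j, (v + c • y) j * ∑ i, y i * pd i (pd j h) y := by
        simp only [Finset.mul_sum]
        rw [Finset.sum_comm (f := fun j i => c * ((v + c • y) j * (y i * pd i (pd j h) y)))]
        simp only [← Finset.sum_add_distrib]
        refine Finset.sum_congr rfl fun i _ => Finset.sum_congr rfl fun j _ => ?_
        simp; ring
    _ = _ := by simp [h1, h2]

/-- A vector is split into a radial part and a part orthogonal to `y`. The term `h D²h` sees only
the orthogonal part and is positive there. If that part vanishes, the square of `dh` remains, and
`dh(y) = h(y) > 0`. -/
theorem gm_posDef (hy : y ≠ 0) : (gm h y).PosDef := by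
  refine Matrix.PosDef.of_dotProduct_mulVec_pos ?_ fun x hx => ?_
  · ext i j
    simpa using H.gm_symm hy j i
  · set x' : Euc d := WithLp.toLp 2 x with hx'
    have hyy : ⟪y, y⟫ ≠ (0 : ℝ) := by simpa using hy
    set c : ℝ := ⟪y, x'⟫ / ⟪y, y⟫
    set v : Euc d := x' - c • y with hv
    have hxv : x' = v + c • y := by rw [hv]; abel
    have hyv : ⟪y, v⟫ = (0 : ℝ) := by
      rw [hv, inner_sub_right, inner_smul_right, div_mul_cancel₀ _ hyy, sub_self]
    have hq : star x ⬝ᵥ (gm h y).mulVec x =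
        h y * ∑ i, ∑ j, x' i * x' j * pd i (pd j h) y + (∑ i, x' i * pd i h y) ^ 2 := by
      rw [pow_two, Finset.sum_mul_sum]
      simp only [dotProduct, Matrix.mulVec, gm, Matrix.of_apply, Finset.mul_sum,
        ← Finset.sum_add_distrib]
      refine Finset.sum_congr rfl fun i _ => Finset.sum_congr rfl fun j _ => ?_
      simp [hx']; ring
    rw [hq, hxv, H.hess_add_smul hy]
    by_cases hv0 : v = 0
    · have hc : c ≠ 0 := by
        rintro hc
        apply hx
        have : x' = 0 := by rw [hxv, hv0, hc]; simp
        simpa [hx'] using this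
      have : ∑ i, (v + c • y) i * pd i h y = c * h y := by
        rw [← H.euler hy, hv0, Finset.mul_sum]
        refine Finset.sum_congr rfl fun i _ => ?_
        simp; ring
      rw [this, hv0]
      have := H.pos y hy
      simp only [PiLp.zero_apply, zero_mul, Finset.sum_const_zero, mul_zero, zero_add]
      positivity
    · have := mul_pos (H.pos y hy) (H.convex y v hy hv0 hyv)
      positivity

theorem gd_pos (hy : y ≠ 0) : 0 < gd h y := (H.gm_posDef hy).det_pos

theorem gm_mul_gi (hy : y ≠ 0) : gm h y * gi h y = 1 :=
  Matrix.mul_nonsing_inv _ (isUnit_iff_ne_zero.2 (H.gd_pos hy).ne')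

theorem gi_mul_gm (hy : y ≠ 0) : gi h y * gm h y = 1 :=
  Matrix.nonsing_inv_mul _ (isUnit_iff_ne_zero.2 (H.gd_pos hy).ne')

theorem gi_posDef (hy : y ≠ 0) : (gi h y).PosDef := (H.gm_posDef hy).inv

theorem gi_symm (hy : y ≠ 0) (i j) : gi h y i j = gi h y j i := by
  simpa using (congrFun (congrFun (H.gi_posDef hy).1 i) j).symm

theorem cd_gi (i j) : CD ∞ fun y => gi h y i j := by
  simp only [gi_eq]
  exact (H.cd_gd.inv fun y hy => (H.gd_pos hy).ne').mul (cd_adjugate H.cd_gm i j)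

theorem hom_gi (i j) : Hom 0 fun y => gi h y i j := by
  simp only [gi_eq]
  exact (H.hom_gd.inv.mul (hom_adjugate H.hom_gm i j)).cast (by simp)

/-- Since `G⁻¹ dh` is radial, differentiating a power of `h` used as a weight produces a contraction
with `y`, which Euler's identity evaluates. -/
theorem gi_mulVec (hy : y ≠ 0) (i) : ∑ j, gi h y i j * pd j h y = y i * (h y)⁻¹ := by
  have h1 : (gm h y).mulVec y = h y • fun j => pd j h y := by
    ext j; exact H.gm_mulVec hy j
  have h2 : (gi h y).mulVec ((gm h y).mulVec y) = y := by
    rw [Matrix.mulVec_mulVec, H.gi_mul_gm hy, Matrix.one_mulVec]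
  rw [h1, Matrix.mulVec_smul] at h2
  have h3 := congrFun h2 i
  simp only [Pi.smul_apply, smul_eq_mul, Matrix.mulVec, dotProduct] at h3
  rw [← h3]
  field_simp [H.ne hy]

/-- The third derivatives of `h² / 2`. -/
theorem pd_gm (hy : y ≠ 0) (k i j) : pd k (fun y => gm h y i j) y =
    pd k h y * pd i (pd j h) y + h y * pd k (pd i (pd j h)) y +
      (pd k (pd i h) y * pd j h y + pd i h y * pd k (pd j h) y) := by
  simp only [gm, Matrix.of_apply]
  rw [pd_add (H.cd.mul (H.cd_pd2 i j)) ((H.cd_pd i).mul (H.cd_pd j)) one_le_top hy,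
    pd_mul H.cd (H.cd_pd2 i j) one_le_top hy, pd_mul (H.cd_pd i) (H.cd_pd j) one_le_top hy]

theorem pd_gm_swap_right (hy : y ≠ 0) (k i j) :
    pd k (fun y => gm h y i j) y = pd k (fun y => gm h y j i) y :=
  pd_congr (fun _ hy => H.gm_symm hy i j) hy

/-- Derivatives of the entries are third derivatives of `h² / 2`, hence symmetric in all three
indices. The cancellations in `piola` and in the Bochner formula rest on this. -/
theorem pd_gm_swap_left (hy : y ≠ 0) (k i j) :
    pd k (fun y => gm h y i j) y = pd i (fun y => gm h y k j) y := by
  rw [H.pd_gm hy, H.pd_gm hy, pd_comm (H.cd_pd j) two_le_top hy k i,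
    pd_comm H.cd two_le_top hy k i]
  ring

/-- Obtained by differentiating `G⁻¹ G = 1`. -/
theorem pd_gi (hy : y ≠ 0) (k i j) : pd k (fun y => gi h y i j) y =
    -∑ a, ∑ b, gi h y i a * pd k (fun y => gm h y a b) y * gi h y b j := by
  let DR : Matrix (Fin (d + 1)) (Fin (d + 1)) ℝ := .of fun i j => pd k (fun y => gi h y i j) y
  let DG : Matrix (Fin (d + 1)) (Fin (d + 1)) ℝ := .of fun i j => pd k (fun y => gm h y i j) y
  have h1 : DR * gm h y + gi h y * DG = 0 := by
    ext a b
    have : pd k (fun y => ∑ c, gi h y a c * gm h y c b) y = 0 := by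
      rw [pd_congr (G := fun _ => (1 : Matrix (Fin (d + 1)) (Fin (d + 1)) ℝ) a b) _ hy, pd_const]
      intro z hz
      rw [← H.gi_mul_gm hz]; rfl
    rw [pd_sum (m := ∞) (fun c _ => (H.cd_gi a c).mul (H.cd_gm c b)) one_le_top hy] at this
    simp only [pd_mul (H.cd_gi _ _) (H.cd_gm _ _) one_le_top hy, Finset.sum_add_distrib] at this
    exact this
  have h2 : DR = -(gi h y * DG * gi h y) := by
    have h3 := congrArg (· * gi h y) h1
    simp only [add_mul, Matrix.mul_assoc DR, H.gm_mul_gi hy, mul_one, zero_mul] at h3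
    exact eq_neg_of_add_eq_zero_left h3
  have h3 := congrFun (congrFun h2 i) j
  rw [show pd k (fun y => gi h y i j) y = DR i j from rfl, h3]
  simp only [Matrix.neg_apply, Matrix.mul_apply, Finset.sum_mul]
  rw [Finset.sum_comm]
  rfl

theorem pd_gd (hy : y ≠ 0) (k) : pd k (gd h) y =
    gd h y * ∑ a, ∑ b, gi h y a b * pd k (fun y => gm h y a b) y := by
  have : pd k (gd h) y = _ := pd_det H.cd_gm one_le_top hy k
  rw [this, Finset.mul_sum]
  refine Finset.sum_congr rfl fun a _ => ?_
  rw [Finset.mul_sum]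
  refine Finset.sum_congr rfl fun b _ => ?_
  rw [gi_eq, H.pd_gm_swap_right hy k b a]
  have := (H.gd_pos hy).ne'
  field_simp

/-- The cofactor matrix of a Hessian is divergence free. -/
theorem piola (hy : y ≠ 0) (j) : ∑ i, pd i (fun y => gd h y * gi h y i j) y = 0 := by
  have h1 : ∀ i, pd i (fun y => gd h y * gi h y i j) y =
      gd h y * (∑ a, ∑ b, gi h y a b * pd i (fun y => gm h y a b) y * gi h y i j -
        ∑ a, ∑ b, gi h y i a * pd i (fun y => gm h y a b) y * gi h y b j) := fun i => by
    rw [pd_mul H.cd_gd (H.cd_gi i j) one_le_top hy, H.pd_gd hy, H.pd_gi hy]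
    simp only [← Finset.sum_mul]; ring
  simp only [h1, ← Finset.mul_sum, Finset.sum_sub_distrib]
  -- The term from differentiating the determinant and the term from differentiating the inverse
  -- coincide after relabelling, by the symmetry of the third derivatives.
  have h2 : ∑ i, ∑ a, ∑ b, gi h y a b * pd i (fun y => gm h y a b) y * gi h y i j =
      ∑ i, ∑ a, ∑ b, gi h y i a * pd i (fun y => gm h y a b) y * gi h y b j := by
    rw [Finset.sum_comm]
    refine Finset.sum_congr rfl fun a _ => ?_
    rw [Finset.sum_comm]
    refine Finset.sum_congr rfl fun b _ => Finset.sum_congr rfl fun i _ => ?_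
    rw [H.pd_gm_swap_left hy i a b, H.pd_gm_swap_right hy a i b]
  rw [h2, sub_self, mul_zero]

end Adm

end

section


/-! ### The centro-affine operators in Cartesian coordinates -/

open MeasureTheory

/-- The Laplacian of a function of degree zero. -/
def lap (h F : Euc d → ℝ) (y : Euc d) : ℝ := h y ^ 2 * ∑ i, ∑ j, gi h y i j * pd i (pd j F) y

/-- The scalar product of the gradients of two functions of degree zero. -/
def gam (h F K : Euc d → ℝ) (y : Euc d) : ℝ :=
  h y ^ 2 * ∑ i, ∑ j, gi h y i j * (pd i F y * pd j K y)

/-- The Hessian matrix. -/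
def hm (F : Euc d → ℝ) (y : Euc d) : Matrix (Fin (d + 1)) (Fin (d + 1)) ℝ :=
  Matrix.of fun i j => pd i (pd j F) y

/-- The scalar product of the Hessians of two functions of degree zero, with respect to the
Hessian metric of `h² / 2`. -/
def hs (h F K : Euc d → ℝ) (y : Euc d) : ℝ :=
  h y ^ 4 * (gi h y * hm F y * gi h y * hm K y).trace

/-- The density of the centro-affine measure. -/
def dens (h : Euc d → ℝ) (y : Euc d) : ℝ := h y ^ (-((d : ℤ) + 1)) * gd h y

/-- Both sides contract the totally symmetric tensor `T` with `R U R` and `v`. In the Bochner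
formula `T` is the third derivative of `h² / 2`, and the identity removes all terms in which the
metric is differentiated. -/
theorem sum_contract_third {ι : Type*} [Fintype ι] (R U : ι → ι → ℝ) (T : ι → ι → ι → ℝ)
    (v : ι → ℝ) (hU : ∀ i j, U i j = U j i)
    (hT : ∀ i j k, T i j k = T j i k) (hT' : ∀ i j k, T i j k = T i k j) :
    ∑ i, (∑ a, ∑ b, (∑ c, ∑ e, R a c * T i c e * R e b) * U a b) * v i =
      ∑ i, ∑ j, R i j * ∑ a, U j a * ∑ c, ∑ e, R a c * T i c e * v e := by
  have h1 : ∀ i, ∑ a, ∑ b, (∑ c, ∑ e, R a c * T i c e * R e b) * U a b =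
      ∑ c, ∑ e, T i c e * ∑ a, ∑ b, R e b * U b a * R a c := by
    intro i
    simp only [Finset.sum_mul, Finset.mul_sum]
    calc _ = ∑ a, ∑ c, ∑ e, ∑ b, R a c * T i c e * R e b * U a b := by
          refine Finset.sum_congr rfl fun a _ => ?_
          rw [Finset.sum_comm]
          exact Finset.sum_congr rfl fun c _ => Finset.sum_comm
      _ = ∑ c, ∑ e, ∑ a, ∑ b, R a c * T i c e * R e b * U a b := by
          rw [Finset.sum_comm]
          exact Finset.sum_congr rfl fun c _ => Finset.sum_comm
      _ = _ := by
          refine Finset.sum_congr rfl fun c _ => Finset.sum_congr rfl fun e _ =>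
            Finset.sum_congr rfl fun a _ => Finset.sum_congr rfl fun b _ => ?_
          rw [hU a b]; ring
  have h2 : ∀ i, ∑ j, R i j * ∑ a, U j a * ∑ c, ∑ e, R a c * T i c e * v e =
      ∑ c, (∑ a, ∑ j, R i j * U j a * R a c) * ∑ e, T i c e * v e := by
    intro i
    simp only [Finset.sum_mul, Finset.mul_sum]
    calc _ = ∑ j, ∑ c, ∑ a, ∑ e, R i j * (U j a * (R a c * T i c e * v e)) := by
          exact Finset.sum_congr rfl fun j _ => Finset.sum_comm
      _ = ∑ c, ∑ a, ∑ j, ∑ e, R i j * (U j a * (R a c * T i c e * v e)) := by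
          rw [Finset.sum_comm]
          exact Finset.sum_congr rfl fun c _ => Finset.sum_comm
      _ = _ := by
          refine Finset.sum_congr rfl fun c _ => ?_
          calc _ = ∑ a, ∑ e, ∑ j, R i j * (U j a * (R a c * T i c e * v e)) :=
                Finset.sum_congr rfl fun a _ => Finset.sum_comm
            _ = ∑ e, ∑ a, ∑ j, R i j * (U j a * (R a c * T i c e * v e)) := Finset.sum_comm
            _ = _ := Finset.sum_congr rfl fun e _ => Finset.sum_congr rfl fun a _ =>
                Finset.sum_congr rfl fun j _ => by ring
  simp only [h1, h2]
  generalize hQ : (fun e c => ∑ a, ∑ b, R e b * U b a * R a c) = Q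
  have hQ' : ∀ e c, ∑ a, ∑ b, R e b * U b a * R a c = Q e c := fun e c => by rw [← hQ]
  simp only [hQ', Finset.sum_mul, Finset.mul_sum]
  calc _ = ∑ e, ∑ i, ∑ c, T i c e * Q e c * v i := by
        rw [Finset.sum_comm (s := Finset.univ) (t := Finset.univ) (f := fun e i =>
          ∑ c, T i c e * Q e c * v i)]
        exact Finset.sum_congr rfl fun i _ => Finset.sum_comm
    _ = _ := by
        refine Finset.sum_congr rfl fun e _ => ?_
        rw [Finset.sum_comm]
        refine Finset.sum_congr rfl fun c _ => Finset.sum_congr rfl fun i _ => ?_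
        rw [hT i c e, hT' c i e, hT c e i]; ring

variable {m : WithTop ℕ∞} {y : Euc d}

namespace Adm

variable {h F K : Euc d → ℝ} (H : Adm h)
include H

theorem dens_pos (hy : y ≠ 0) : 0 < dens h y :=
  mul_pos (zpow_pos (H.pos y hy) _) (H.gd_pos hy)

theorem cd_dens : CD ∞ (dens h) := (H.cd.zpow (fun _ hy => H.ne hy) _).mul H.cd_gd

theorem cd_lap (hF : CD 2 F) : CD 0 (lap h F) :=
  ((H.cd.of_le zero_le).pow 2).mul (CD.sum fun i _ => CD.sum fun j _ =>
    ((H.cd_gi i j).of_le zero_le).mul ((hF.pd (k := 1) (by norm_num) j).pd (k := 0) (by norm_num) i))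

theorem cd_gam (hF : CD 1 F) (hK : CD 1 K) : CD 0 (gam h F K) :=
  ((H.cd.of_le zero_le).pow 2).mul (CD.sum fun i _ => CD.sum fun j _ =>
    ((H.cd_gi i j).of_le zero_le).mul
      ((hF.pd (k := 0) (by norm_num) i).mul (hK.pd (k := 0) (by norm_num) j)))

theorem cd_hs (hF : CD 2 F) (hK : CD 2 K) : CD 0 (hs h F K) := by
  refine ((H.cd.of_le zero_le).pow 4).mul ?_
  simp only [Matrix.trace, Matrix.diag, Matrix.mul_apply, hm, Matrix.of_apply]
  exact CD.sum fun i _ => CD.sum fun j _ => ((CD.sum fun a _ => (CD.sum fun b _ =>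
    ((H.cd_gi _ _).of_le zero_le).mul ((hF.pd (k := 1) (by norm_num) _).pd (k := 0)
      (by norm_num) _)).mul ((H.cd_gi _ _).of_le zero_le))).mul
      ((hK.pd (k := 1) (by norm_num) _).pd (k := 0) (by norm_num) _)

/-- The divergence of `w det(G) G⁻¹ ξ`. -/
theorem div_cofactor {w : Euc d → ℝ} {ξ : Fin (d + 1) → Euc d → ℝ} (hw : CD 1 w)
    (hξ : ∀ j, CD 1 (ξ j)) (hy : y ≠ 0) :
    ∑ i, pd i (fun y => w y * ∑ j, gd h y * gi h y i j * ξ j y) y =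
      gd h y * (∑ i, ∑ j, gi h y i j * (pd i w y * ξ j y) +
        w y * ∑ i, ∑ j, gi h y i j * pd i (ξ j) y) := by
  have hc : ∀ i j, CD 1 fun y => gd h y * gi h y i j := fun i j =>
    (H.cd_gd.mul (H.cd_gi i j)).of_le one_le_top
  have h1 : ∀ i, pd i (fun y => w y * ∑ j, gd h y * gi h y i j * ξ j y) y =
      gd h y * (∑ j, gi h y i j * (pd i w y * ξ j y) + w y * ∑ j, gi h y i j * pd i (ξ j) y) +
        w y * ∑ j, pd i (fun y => gd h y * gi h y i j) y * ξ j y := by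
    intro i
    rw [pd_mul hw (CD.sum fun j _ => (hc i j).mul (hξ j)) le_rfl hy,
      pd_sum (fun j _ => (hc i j).mul (hξ j)) le_rfl hy]
    simp only [pd_mul (hc _ _) (hξ _) le_rfl hy, Finset.sum_add_distrib, Finset.mul_sum, mul_add]
    have e1 : ∀ j, pd i w y * (gd h y * gi h y i j * ξ j y) =
      gd h y * (gi h y i j * (pd i w y * ξ j y)) := fun j => by ring
    have e2 : ∀ j, w y * (gd h y * gi h y i j * pd i (ξ j) y) =
      gd h y * (w y * (gi h y i j * pd i (ξ j) y)) := fun j => by ring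
    simp only [e1, e2]; ring
  simp only [h1, Finset.sum_add_distrib, ← Finset.mul_sum]
  rw [Finset.sum_comm (f := fun i j => pd i (fun y => gd h y * gi h y i j) y * ξ j y)]
  simp only [← Finset.sum_mul, H.piola hy, zero_mul, Finset.sum_const_zero, mul_zero, add_zero]

theorem sum_gi_pd (hy : y ≠ 0) (x : Fin (d + 1) → ℝ) :
    ∑ i, ∑ j, gi h y i j * (pd i h y * x j) = (h y)⁻¹ * ∑ j, y j * x j := by
  rw [Finset.sum_comm, Finset.mul_sum]
  refine Finset.sum_congr rfl fun j _ => ?_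
  have := H.gi_mulVec hy j
  calc _ = (∑ i, gi h y j i * pd i h y) * x j := by
        rw [Finset.sum_mul]
        exact Finset.sum_congr rfl fun i _ => by rw [H.gi_symm hy]; ring
    _ = _ := by rw [this]; ring


/-- Green's formula. -/
theorem integral_mul_lap (hF : CD 2 F) (hF0 : Hom 0 F) (hK : CD 1 K) (hK0 : Hom 0 K) :
    ∫ θ : Sph d, K θ * lap h F θ * dens h θ ∂(sig d) =
      -∫ θ : Sph d, gam h K F θ * dens h θ ∂(sig d) := by
  have hF1 : ∀ j, CD 1 (pd j F) := fun j => hF.pd (by norm_num) j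
  have hz : CD 1 fun y => h y ^ (1 - d : ℤ) :=
    (H.cd.zpow (fun _ hy => H.ne hy) _).of_le one_le_top
  have hw : CD 1 fun y => h y ^ (1 - d : ℤ) * K y := hz.mul hK
  -- The exponent `1 - d` gives the field the degree `-d`. It is also the right one for the
  -- operators: `h ^ (1 - d)` is `h²`, from the Laplacian, times `h ^ (-(d + 1))`, from the density.
  have key := integral_sph_div_eq_zero
    (Y := fun i y => (h y ^ (1 - d : ℤ) * K y) * ∑ j, gd h y * gi h y i j * pd j F y)
    (fun i => hw.mul (CD.sum fun j _ => ((H.cd_gd.mul (H.cd_gi i j)).of_le one_le_top).mul (hF1 j)))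
    (fun i => ((((H.hom.zpow _).mul hK0)).mul (Hom.sum fun j _ =>
      (H.hom_gd.mul (H.hom_gi i j)).mul (hF0.pd j))).cast (by ring))
  have pt : ∀ y, y ≠ 0 → K y * lap h F y * dens h y - -(gam h K F y * dens h y) =
      ∑ i, pd i (fun y => (h y ^ (1 - d : ℤ) * K y) * ∑ j, gd h y * gi h y i j * pd j F y) y := by
    intro y hy
    have hhy := H.ne hy
    rw [H.div_cofactor hw hF1 hy]
    simp only [pd_mul hz hK le_rfl hy, pd_zpow H.cd one_le_top hy (H.ne hy)]
    have e1 : ∑ i, ∑ j, gi h y i j * ((((1 - d : ℤ) : ℝ) * h y ^ (1 - d - 1 : ℤ) * pd i h y * K y +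
        h y ^ (1 - d : ℤ) * pd i K y) * pd j F y) =
        ((1 - d : ℤ) : ℝ) * h y ^ (1 - d - 1 : ℤ) * K y *
          (∑ i, ∑ j, gi h y i j * (pd i h y * pd j F y)) +
        h y ^ (1 - d : ℤ) * ∑ i, ∑ j, gi h y i j * (pd i K y * pd j F y) := by
      simp only [Finset.mul_sum, ← Finset.sum_add_distrib]
      exact Finset.sum_congr rfl fun i _ => Finset.sum_congr rfl fun j _ => by ring
    -- The derivative of the power of `h` pairs `dF` with the radial direction, and this vanishes
    -- because `F` has degree zero.
    have e2 := hF0.euler hF one_le_two hy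
    rw [e1, H.sum_gi_pd hy, e2]
    simp only [lap, gam, dens]
    have e3 : h y ^ (1 - d : ℤ) = h y ^ 2 * h y ^ (-((d : ℤ) + 1)) := by
      rw [← zpow_natCast, ← zpow_add₀ hhy]; congr 1; push_cast; ring
    rw [e3]
    push_cast; ring
  rw [← integral_neg, ← sub_eq_zero, ← integral_sub]
  · rw [← key]
    exact integral_congr_ae (Filter.Eventually.of_forall fun θ => pt θ (sph_ne_zero θ))
  · exact integrable_sph (((hK.of_le zero_le).mul (H.cd_lap hF)).mul
      (H.cd_dens.of_le zero_le)).continuous_sph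
  · exact (integrable_sph ((H.cd_gam hK (hF.of_le one_le_two)).mul
      (H.cd_dens.of_le zero_le)).continuous_sph).neg

/-- The integrated Bochner formula. -/
theorem integral_hs (hF : CD ∞ F) (hF0 : Hom 0 F) (hK : CD 2 K) (hK0 : Hom 0 K) :
    ∫ θ : Sph d, hs h F K θ * dens h θ ∂(sig d) =
      ∫ θ : Sph d, lap h F θ * lap h K θ * dens h θ ∂(sig d) +
        (3 - d : ℝ) * ∫ θ : Sph d, gam h F K θ * dens h θ ∂(sig d) := by
  -- The roles are asymmetric: only `F` is differentiated three times, while `K` is merely `C²`. The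
  -- bilinear form of the formula is what later allows the passage to `C²` functions.
  have hK1 : ∀ j, CD 1 (pd j K) := fun j => hK.pd (by norm_num) j
  have hK2 : ∀ i j, CD 0 (pd i (pd j K)) := fun i j => (hK1 j).pd (by norm_num) i
  have hF1 : ∀ j, CD ∞ (pd j F) := fun j => hF.pd top_add_one_le j
  have hF2 : ∀ i j, CD ∞ (pd i (pd j F)) := fun i j => (hF1 j).pd top_add_one_le i
  have hw : CD 1 fun y => h y ^ (3 - d : ℤ) :=
    (H.cd.zpow (fun _ hy => H.ne hy) _).of_le one_le_top
  set v : Fin (d + 1) → Euc d → ℝ := fun a y => ∑ b, gi h y a b * pd b K y with hv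
  have hv1 : ∀ a, CD 1 (v a) := fun a =>
    CD.sum fun b _ => ((H.cd_gi a b).of_le one_le_top).mul (hK1 b)
  set τ : Euc d → ℝ := fun y => ∑ a, ∑ b, gi h y a b * pd a (pd b F) y with hτ
  have hτ1 : CD 1 τ := CD.of_le (CD.sum fun a _ => CD.sum fun b _ => (H.cd_gi a b).mul (hF2 a b))
    one_le_top
  -- In the divergence of `tr(G⁻¹ D²F) dK - D²F G⁻¹ dK` the third derivatives of `F` occur twice
  -- with opposite signs. The field has degree `-3`, whence the weight `h ^ (3 - d)`.
  set ξ : Fin (d + 1) → Euc d → ℝ := fun j y => τ y * pd j K y - ∑ a, pd j (pd a F) y * v a y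
    with hξ
  have hs1 : ∀ j, CD 1 fun y => ∑ a, pd j (pd a F) y * v a y := fun j =>
    CD.sum fun a _ => ((hF2 j a).of_le one_le_top).mul (hv1 a)
  have hξ1 : ∀ j, CD 1 (ξ j) := fun j => (hτ1.mul (hK1 j)).sub (hs1 j)
  have hξ0 : ∀ j, Hom (-3) (ξ j) := fun j =>
    Hom.sub (((Hom.sum fun a _ => Hom.sum fun b _ => (H.hom_gi a b).mul ((hF0.pd b).pd a)).mul
      (hK0.pd j)).cast (by ring))
      (Hom.sum fun a _ => (((hF0.pd a).pd j).mul (Hom.sum fun b _ =>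
        (H.hom_gi a b).mul (hK0.pd b))).cast (by ring))
  have key := integral_sph_div_eq_zero
    (Y := fun i y => h y ^ (3 - d : ℤ) * ∑ j, gd h y * gi h y i j * ξ j y)
    (fun i => hw.mul (CD.sum fun j _ => ((H.cd_gd.mul (H.cd_gi i j)).of_le one_le_top).mul (hξ1 j)))
    (fun i => ((H.hom.zpow _).mul (Hom.sum fun j _ =>
      (H.hom_gd.mul (H.hom_gi i j)).mul (hξ0 j))).cast (by ring))
  have pt : ∀ y, y ≠ 0 → lap h F y * lap h K y * dens h y +
      (3 - d : ℝ) * (gam h F K y * dens h y) - hs h F K y * dens h y =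
      ∑ i, pd i (fun y => h y ^ (3 - d : ℤ) * ∑ j, gd h y * gi h y i j * ξ j y) y := by
    intro y hy
    have hhy := H.ne hy
    rw [H.div_cofactor hw hξ1 hy]
    simp only [pd_zpow H.cd one_le_top hy (H.ne hy)]
    have e1 : ∑ i, ∑ j, gi h y i j *
        (((3 - d : ℤ) : ℝ) * h y ^ (3 - d - 1 : ℤ) * pd i h y * ξ j y) =
        ((3 - d : ℤ) : ℝ) * h y ^ (3 - d - 1 : ℤ) *
          (∑ i, ∑ j, gi h y i j * (pd i h y * ξ j y)) := by
      simp only [Finset.mul_sum]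
      exact Finset.sum_congr rfl fun i _ => Finset.sum_congr rfl fun j _ => by ring
    -- Unlike in Green's formula, the derivative of the weight survives: `dF` has degree `-1`, so
    -- `D²F y = -dF`. This produces the gradient term with coefficient `3 - d`.
    have e2 : ∑ j, y j * ξ j y = ∑ i, ∑ j, gi h y i j * (pd i F y * pd j K y) := by
      have f1 := hK0.euler hK one_le_two hy
      have f2 : ∀ a, ∑ j, y j * pd j (pd a F) y = -pd a F y := fun a => by
        have := (hF0.pd a).euler (hF1 a) one_le_top hy
        simpa using this
      calc _ = τ y * ∑ j, y j * pd j K y - ∑ a, (∑ j, y j * pd j (pd a F) y) * v a y := by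
            simp only [hξ, mul_sub, Finset.sum_sub_distrib, Finset.mul_sum, Finset.sum_mul]
            congr 1
            · exact Finset.sum_congr rfl fun j _ => by ring
            · rw [Finset.sum_comm]
              exact Finset.sum_congr rfl fun j _ => Finset.sum_congr rfl fun a _ => by ring
        _ = _ := by
            rw [f1]
            simp only [f2, hv, Finset.mul_sum]
            simp only [Int.cast_zero, zero_mul, mul_zero, zero_sub, ← Finset.sum_neg_distrib]
            exact Finset.sum_congr rfl fun j _ => Finset.sum_congr rfl fun a _ => by ring
    have e3 : ∑ i, ∑ j, gi h y i j * pd i (ξ j) y =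
        τ y * (∑ i, ∑ j, gi h y i j * pd i (pd j K) y) -
          ∑ i, ∑ j, gi h y i j * ∑ a, pd j (pd a F) y * ∑ b, gi h y a b * pd i (pd b K) y := by
      have f1 : ∀ i j, pd i (ξ j) y = pd i τ y * pd j K y + τ y * pd i (pd j K) y -
          ∑ a, (pd i (pd j (pd a F)) y * v a y + pd j (pd a F) y * pd i (v a) y) := by
        intro i j
        rw [hξ, pd_sub (hτ1.mul (hK1 j)) (hs1 j) le_rfl hy, pd_mul hτ1 (hK1 j) le_rfl hy,
          pd_sum (fun a _ => ((hF2 j a).of_le one_le_top).mul (hv1 a)) le_rfl hy]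
        congr 1
        exact Finset.sum_congr rfl fun a _ =>
          pd_mul ((hF2 j a).of_le one_le_top) (hv1 a) le_rfl hy
      have f2 : ∀ i a, pd i (v a) y = ∑ b, gi h y a b * pd i (pd b K) y -
          ∑ c, ∑ e, gi h y a c * pd i (fun y => gm h y c e) y * v e y := by
        intro i a
        rw [hv, pd_sum (m := 1) (fun b _ => ((H.cd_gi a b).of_le one_le_top).mul (hK1 b)) le_rfl hy]
        simp only [pd_mul ((H.cd_gi a _).of_le one_le_top) (hK1 _) le_rfl hy, H.pd_gi hy,
          Finset.sum_add_distrib, Finset.mul_sum, Finset.sum_mul, neg_mul,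
          Finset.sum_neg_distrib]
        rw [Finset.sum_comm, neg_add_eq_sub]
        congr 1
        refine Finset.sum_congr rfl fun c _ => ?_
        rw [Finset.sum_comm]
        exact Finset.sum_congr rfl fun e _ => Finset.sum_congr rfl fun b _ => by ring
      have f3 : ∀ i, pd i τ y = ∑ a, ∑ b, gi h y a b * pd i (pd a (pd b F)) y -
          ∑ a, ∑ b, (∑ c, ∑ e, gi h y a c * pd i (fun y => gm h y c e) y * gi h y e b) *
            pd a (pd b F) y := by
        intro i
        rw [hτ, pd_sum (m := ∞) (fun a _ => CD.sum fun b _ => (H.cd_gi a b).mul (hF2 a b))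
          one_le_top hy]
        rw [← Finset.sum_sub_distrib]
        refine Finset.sum_congr rfl fun a _ => ?_
        rw [pd_sum (m := ∞) (fun b _ => (H.cd_gi a b).mul (hF2 a b)) one_le_top hy,
          ← Finset.sum_sub_distrib]
        refine Finset.sum_congr rfl fun b _ => ?_
        rw [pd_mul (H.cd_gi a b) (hF2 a b) one_le_top hy, H.pd_gi hy]
        ring
      have g1 : ∑ i, ∑ j, gi h y i j * (pd i τ y * pd j K y) = ∑ i, pd i τ y * v i y := by
        refine Finset.sum_congr rfl fun i _ => ?_
        rw [hv, Finset.mul_sum]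
        exact Finset.sum_congr rfl fun j _ => by ring
      -- The cancellation of the third derivatives of `F`.
      have g2 : ∑ i, (∑ a, ∑ b, gi h y a b * pd i (pd a (pd b F)) y) * v i y =
          ∑ i, ∑ j, gi h y i j * ∑ a, pd i (pd j (pd a F)) y * v a y := by
        simp only [Finset.mul_sum, Finset.sum_mul]
        rw [Finset.sum_comm]
        refine Finset.sum_congr rfl fun a _ => ?_
        rw [Finset.sum_comm]
        refine Finset.sum_congr rfl fun b _ => Finset.sum_congr rfl fun i _ => ?_
        rw [pd_comm (hF1 b) two_le_top hy i a,
          pd_congr (i := a) (fun z hz => pd_comm hF two_le_top hz i b) hy]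
        ring
      -- `G⁻¹` is differentiated once inside `τ` and once inside `v`; these contributions also
      -- cancel.
      have g3 := sum_contract_third (fun i j => gi h y i j) (fun i j => pd i (pd j F) y)
        (fun i j k => pd i (fun y => gm h y j k) y) (fun i => v i y)
        (fun i j => pd_comm hF two_le_top hy i j) (fun i j k => H.pd_gm_swap_left hy i j k)
        (fun i j k => H.pd_gm_swap_right hy i j k)
      calc _ = ∑ i, ∑ j, gi h y i j * (pd i τ y * pd j K y) +
            τ y * (∑ i, ∑ j, gi h y i j * pd i (pd j K) y) -
            ∑ i, ∑ j, gi h y i j * ∑ a, pd i (pd j (pd a F)) y * v a y -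
            (∑ i, ∑ j, gi h y i j * ∑ a, pd j (pd a F) y * ∑ b, gi h y a b * pd i (pd b K) y -
            ∑ i, ∑ j, gi h y i j * ∑ a, pd j (pd a F) y *
              ∑ c, ∑ e, gi h y a c * pd i (fun y => gm h y c e) y * v e y) := by
            rw [Finset.mul_sum]
            simp only [← Finset.sum_add_distrib, ← Finset.sum_sub_distrib]
            refine Finset.sum_congr rfl fun i _ => ?_
            rw [Finset.mul_sum]
            simp only [← Finset.sum_add_distrib, ← Finset.sum_sub_distrib]
            refine Finset.sum_congr rfl fun j _ => ?_
            rw [f1]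
            simp only [f2, mul_sub, Finset.sum_add_distrib, Finset.sum_sub_distrib]
            ring
        _ = _ := by
            rw [g1, ← g2, ← g3]
            simp only [f3, sub_mul, Finset.sum_sub_distrib]
            ring
    have e4 : (gi h y * hm F y * gi h y * hm K y).trace =
        ∑ i, ∑ j, gi h y i j * ∑ a, pd j (pd a F) y * ∑ b, gi h y a b * pd i (pd b K) y := by
      simp only [Matrix.mul_assoc]
      simp only [Matrix.trace, Matrix.diag, Matrix.mul_apply, hm, Matrix.of_apply]
      refine Finset.sum_congr rfl fun i _ => Finset.sum_congr rfl fun j _ => ?_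
      congr 1
      refine Finset.sum_congr rfl fun a _ => ?_
      congr 1
      exact Finset.sum_congr rfl fun b _ => by rw [pd_comm hK le_rfl hy b i]
    rw [e1, H.sum_gi_pd hy, e2, e3, ← e4]
    simp only [lap, gam, dens, hs]
    have e5 : h y ^ (3 - d : ℤ) = h y ^ 4 * h y ^ (-((d : ℤ) + 1)) := by
      rw [← zpow_natCast, ← zpow_add₀ hhy]; congr 1; push_cast; ring
    have e6 : h y ^ (3 - d - 1 : ℤ) = h y ^ 3 * h y ^ (-((d : ℤ) + 1)) := by
      rw [← zpow_natCast, ← zpow_add₀ hhy]; congr 1; push_cast; ring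
    rw [e5, e6]
    push_cast
    field_simp
    ring
  have i1 := integrable_sph (((H.cd_lap (hF.of_le two_le_top)).mul (H.cd_lap hK)).mul
      (H.cd_dens.of_le zero_le)).continuous_sph
  have i2 := integrable_sph ((H.cd_gam (hF.of_le one_le_top) (hK.of_le one_le_two)).mul
      (H.cd_dens.of_le zero_le)).continuous_sph
  have i3 := integrable_sph ((H.cd_hs (hF.of_le two_le_top) hK).mul
      (H.cd_dens.of_le zero_le)).continuous_sph
  have := integral_congr_ae (μ := sig d)
    (Filter.Eventually.of_forall fun θ : Sph d => pt θ (sph_ne_zero θ))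
  rw [key] at this
  erw [integral_sub (i1.add (i2.const_mul (3 - d : ℝ))) i3,
    integral_add i1 (i2.const_mul (3 - d : ℝ))] at this
  rw [integral_const_mul] at this
  linarith

end Adm

end

section


/-! ### Functions of degree zero and the planar inequality -/

open MeasureTheory Filter

variable {m : WithTop ℕ∞} {y : Euc d}

/-- Even functions of class `C^m` which are homogeneous of degree zero. -/
structure DZ (m : WithTop ℕ∞) (F : Euc d → ℝ) : Prop where
  cd : CD m F
  hom : Hom 0 F
  even : ∀ y, F (-y) = F y

/-- The quotient of a linear form and `h`. -/
def linQuot (h : Euc d → ℝ) (a : Euc d) (y : Euc d) : ℝ := (∑ i, a i * y i) * (h y)⁻¹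

theorem integral_sub_add {X : Type*} [MeasurableSpace X] {μ : Measure X} {f g k : X → ℝ}
    (hf : Integrable f μ) (hg : Integrable g μ) (hk : Integrable k μ) (a b : ℝ) :
    ∫ x, f x - a * g x + b * k x ∂μ = ∫ x, f x ∂μ - a * ∫ x, g x ∂μ + b * ∫ x, k x ∂μ := by
  have h1 := integral_add (hf.sub (hg.const_mul a)) (hk.const_mul b)
  have h2 := integral_sub hf (hg.const_mul a)
  simp only [Pi.sub_apply] at h1 h2
  rw [h1, h2, integral_const_mul, integral_const_mul]

namespace Adm

variable {h F K : Euc d → ℝ} (H : Adm h)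
include H

theorem gi_quad_nonneg (hy : y ≠ 0) (x : Fin (d + 1) → ℝ) :
    0 ≤ ∑ i, ∑ j, gi h y i j * (x i * x j) := by
  have := (H.gi_posDef hy).posSemidef.dotProduct_mulVec_nonneg x
  refine this.trans_eq ?_
  simp only [dotProduct, Matrix.mulVec, Finset.mul_sum]
  exact Finset.sum_congr rfl fun i _ => Finset.sum_congr rfl fun j _ => by simp; ring

theorem gam_self_nonneg (hy : y ≠ 0) : 0 ≤ gam h F F y :=
  mul_nonneg (sq_nonneg _) (H.gi_quad_nonneg hy fun i => pd i F y)

theorem gam_comm (hy : y ≠ 0) : gam h F K y = gam h K F y := by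
  simp only [gam]
  rw [Finset.sum_comm]
  congr 1
  exact Finset.sum_congr rfl fun i _ => Finset.sum_congr rfl fun j _ => by
    rw [H.gi_symm hy]; ring

omit H in
theorem gam_congr_left {a b : ℝ} {F₁ F₂ : Euc d → ℝ}
    (hF : ∀ i, pd i F y = a * pd i F₁ y + b * pd i F₂ y) :
    gam h F K y = a * gam h F₁ K y + b * gam h F₂ K y := by
  simp only [gam, hF, Finset.mul_sum, ← Finset.sum_add_distrib]
  exact Finset.sum_congr rfl fun i _ => Finset.sum_congr rfl fun j _ => by ring

/-- This is `0 ≤ |dF - q dK|²` at a single point. As `q` is just a number, it may later depend on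
the point. -/
theorem two_mul_gam_le (hy : y ≠ 0) (q : ℝ) :
    2 * q * gam h F K y ≤ gam h F F y + q ^ 2 * gam h K K y := by
  have h1 := mul_nonneg (sq_nonneg (h y)) (H.gi_quad_nonneg hy fun i => pd i F y - q * pd i K y)
  have h2 : h y ^ 2 * ∑ i, ∑ j, gi h y i j * ((pd i F y - q * pd i K y) * (pd j F y - q * pd j K y))
      = gam h F F y - q * gam h F K y - q * gam h K F y + q ^ 2 * gam h K K y := by
    simp only [gam, Finset.mul_sum, ← Finset.sum_add_distrib, ← Finset.sum_sub_distrib]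
    exact Finset.sum_congr rfl fun i _ => Finset.sum_congr rfl fun j _ => by ring
  rw [h2, H.gam_comm hy (F := K)] at h1
  linarith

theorem cd_linQuot (a : Euc d) : CD ∞ (linQuot h a) :=
  (CD.sum fun i _ => (cd_const _).mul (cd_coord i)).mul (H.cd.inv fun _ hy => H.ne hy)

theorem hom_linQuot (a : Euc d) : Hom 0 (linQuot h a) :=
  ((Hom.sum fun i _ => (hom_const (a i)).mul (hom_coord i)).mul H.hom.inv).cast (by ring)

/-- The trace of `G⁻¹ G` is `d + 1`, and the summand `dh ⊗ dh` of `G` accounts for `1` of it. -/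
theorem sum_gi_hess (hy : y ≠ 0) : h y * ∑ i, ∑ j, gi h y i j * pd i (pd j h) y = d := by
  have h1 : ∑ i, ∑ j, gi h y i j * gm h y i j = (d : ℝ) + 1 := by
    have : (gi h y * gm h y).trace = (d : ℝ) + 1 := by
      rw [H.gi_mul_gm hy]; simp
    rw [← this]
    simp only [Matrix.trace, Matrix.diag, Matrix.mul_apply]
    exact Finset.sum_congr rfl fun i _ => Finset.sum_congr rfl fun j _ => by rw [H.gm_symm hy i j]
  have h2 := H.sum_gi_pd hy fun j => pd j h y
  rw [H.euler hy, inv_mul_cancel₀ (H.ne hy)] at h2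
  simp only [gm, Matrix.of_apply, mul_add, Finset.sum_add_distrib, h2] at h1
  rw [Finset.mul_sum]
  have h3 : ∑ i, h y * ∑ j, gi h y i j * pd i (pd j h) y =
      ∑ i, ∑ j, gi h y i j * (h y * pd i (pd j h) y) := by
    simp only [Finset.mul_sum]
    exact Finset.sum_congr rfl fun i _ => Finset.sum_congr rfl fun j _ => by ring
  rw [h3]; linarith

/-- Differentiating `h u = ⟨a, y⟩` twice gives zero on the right. After contraction with `G⁻¹` the
mixed terms vanish, since `G⁻¹ dh` is radial and `u` has degree zero, and `sum_gi_hess` evaluates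
the rest. These odd eigenfunctions, with eigenvalue `d`, reflect translations of the body. -/
theorem lap_linQuot (hy : y ≠ 0) (a : Euc d) : lap h (linQuot h a) y = -d * linQuot h a y := by
  set u := linQuot h a with hu
  have hu1 : CD ∞ u := H.cd_linQuot a
  have hu2 : ∀ j, CD ∞ (pd j u) := fun j => hu1.pd top_add_one_le j
  have hhu : ∀ z, z ≠ 0 → h z * u z = ∑ i, a i * z i := fun z hz => by
    have := H.ne hz
    simp only [hu, linQuot]; field_simp
  have h1 : ∀ j, ∀ z, z ≠ 0 → pd j h z * u z + h z * pd j u z = a j := fun j z hz => by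
    rw [← pd_mul H.cd hu1 one_le_top hz, pd_congr hhu hz,
      pd_sum (m := 1) (fun i _ => (cd_const _).mul (cd_coord i)) le_rfl hz]
    simp only [pd_const_mul (m := 1) _ (cd_coord _) le_rfl hz, pd_coord]
    simp
  have h2 : ∀ i j, pd i (pd j h) y * u y + pd j h y * pd i u y +
      (pd i h y * pd j u y + h y * pd i (pd j u) y) = 0 := fun i j => by
    rw [← pd_mul (H.cd_pd j) hu1 one_le_top hy, ← pd_mul H.cd (hu2 j) one_le_top hy,
      ← pd_add ((H.cd_pd j).mul hu1) (H.cd.mul (hu2 j)) one_le_top hy, pd_congr (h1 j) hy, pd_const]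
  have h3 : h y * ∑ i, ∑ j, gi h y i j * pd i (pd j u) y =
      -(u y * ∑ i, ∑ j, gi h y i j * pd i (pd j h) y)
      - ∑ i, ∑ j, gi h y i j * (pd i u y * pd j h y)
      - ∑ i, ∑ j, gi h y i j * (pd i h y * pd j u y) := by
    simp only [Finset.mul_sum, ← Finset.sum_sub_distrib, ← Finset.sum_neg_distrib]
    refine Finset.sum_congr rfl fun i _ => Finset.sum_congr rfl fun j _ => ?_
    linear_combination gi h y i j * h2 i j
  have h4 : ∑ i, ∑ j, gi h y i j * (pd i h y * pd j u y) = 0 := by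
    rw [H.sum_gi_pd hy, (H.hom_linQuot a).euler hu1 one_le_top hy]; simp
  have h5 : ∑ i, ∑ j, gi h y i j * (pd i u y * pd j h y) = 0 := by
    rw [← h4, Finset.sum_comm]
    exact Finset.sum_congr rfl fun i _ => Finset.sum_congr rfl fun j _ => by
      rw [H.gi_symm hy]; ring
  rw [h4, h5] at h3
  have h6 := H.sum_gi_hess hy
  simp only [lap]
  linear_combination h y * h3 - u y * h6

/-- A Picone type inequality. -/
theorem picone (hF : CD 2 F) (hF0 : Hom 0 F) (a : Euc d) {C : ℝ}
    (hC : ∀ θ : Sph d, |F θ| ≤ C * |linQuot h a θ|) :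
    d * ∫ θ : Sph d, F θ ^ 2 * dens h θ ∂(sig d) ≤ ∫ θ : Sph d, gam h F F θ * dens h θ ∂(sig d) := by
  set u := linQuot h a with hu
  have hu1 : CD ∞ u := H.cd_linQuot a
  have hu0 : Hom 0 u := H.hom_linQuot a
  have hd0 := H.cd_dens.of_le (k := 0) zero_le
  have hF1 : CD 1 F := hF.of_le one_le_two
  have hu11 : CD 1 u := hu1.of_le one_le_top
  have iE := integrable_sph ((H.cd_gam hF1 hF1).mul hd0).continuous_sph
  -- the inequality with a regularization parameter
  have main : ∀ ε : ℝ, 0 < ε →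
      d * ∫ θ : Sph d, F θ ^ 2 * u θ ^ 2 * (u θ ^ 2 + ε ^ 2)⁻¹ * dens h θ ∂(sig d) ≤
        ∫ θ : Sph d, gam h F F θ * dens h θ ∂(sig d) +
        ∫ θ : Sph d, F θ ^ 2 * ε ^ 2 * ((u θ ^ 2 + ε ^ 2)⁻¹) ^ 2 * gam h u u θ * dens h θ
          ∂(sig d) := by
    intro ε hε
    have hne : ∀ z, u z ^ 2 + ε ^ 2 ≠ 0 := fun z => by positivity
    have hw1 : CD 1 fun z => u z ^ 2 + ε ^ 2 := (hu11.pow 2).add (cd_const _)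
    have hw : CD 1 fun z => (u z ^ 2 + ε ^ 2)⁻¹ := hw1.inv fun z _ => hne z
    have hK1 : CD 1 fun z => F z ^ 2 * u z := (hF1.pow 2).mul hu11
    -- Picone's argument would test `Δu = -d u` against `F² / u`. Since `u` has zeros, the quotient
    -- is regularized; the resulting error disappears as `ε → 0` thanks to `|F| ≤ C |u|`.
    have hK : CD 1 fun z => F z ^ 2 * u z * (u z ^ 2 + ε ^ 2)⁻¹ := hK1.mul hw
    have hK0 : Hom 0 fun z => F z ^ 2 * u z * (u z ^ 2 + ε ^ 2)⁻¹ := by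
      intro c hc z hz
      have e1 := hF0 c hc z hz
      have e2 := hu0 c hc z hz
      simp only [zpow_zero, one_mul] at e1 e2 ⊢
      simp only [e1, e2]
    have green := H.integral_mul_lap (hu1.of_le two_le_top) hu0 hK hK0
    have hpd : ∀ z, z ≠ 0 → ∀ i, pd i (fun z => F z ^ 2 * u z * (u z ^ 2 + ε ^ 2)⁻¹) z =
        (2 * (F z * u z * (u z ^ 2 + ε ^ 2)⁻¹)) * pd i F z +
          (F z ^ 2 * (ε ^ 2 - u z ^ 2) * ((u z ^ 2 + ε ^ 2)⁻¹) ^ 2) * pd i u z := by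
      intro z hz i
      have := hne z
      rw [pd_mul hK1 hw le_rfl hz, pd_mul (hF1.pow 2) hu11 le_rfl hz, pd_pow hF1 le_rfl hz,
        pd_inv hw1 le_rfl hz (hne z), pd_add (hu11.pow 2) (cd_const _) le_rfl hz,
        pd_pow hu11 le_rfl hz, pd_const]
      field_simp
      push_cast
      ring
    have hpt : ∀ z, z ≠ 0 →
        gam h (fun z => F z ^ 2 * u z * (u z ^ 2 + ε ^ 2)⁻¹) u z ≤ gam h F F z +
        F z ^ 2 * ε ^ 2 * ((u z ^ 2 + ε ^ 2)⁻¹) ^ 2 * gam h u u z := by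
      intro z hz
      rw [gam_congr_left (hpd z hz)]
      -- This `q` is half the coefficient of `dF` in the differential of the test function, so the
      -- cross term is absorbed by a complete square.
      have := H.two_mul_gam_le hz (F := F) (K := u) (F z * u z * (u z ^ 2 + ε ^ 2)⁻¹)
      have e : F z ^ 2 * (ε ^ 2 - u z ^ 2) * ((u z ^ 2 + ε ^ 2)⁻¹) ^ 2 +
          (F z * u z * (u z ^ 2 + ε ^ 2)⁻¹) ^ 2 =
          F z ^ 2 * ε ^ 2 * ((u z ^ 2 + ε ^ 2)⁻¹) ^ 2 := by ring
      rw [← e, add_mul]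
      linarith
    have hL : d * ∫ θ : Sph d, F θ ^ 2 * u θ ^ 2 * (u θ ^ 2 + ε ^ 2)⁻¹ * dens h θ ∂(sig d) =
        ∫ θ : Sph d, gam h (fun z => F z ^ 2 * u z * (u z ^ 2 + ε ^ 2)⁻¹) u θ * dens h θ
          ∂(sig d) := by
      rw [← neg_inj, ← green, ← integral_const_mul, ← integral_neg]
      refine integral_congr_ae (Eventually.of_forall fun θ => ?_)
      simp only [hu, H.lap_linQuot (sph_ne_zero θ)]
      ring
    have iR := integrable_sph ((((((hF1.of_le zero_le).pow 2).mul (cd_const (ε ^ 2))).mul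
      ((hw.of_le zero_le).pow 2)).mul (H.cd_gam hu11 hu11)).mul hd0).continuous_sph
    rw [hL, ← integral_add iE iR]
    refine integral_mono (integrable_sph ((H.cd_gam hK hu11).mul hd0).continuous_sph)
      (iE.add iR) fun θ => ?_
    have := mul_le_mul_of_nonneg_right (hpt θ (sph_ne_zero θ)) (H.dens_pos (sph_ne_zero θ)).le
    simp only
    linarith
  have hcu : Continuous fun θ : Sph d => u θ := hu1.continuous_sph
  have hcF : Continuous fun θ : Sph d => F θ := hF.continuous_sph
  have hcd : Continuous fun θ : Sph d => dens h θ := hd0.continuous_sph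
  have hcg : Continuous fun θ : Sph d => gam h u u θ := (H.cd_gam hu11 hu11).continuous_sph
  have hne' : ∀ {ε : ℝ}, 0 < ε → ∀ θ : Sph d, u θ ^ 2 + ε ^ 2 ≠ 0 := fun hε θ => by positivity
  have hF00 : ∀ θ : Sph d, u θ = 0 → F θ = 0 := fun θ h0 => by
    have := hC θ
    rw [h0] at this
    simpa using this
  have lim1 : Tendsto (fun ε : ℝ => ∫ θ : Sph d,
      F θ ^ 2 * u θ ^ 2 * (u θ ^ 2 + ε ^ 2)⁻¹ * dens h θ ∂(sig d)) (𝓝[>] 0)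
      (𝓝 (∫ θ : Sph d, F θ ^ 2 * dens h θ ∂(sig d))) := by
    refine tendsto_integral_filter_of_dominated_convergence (fun θ => F θ ^ 2 * dens h θ) ?_ ?_
      (integrable_sph ((hcF.pow 2).mul hcd)) ?_
    · filter_upwards [self_mem_nhdsWithin] with ε hε
      have hε' : (0 : ℝ) < ε := hε
      exact (((((hcF.pow 2).mul (hcu.pow 2)).mul (((hcu.pow 2).add continuous_const).inv₀
        fun θ => hne' hε' θ)).mul hcd)).aestronglyMeasurable
    · filter_upwards [self_mem_nhdsWithin] with ε hε
      have hε' : (0 : ℝ) < ε := hε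
      refine Eventually.of_forall fun θ => ?_
      have hdp := (H.dens_pos (sph_ne_zero θ))
      rw [Real.norm_of_nonneg (by positivity)]
      refine mul_le_mul_of_nonneg_right ?_ hdp.le
      rw [mul_assoc]
      refine mul_le_of_le_one_right (sq_nonneg _) ?_
      rw [← div_eq_mul_inv]
      exact div_le_one_of_le₀ (by nlinarith) (by positivity)
    · refine Eventually.of_forall fun θ => ?_
      by_cases h0 : u θ = 0
      · simp [hF00 θ h0]
      · refine tendsto_nhdsWithin_of_tendsto_nhds ?_
        have hc : ContinuousAt (fun ε : ℝ =>
            F θ ^ 2 * u θ ^ 2 * (u θ ^ 2 + ε ^ 2)⁻¹ * dens h θ) 0 :=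
          (continuousAt_const.mul ((continuousAt_const.add (continuousAt_id.pow 2)).inv₀
            (by simpa using h0))).mul continuousAt_const
        have := hc.tendsto
        convert this using 2
        field_simp
        ring
  have lim2 : Tendsto (fun ε : ℝ => ∫ θ : Sph d,
      F θ ^ 2 * ε ^ 2 * ((u θ ^ 2 + ε ^ 2)⁻¹) ^ 2 * gam h u u θ * dens h θ ∂(sig d)) (𝓝[>] 0)
      (𝓝 (∫ θ : Sph d, (0 : ℝ) ∂(sig d))) := by
    refine tendsto_integral_filter_of_dominated_convergence
      (fun θ => C ^ 2 * gam h u u θ * dens h θ) ?_ ?_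
      (integrable_sph ((continuous_const.mul hcg).mul hcd)) ?_
    · filter_upwards [self_mem_nhdsWithin] with ε hε
      have hε' : (0 : ℝ) < ε := hε
      exact ((((((hcF.pow 2).mul continuous_const).mul ((((hcu.pow 2).add continuous_const).inv₀
        fun θ => hne' hε' θ).pow 2)).mul hcg).mul hcd)).aestronglyMeasurable
    · filter_upwards [self_mem_nhdsWithin] with ε hε
      have hε' : (0 : ℝ) < ε := hε
      refine Eventually.of_forall fun θ => ?_
      have hdp := (H.dens_pos (sph_ne_zero θ))
      have hgp := H.gam_self_nonneg (F := u) (sph_ne_zero θ)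
      rw [Real.norm_of_nonneg (by positivity)]
      refine mul_le_mul_of_nonneg_right (mul_le_mul_of_nonneg_right ?_ hgp) hdp.le
      -- The bound on `F` by `u` makes the error dominated uniformly in `ε`.
      have e1 : F θ ^ 2 ≤ C ^ 2 * u θ ^ 2 := by
        rw [← sq_abs (F θ), ← sq_abs (u θ), ← mul_pow]
        exact pow_le_pow_left₀ (abs_nonneg _) (hC θ) 2
      have e2 : u θ ^ 2 * ε ^ 2 ≤ (u θ ^ 2 + ε ^ 2) ^ 2 := by
        nlinarith [sq_nonneg (u θ ^ 2), sq_nonneg (ε ^ 2), mul_nonneg (sq_nonneg (u θ)) (sq_nonneg ε)]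
      rw [inv_pow, ← div_eq_mul_inv, div_le_iff₀ (by positivity)]
      calc F θ ^ 2 * ε ^ 2 ≤ C ^ 2 * u θ ^ 2 * ε ^ 2 :=
            mul_le_mul_of_nonneg_right e1 (sq_nonneg _)
        _ = C ^ 2 * (u θ ^ 2 * ε ^ 2) := by ring
        _ ≤ _ := mul_le_mul_of_nonneg_left e2 (sq_nonneg _)
    · refine Eventually.of_forall fun θ => ?_
      by_cases h0 : u θ = 0
      · simp [hF00 θ h0]
      · refine tendsto_nhdsWithin_of_tendsto_nhds ?_
        have hc : ContinuousAt (fun ε : ℝ =>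
            F θ ^ 2 * ε ^ 2 * ((u θ ^ 2 + ε ^ 2)⁻¹) ^ 2 * gam h u u θ * dens h θ) 0 :=
          (((continuousAt_const.mul (continuousAt_id.pow 2)).mul
            (((continuousAt_const.add (continuousAt_id.pow 2)).inv₀
            (by simpa using h0)).pow 2)).mul continuousAt_const).mul continuousAt_const
        have := hc.tendsto
        convert this using 2
        ring
  have := le_of_tendsto_of_tendsto (lim1.const_mul (d : ℝ)) (lim2.const_add _)
    (by filter_upwards [self_mem_nhdsWithin] with ε hε using main ε hε)
  simpa using this


theorem integrable_mul_dens {f : Euc d → ℝ} (hf : CD 0 f) :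
    Integrable (fun θ : Sph d => f θ * dens h θ) (sig d) :=
  integrable_sph (hf.mul (H.cd_dens.of_le zero_le)).continuous_sph

theorem integral_dens_pos : 0 < ∫ θ : Sph d, dens h θ ∂(sig d) := by
  have hc : Continuous fun θ : Sph d => dens h θ := H.cd_dens.continuous_sph
  refine hc.integral_pos_of_hasCompactSupport_nonneg_nonzero (HasCompactSupport.of_compactSpace _)
    (fun θ => (H.dens_pos (sph_ne_zero θ)).le) (x := ⟨EuclideanSpace.single 0 1, by simp⟩)
    (H.dens_pos (sph_ne_zero _)).ne'

end Adm

theorem DZ.const_mem (c : ℝ) : DZ (d := d) m fun _ => c := ⟨cd_const c, hom_const c, fun _ => rfl⟩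

theorem DZ.sub {F K : Euc d → ℝ} (hF : DZ m F) (hK : DZ m K) : DZ m fun y => F y - K y :=
  ⟨hF.cd.sub hK.cd, hF.hom.sub hK.hom, fun y => by simp only [hF.even, hK.even]⟩

theorem DZ.of_le {k : WithTop ℕ∞} {F : Euc d → ℝ} (hF : DZ m F) (hk : k ≤ m) : DZ k F :=
  ⟨hF.cd.of_le hk, hF.hom, hF.even⟩

theorem DZ.smul_eq {F : Euc d → ℝ} (hF : DZ m F) {c : ℝ} (hc : c ≠ 0) (hy : y ≠ 0) :
    F (c • y) = F y := by
  rcases lt_or_gt_of_ne hc with h | h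
  · have := hF.hom (-c) (neg_pos.2 h) y hy
    rw [neg_smul, hF.even] at this
    simpa using this
  · simpa using hF.hom c h y hy

/-! ### The planar inequality -/

/-- The rotation by a right angle. -/
def rot (y : Euc 1) : Euc 1 := !₂[-y 1, y 0]

/-- An even function with a zero at `φ` also vanishes at `-φ`, and `±φ` are exactly the zeros on the
circle of the linear form `rot φ`, both simple. Away from them boundedness of `F` suffices. Near
them `F` is read off on the tangent line at `φ` and estimated by the mean value inequality. -/
theorem abs_le_mul_abs_of_zero {F : Euc 1 → ℝ} (hF : DZ 1 F) (φ : Sph 1) (h0 : F φ = 0) :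
    ∃ C : ℝ, 0 ≤ C ∧ ∀ θ : Sph 1, |F θ| ≤ C * |∑ i, rot φ i * (θ : Euc 1) i| := by
  obtain ⟨B, hB⟩ := (isCompact_univ (X := Sph 1)).exists_bound_of_continuousOn
    hF.cd.continuous_sph.continuousOn
  have hφ : (φ : Euc 1) 0 * (φ : Euc 1) 0 + (φ : Euc 1) 1 * (φ : Euc 1) 1 = 1 :=
    (Fin.sum_univ_two _).symm.trans (sph_sum_sq φ)
  have hline : ∀ s : ℝ, (φ : Euc 1) + s • rot φ ≠ 0 := by
    intro s hs
    have e0 := congrArg (fun v : Euc 1 => v 0) hs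
    have e1 := congrArg (fun v : Euc 1 => v 1) hs
    simp [rot] at e0 e1
    refine one_ne_zero (α := ℝ) ?_
    linear_combination (φ : Euc 1) 0 * e0 + (φ : Euc 1) 1 * e1 - hφ
  have hg : ContDiff ℝ 1 fun s : ℝ => F ((φ : Euc 1) + s • rot φ) := by
    rw [contDiff_iff_contDiffAt]
    intro s
    exact (hF.cd.contDiffAt (hline s)).comp s
      (contDiff_const.add (contDiff_id.smul contDiff_const)).contDiffAt
  obtain ⟨M, hM⟩ := (isCompact_Icc (a := (-1 : ℝ)) (b := 1)).exists_bound_of_continuousOn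
    (hg.continuous_deriv le_rfl).continuousOn
  have hB0 : 0 ≤ B := (norm_nonneg _).trans (hB φ trivial)
  have hM0 : 0 ≤ M := (norm_nonneg _).trans (hM 0 (by norm_num))
  refine ⟨2 * B + 2 * M, by positivity, fun θ => ?_⟩
  set β := ∑ i, rot φ i * (θ : Euc 1) i
  set α := ∑ i, (φ : Euc 1) i * (θ : Euc 1) i
  have hθ : (θ : Euc 1) 0 * (θ : Euc 1) 0 + (θ : Euc 1) 1 * (θ : Euc 1) 1 = 1 :=
    (Fin.sum_univ_two _).symm.trans (sph_sum_sq θ)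
  have hα : α = (φ : Euc 1) 0 * (θ : Euc 1) 0 + (φ : Euc 1) 1 * (θ : Euc 1) 1 := Fin.sum_univ_two _
  have hβ : β = -((φ : Euc 1) 1 * (θ : Euc 1) 0) + (φ : Euc 1) 0 * (θ : Euc 1) 1 :=
    (Fin.sum_univ_two _).trans (by simp [rot])
  have hαβ : α ^ 2 + β ^ 2 = 1 := by
    rw [hα, hβ]
    linear_combination ((θ : Euc 1) 0 * (θ : Euc 1) 0 + (θ : Euc 1) 1 * (θ : Euc 1) 1) * hφ + hθ
  have hdec : (θ : Euc 1) = α • (φ : Euc 1) + β • rot φ := by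
    ext i
    fin_cases i
    · simp [rot, hα, hβ]
      linear_combination -(θ : Euc 1) 0 * hφ
    · simp [rot, hα, hβ]
      linear_combination -(θ : Euc 1) 1 * hφ
  by_cases hb : 1 / 2 ≤ |β|
  · calc |F θ| ≤ B := hB θ trivial
      _ ≤ 2 * B * |β| := by nlinarith
      _ ≤ _ := by nlinarith [abs_nonneg β]
  · push Not at hb
    have ha : 1 / 2 ≤ |α| := by
      by_contra hcon
      push Not at hcon
      nlinarith [sq_abs α, sq_abs β, abs_nonneg α, abs_nonneg β]
    have ha0 : α ≠ 0 := by
      rintro h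
      rw [h] at ha
      norm_num at ha
    have hs : |β / α| ≤ 2 * |β| := by
      rw [abs_div, div_le_iff₀ (by positivity)]
      nlinarith [abs_nonneg β]
    have hs1 : β / α ∈ Set.Icc (-1 : ℝ) 1 := by
      rw [Set.mem_Icc, ← abs_le]
      linarith
    -- The coefficient `α` may be negative; evenness is what allows rescaling by it.
    have hF1 : F θ = F ((φ : Euc 1) + (β / α) • rot φ) := by
      rw [← hF.smul_eq ha0 (hline _), hdec, smul_add, smul_smul, mul_div_cancel₀ _ ha0]
    have := (convex_Icc (-1 : ℝ) 1).norm_image_sub_le_of_norm_deriv_le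
      (fun s _ => hg.differentiable one_ne_zero s) hM (by norm_num : (0 : ℝ) ∈ Set.Icc (-1 : ℝ) 1) hs1
    simp only [zero_smul, add_zero, h0, sub_zero, ← hF1, Real.norm_eq_abs] at this
    calc |F θ| ≤ M * |β / α| := this
      _ ≤ M * (2 * |β|) := mul_le_mul_of_nonneg_left hs hM0
      _ ≤ _ := by nlinarith [mul_nonneg hB0 (abs_nonneg β)]

/-- Picone with the eigenfunction that vanishes at `±φ`. An upper bound of `h` on the circle
compares the linear form with its quotient by `h`. -/
theorem Adm.planar_of_zero {h F : Euc 1 → ℝ} (H : Adm h) (hF : DZ 2 F) (φ : Sph 1) (h0 : F φ = 0) :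
    ∫ θ : Sph 1, F θ ^ 2 * dens h θ ∂(sig 1) ≤ ∫ θ : Sph 1, gam h F F θ * dens h θ ∂(sig 1) := by
  obtain ⟨C, hC0, hC⟩ := abs_le_mul_abs_of_zero (hF.of_le one_le_two) φ h0
  obtain ⟨B, hB⟩ := (isCompact_univ (X := Sph 1)).exists_bound_of_continuousOn
    H.cd.continuous_sph.continuousOn
  have := H.picone hF.cd hF.hom (rot φ) (C := C * B) fun θ => by
    have hp := H.pos _ (sph_ne_zero θ)
    have hb : h θ ≤ B := (le_abs_self _).trans (hB θ trivial)
    calc |F θ| ≤ C * |∑ i, rot φ i * (θ : Euc 1) i| := hC θ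
      _ = C * h θ * |linQuot h (rot φ) θ| := by
        rw [linQuot, abs_mul, abs_inv, abs_of_pos hp]; field_simp
      _ ≤ _ := by gcongr
  simpa using this

/-- The even local log-Brunn--Minkowski inequality in the plane. -/
theorem Adm.planar {h F : Euc 1 → ℝ} (H : Adm h) (hF : DZ 2 F)
    (h0 : ∫ θ : Sph 1, F θ * dens h θ ∂(sig 1) = 0) :
    2 * ∫ θ : Sph 1, F θ ^ 2 * dens h θ ∂(sig 1) ≤
      ∫ θ : Sph 1, gam h F F θ * dens h θ ∂(sig 1) := by
  set A := ∫ θ : Sph 1, F θ ^ 2 * dens h θ ∂(sig 1)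
  set E := ∫ θ : Sph 1, gam h F F θ * dens h θ ∂(sig 1) with hE
  set M := ∫ θ : Sph 1, dens h θ ∂(sig 1)
  have hF0 : CD 0 F := hF.cd.of_le zero_le
  have i0 := integrable_sph (H.cd_dens.continuous_sph)
  have i1 := H.integrable_mul_dens hF0
  have i2 := H.integrable_mul_dens (hF0.pow 2)
  -- `F - F φ` vanishes at `φ`, so the previous estimate applies to it; since `F` has mean zero,
  -- this gains `F φ ^ 2 * M`. Averaging over `φ` turns the gain into a second copy of `∫ F²`, hence
  -- the constant `2`.
  have key : ∀ φ : Sph 1, F φ ^ 2 * M ≤ E - A := by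
    intro φ
    have h1 := H.planar_of_zero (hF.sub (DZ.const_mem (F φ))) φ (sub_self _)
    have h2 : ∀ θ : Sph 1, gam h (fun y => F y - F φ) (fun y => F y - F φ) θ = gam h F F θ := by
      intro θ
      have : ∀ i, pd i (fun y => F y - F φ) θ = pd i F θ := fun i => by
        rw [pd_sub hF.cd (cd_const _) one_le_two (sph_ne_zero θ), pd_const, sub_zero]
      simp only [gam, this]
    have h3 : ∀ θ : Sph 1, (F θ - F φ) ^ 2 * dens h θ =
        F θ ^ 2 * dens h θ - 2 * F φ * (F θ * dens h θ) + F φ ^ 2 * dens h θ := fun θ => by ring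
    simp only [h2, h3] at h1
    rw [integral_sub_add i2 i1 i0, h0] at h1
    linarith
  have h4 : ∫ φ : Sph 1, F φ ^ 2 * dens h φ * M ∂(sig 1) ≤
      ∫ φ : Sph 1, (E - A) * dens h φ ∂(sig 1) := by
    refine integral_mono (i2.mul_const _) (i0.const_mul _) fun φ => ?_
    have := mul_le_mul_of_nonneg_right (key φ) (H.dens_pos (sph_ne_zero φ)).le
    simp only
    linarith
  rw [integral_mul_const, integral_const_mul] at h4
  have := le_of_mul_le_mul_right h4 H.integral_dens_pos
  linarith

end

section


/-! ### The Hessian norm and the range of the Laplacian -/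

open MeasureTheory Filter

variable {m : WithTop ℕ∞} {y : Euc d}

section MatrixTrace

variable {ι : Type*} [Fintype ι] {R S U D : Matrix ι ι ℝ}

/-- Regrouped as `R * (S R S)`, the product has two positive semidefinite factors. Splitting `R`
into rank-one terms `v vᵀ` makes the trace a sum of values of the quadratic form of `S R S`. -/
theorem trace_quad_nonneg (hR : R.PosSemidef) (hS : S.IsSymm) : 0 ≤ (R * S * R * S).trace := by
  have h1 : (S * R * S).PosSemidef := by
    have := hR.conjTranspose_mul_mul_same S
    have hS' : S.conjTranspose = S := by simpa using hS.eq
    rwa [hS'] at this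
  obtain ⟨k, v, hv⟩ := Matrix.posSemidef_iff_eq_sum_vecMulVec.1 hR
  rw [show R * S * R * S = R * (S * R * S) by simp only [Matrix.mul_assoc]]
  generalize S * R * S = P at h1
  rw [hv, Finset.sum_mul, Matrix.trace_sum]
  refine Finset.sum_nonneg fun i _ => ?_
  rw [Matrix.vecMulVec_mul, Matrix.trace_vecMulVec, dotProduct_comm, ← Matrix.dotProduct_mulVec]
  exact h1.dotProduct_mulVec_nonneg _

/-- The Cauchy--Schwarz inequality for the scalar product of symmetric two-tensors. -/
theorem sq_trace_mul_le [DecidableEq ι] {G : Matrix ι ι ℝ} (hR : R.PosSemidef) (hRG : R * G = 1)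
    (hG : G.IsSymm) (hU : U.IsSymm) (hD : D.IsSymm) :
    (D * U).trace ^ 2 ≤ (D * G * D * G).trace * (R * U * R * U).trace := by
  have hGR : G * R = 1 := mul_eq_one_comm.1 hRG
  -- Lowering the indices of `D` to `G D G` makes it comparable with `U`. The squared norm of `U + x
  -- G D G` is a nonnegative quadratic polynomial in `x`, and the inequality is the sign of its
  -- discriminant.
  have key : ∀ x : ℝ, 0 ≤ (D * G * D * G).trace * (x * x) + 2 * (D * U).trace * x +
      (R * U * R * U).trace := by
    intro x
    have hS : (U + x • (G * D * G)).IsSymm := by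
      unfold Matrix.IsSymm at *
      simp [Matrix.transpose_mul, hU, hG, hD, Matrix.mul_assoc]
    refine (trace_quad_nonneg hR hS).trans_eq ?_
    have e0 : R * (G * D * G) = D * G := by
      rw [Matrix.mul_assoc G, ← Matrix.mul_assoc, hRG, one_mul]
    have e1 : R * (U + x • (G * D * G)) = R * U + x • (D * G) := by
      rw [mul_add, Matrix.mul_smul, e0]
    have e2 : (R * U * (D * G)).trace = (D * U).trace := by
      rw [Matrix.trace_mul_comm, Matrix.mul_assoc D, ← Matrix.mul_assoc G, hGR, one_mul]
    have e3 : (D * G * (R * U)).trace = (D * U).trace := by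
      rw [Matrix.trace_mul_comm, e2]
    rw [Matrix.mul_assoc _ R, e1, add_mul, mul_add, mul_add]
    simp only [Matrix.trace_add, Matrix.smul_mul, Matrix.mul_smul, Matrix.trace_smul, smul_eq_mul,
      e2, e3]
    simp only [Matrix.mul_assoc]
    ring
  have := discrim_le_zero key
  rw [discrim] at this
  nlinarith

end MatrixTrace

theorem hm_isSymm {F : Euc d → ℝ} (hF : CD 2 F) (hy : y ≠ 0) : (hm F y).IsSymm := by
  ext i j
  exact pd_comm hF le_rfl hy j i

theorem pd_neg_arg (F : Euc d → ℝ) (i : Fin (d + 1)) (y : Euc d) :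
    pd i (fun z => F (-z)) y = -pd i F (-y) := by
  have h1 := fderiv_comp_smul (𝕜 := ℝ) (f := F) (x := y) (-1)
  simp only [neg_smul, one_smul] at h1
  simp only [pd, h1]; rfl

namespace Adm

variable {h F K : Euc d → ℝ} (H : Adm h)
include H

/-- The full Hessian dominates its mixed part. -/
theorem two_gam_le_hs (hF : CD 2 F) (hF0 : Hom 0 F) (hy : y ≠ 0) :
    2 * gam h F F y ≤ hs h F F y := by
  set a : Fin (d + 1) → ℝ := fun i => pd i h y with ha
  set b : Fin (d + 1) → ℝ := fun i => pd i F y with hb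
  set R := gi h y with hR
  set U := hm F y with hU
  set c := (h y)⁻¹ with hc
  have hhy := H.ne hy
  have hRs : R.IsSymm := by ext i j; exact H.gi_symm hy j i
  have hUs := hm_isSymm hF hy
  -- Degree zero forces the radial components `D²F y = -dF`. Adding `h⁻¹ (dh ⊗ dF + dF ⊗ dh)`
  -- removes them and lowers the squared norm by exactly the gradient term; what remains is
  -- nonnegative.
  set Q := Matrix.vecMulVec a b + Matrix.vecMulVec b a with hQ
  have hQs : Q.IsSymm := by
    ext i j
    simp [hQ, Matrix.vecMulVec]; ring
  have hS : (U + c • Q).IsSymm := hUs.add (hQs.smul c)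
  have h1 := trace_quad_nonneg (H.gi_posDef hy).posSemidef hS
  have hRa : R.mulVec a = c • (fun i => y i) := by
    ext i
    have := H.gi_mulVec hy i
    simp only [Matrix.mulVec, dotProduct, Pi.smul_apply, smul_eq_mul]
    rw [hR, ha, this]; ring
  have haR : Matrix.vecMul a R = c • (fun i => y i) := by
    rw [← Matrix.mulVec_transpose, hRs, hRa]
  have hyb : (fun i => y i) ⬝ᵥ b = 0 := by
    have := hF0.euler hF one_le_two hy
    simpa [dotProduct] using this
  have hya : (fun i => y i) ⬝ᵥ a = h y := H.euler hy
  have hyU : Matrix.vecMul (fun i => y i) U = -b := by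
    ext j
    have := (hF0.pd j).euler (hF.pd (k := 1) (by norm_num) j) le_rfl hy
    simp only [Matrix.vecMul, dotProduct, hU, hm, Matrix.of_apply, this]
    simp [hb]
  set g := b ⬝ᵥ R.mulVec b with hg
  have t1 : (R * U * (R * Q)).trace = -2 * c * g := by
    have e1 : (R * U * (R * Matrix.vecMulVec a b)).trace = -c * g := by
      rw [Matrix.mul_vecMulVec, hRa, Matrix.mul_vecMulVec, Matrix.trace_vecMulVec,
        Matrix.mulVec_smul, smul_dotProduct, ← Matrix.mulVec_mulVec, ← Matrix.vecMul_transpose U,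
        hUs, hyU, hg, Matrix.mulVec_neg, neg_dotProduct, dotProduct_comm]
      simp
    have e2 : (R * U * (R * Matrix.vecMulVec b a)).trace = -c * g := by
      rw [Matrix.mul_vecMulVec, Matrix.mul_vecMulVec, Matrix.trace_vecMulVec, dotProduct_comm,
        ← Matrix.mulVec_mulVec, Matrix.dotProduct_mulVec, haR, Matrix.dotProduct_mulVec,
        Matrix.smul_vecMul, hyU, hg]
      simp
    rw [hQ, mul_add, mul_add, Matrix.trace_add, e1, e2]; ring
  have t2 : (R * Q * (R * U)).trace = -2 * c * g := by rw [Matrix.trace_mul_comm, t1]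
  have aRa : a ⬝ᵥ R.mulVec a = 1 := by
    rw [hRa, dotProduct_smul, dotProduct_comm, hya, hc, smul_eq_mul, inv_mul_cancel₀ hhy]
  have aRb : a ⬝ᵥ R.mulVec b = 0 := by
    rw [Matrix.dotProduct_mulVec, haR, smul_dotProduct, hyb, smul_zero]
  have bRa : b ⬝ᵥ R.mulVec a = 0 := by
    rw [hRa, dotProduct_smul, dotProduct_comm, hyb, smul_zero]
  have t3 : (R * Q * (R * Q)).trace = 2 * g := by
    simp only [hQ, mul_add, add_mul, Matrix.mul_vecMulVec R, Matrix.vecMulVec_mul_vecMulVec,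
      Matrix.trace_add, Matrix.trace_vecMulVec, aRa, aRb, bRa,
      dotProduct_comm (R.mulVec _), ← hg, smul_dotProduct, smul_eq_mul]
    ring
  have h2 : (R * (U + c • Q) * R * (U + c • Q)).trace = (R * U * R * U).trace - 2 * c ^ 2 * g := by
    rw [Matrix.mul_assoc _ R]
    simp only [mul_add, add_mul, Matrix.trace_add, Matrix.mul_smul, Matrix.smul_mul,
      Matrix.trace_smul, smul_eq_mul, t1, t2, t3]
    rw [← Matrix.mul_assoc]; ring_nf
  rw [h2] at h1
  have h3 : gam h F F y = h y ^ 2 * g := by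
    simp only [gam, hg, dotProduct, Matrix.mulVec, Finset.mul_sum]
    exact Finset.sum_congr rfl fun i _ => Finset.sum_congr rfl fun j _ => by ring
  rw [h3, hs]
  have h4 := mul_nonneg (pow_nonneg (H.pos y hy).le 4) h1
  have h5 : h y ^ 4 * (2 * c ^ 2 * g) = 2 * (h y ^ 2 * g) := by
    rw [hc]; field_simp
  linarith

theorem integral_lap_mul_dens (hF : CD 2 F) (hF0 : Hom 0 F) :
    ∫ θ : Sph d, dens h θ * lap h F θ ∂(sig d) = 0 := by
  have := H.integral_mul_lap hF hF0 (cd_const 1) (hom_const 1)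
  simp only [one_mul] at this
  simp only [mul_comm (dens h _)]
  rw [this]
  simp [gam, pd_const]

theorem integral_gam_eq (hF : CD 2 F) (hF0 : Hom 0 F) :
    ∫ θ : Sph d, gam h F F θ * dens h θ ∂(sig d) =
      ∫ θ : Sph d, -lap h F θ * F θ * dens h θ ∂(sig d) := by
  have := H.integral_mul_lap hF hF0 (hF.of_le one_le_two) hF0
  rw [← neg_inj, ← this, ← integral_neg]
  exact integral_congr_ae (Eventually.of_forall fun θ => by simp only; ring)

/-- The Hessian of an even function is controlled by its Laplacian. -/
theorem integral_hs_le (hd : 1 ≤ d) (hF : DZ ∞ F) :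
    ∫ θ : Sph d, hs h F F θ * dens h θ ∂(sig d) ≤
      2 * ∫ θ : Sph d, lap h F θ ^ 2 * dens h θ ∂(sig d) := by
  have hF2 : CD 2 F := hF.cd.of_le two_le_top
  have bochner := H.integral_hs hF.cd hF.hom hF2 hF.hom
  have hcl := H.cd_lap hF2
  have hcg := H.cd_gam (hF2.of_le one_le_two) (hF2.of_le one_le_two)
  have h1 : 2 * ∫ θ : Sph d, gam h F F θ * dens h θ ∂(sig d) ≤
      ∫ θ : Sph d, hs h F F θ * dens h θ ∂(sig d) := by
    rw [← integral_const_mul]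
    refine integral_mono ((H.integrable_mul_dens hcg).const_mul 2)
      (H.integrable_mul_dens (H.cd_hs hF2 hF2)) fun θ => ?_
    have := mul_le_mul_of_nonneg_right (H.two_gam_le_hs hF2 hF.hom (sph_ne_zero θ))
      (H.dens_pos (sph_ne_zero θ)).le
    simp only; linarith
  simp only [← pow_two] at bochner
  set E := ∫ θ : Sph d, gam h F F θ * dens h θ ∂(sig d) with hE
  set L := ∫ θ : Sph d, lap h F θ ^ 2 * dens h θ ∂(sig d) with hL
  have hE0 : 0 ≤ E := integral_nonneg fun θ =>
    mul_nonneg (H.gam_self_nonneg (sph_ne_zero θ)) (H.dens_pos (sph_ne_zero θ)).le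
  have hL0 : 0 ≤ L := integral_nonneg fun θ =>
    mul_nonneg (sq_nonneg _) (H.dens_pos (sph_ne_zero θ)).le
  -- Bochner says that the integral of `hs` is `L + (3 - d) E`. For `d ≥ 2`, together with `h1`, it
  -- gives `(d - 1) E ≤ L`, which suffices. For `d = 1` these two facts do not bound `E`, and the
  -- planar inequality is used.
  rcases hd.lt_or_eq with h2 | h2
  · have hd2 : (2 : ℝ) ≤ d := by exact_mod_cast h2
    have h3 : (d - 1 : ℝ) * E ≤ L := by linarith
    nlinarith
  · subst h2
    have h3 : 2 * E ≤ L := by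
      set M := ∫ θ : Sph 1, dens h θ ∂(sig 1)
      have hM : 0 < M := H.integral_dens_pos
      have i0 := integrable_sph (H.cd_dens.continuous_sph)
      have i1 := H.integrable_mul_dens (hF2.of_le zero_le)
      set c := (∫ θ : Sph 1, F θ * dens h θ ∂(sig 1)) / M with hc
      have hF' : DZ 2 fun y => F y - c := (hF.of_le two_le_top).sub (DZ.const_mem c)
      have hpd : ∀ z, z ≠ 0 → ∀ i, pd i (fun y => F y - c) z = pd i F z := fun z hz i => by
        rw [pd_sub hF2 (cd_const _) one_le_two hz, pd_const, sub_zero]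
      have hgam : ∀ θ : Sph 1, gam h (fun y => F y - c) (fun y => F y - c) θ = gam h F F θ :=
        fun θ => by simp only [gam, hpd _ (sph_ne_zero θ)]
      have hlap : ∀ θ : Sph 1, lap h (fun y => F y - c) θ = lap h F θ := fun θ => by
        simp only [lap]
        congr 1
        exact Finset.sum_congr rfl fun i _ => Finset.sum_congr rfl fun j _ => by
          rw [pd_congr (fun z hz => hpd z hz j) (sph_ne_zero θ)]
      have hmean : ∫ θ : Sph 1, (F θ - c) * dens h θ ∂(sig 1) = 0 := by
        simp only [sub_mul]
        rw [integral_sub i1 (i0.const_mul _), integral_const_mul, hc, div_mul_cancel₀ _ hM.ne',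
          sub_self]
      have hpl := H.planar hF' hmean
      have hgr := H.integral_gam_eq hF'.cd hF'.hom
      simp only [hgam, hlap] at hpl hgr
      have i2 := H.integrable_mul_dens (hcl.pow 2)
      have i3 := H.integrable_mul_dens ((hF'.cd.of_le zero_le).pow 2)
      have i4 := H.integrable_mul_dens (hcl.neg.mul (hF'.cd.of_le zero_le))
      -- From `-4 ΔF (F - c) ≤ (ΔF)² + 4 (F - c)²`; the planar inequality bounds the last term by `2
      -- E`.
      have h4 : 4 * E ≤ L + 4 * ∫ θ : Sph 1, (F θ - c) ^ 2 * dens h θ ∂(sig 1) := by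
        rw [hE, hgr, hL, ← integral_const_mul, ← integral_const_mul,
          ← integral_add i2 (i3.const_mul _)]
        refine integral_mono (i4.const_mul 4) (i2.add (i3.const_mul _)) fun θ => ?_
        have := mul_nonneg (sq_nonneg (lap h F θ + 2 * (F θ - c))) (H.dens_pos (sph_ne_zero θ)).le
        simp only
        nlinarith
      linarith
    norm_num at bochner
    linarith

end Adm

end

section


/-! ### Density of the range of the Laplacian: the method of continuity -/

open MeasureTheory Filter

variable {m : WithTop ℕ∞} {y : Euc d}

theorem pd_of_even {F : Euc d → ℝ} (hF : ∀ y, F (-y) = F y) (i : Fin (d + 1)) (y : Euc d) :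
    pd i F (-y) = -pd i F y := by
  have := pd_neg_arg F i y
  simp only [hF] at this
  linarith

theorem pd_pd_of_even {F : Euc d → ℝ} (hF : ∀ y, F (-y) = F y) (i j : Fin (d + 1)) (y : Euc d) :
    pd i (pd j F) (-y) = pd i (pd j F) y := by
  have h1 := pd_neg_arg (pd j F) i y
  have h2 : (fun z => pd j F (-z)) = fun z => -pd j F z := funext fun z => pd_of_even hF j z
  rw [h2, pd_neg] at h1
  linarith

theorem gm_neg {h : Euc d → ℝ} (he : ∀ y, h (-y) = h y) (y : Euc d) : gm h (-y) = gm h y := by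
  ext i j
  simp [gm, he, pd_of_even he, pd_pd_of_even he]

theorem dens_neg {h : Euc d → ℝ} (he : ∀ y, h (-y) = h y) (y : Euc d) :
    dens h (-y) = dens h y := by
  simp [dens, gd, he, gm_neg he]

theorem lap_neg {h F : Euc d → ℝ} (he : ∀ y, h (-y) = h y) (hF : ∀ y, F (-y) = F y) (y : Euc d) :
    lap h F (-y) = lap h F y := by
  simp [lap, gi, he, gm_neg he, pd_pd_of_even hF]

/-- Smooth even functions of degree zero. -/
def dzSub (d : ℕ) : Submodule ℝ (Euc d → ℝ) where
  carrier := {u | DZ ∞ u}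
  add_mem' := fun ha hb => ⟨ha.cd.add hb.cd, ha.hom.add hb.hom, fun y => by
    simp only [Pi.add_apply, ha.even, hb.even]⟩
  zero_mem' := DZ.const_mem 0
  smul_mem' := fun c u hu => ⟨(cd_const c).mul hu.cd, ((hom_const c).mul hu.hom).cast (by ring),
    fun y => by simp only [Pi.smul_apply, hu.even]⟩

/-- The Laplacian, multiplied by the density of the measure. -/
def opC {h : Euc d → ℝ} (H : Adm h) : dzSub d →ₗ[ℝ] C(Sph d, ℝ) where
  toFun u := ⟨fun θ => dens h θ * lap h u θ,
    ((H.cd_dens.of_le zero_le).mul (H.cd_lap (u.2.cd.of_le two_le_top))).continuous_sph⟩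
  map_add' u v := by
    ext θ
    have hu : CD ∞ (u : Euc d → ℝ) := u.2.cd
    have hv : CD ∞ (v : Euc d → ℝ) := v.2.cd
    have : ∀ i j, pd i (pd j fun y => (u : Euc d → ℝ) y + (v : Euc d → ℝ) y) θ =
        pd i (pd j u) θ + pd i (pd j v) θ := fun i j => by
      rw [pd_congr (fun z hz => pd_add hu hv one_le_top hz) (sph_ne_zero θ),
        pd_add (hu.pd top_add_one_le j) (hv.pd top_add_one_le j) one_le_top (sph_ne_zero θ)]
    change dens h θ * lap h (fun y => (u : Euc d → ℝ) y + (v : Euc d → ℝ) y) θ =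
      dens h θ * lap h u θ + dens h θ * lap h v θ
    simp only [lap, this, mul_add, Finset.sum_add_distrib]
  map_smul' c u := by
    ext θ
    have hu : CD ∞ (u : Euc d → ℝ) := u.2.cd
    have : ∀ i j, pd i (pd j fun y => c * (u : Euc d → ℝ) y) θ = c * pd i (pd j u) θ :=
      fun i j => by
      rw [pd_congr (fun z hz => pd_const_mul c hu one_le_top hz) (sph_ne_zero θ),
        pd_const_mul c (hu.pd top_add_one_le j) one_le_top (sph_ne_zero θ)]
    change dens h θ * lap h (fun y => c * (u : Euc d → ℝ) y) θ = c * (dens h θ * lap h u θ)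
    simp only [lap, this, Finset.mul_sum]
    exact Finset.sum_congr rfl fun i _ => Finset.sum_congr rfl fun j _ => by ring

/-- The embedding of the continuous functions on the sphere into `L²`. -/
def toL2 (d : ℕ) : C(Sph d, ℝ) →L[ℝ] Lp ℝ 2 (sig d) := ContinuousMap.toLp 2 (sig d) ℝ

theorem norm_toL2_sq (f : C(Sph d, ℝ)) : ‖toL2 d f‖ ^ 2 = ∫ θ, f θ ^ 2 ∂(sig d) := by
  rw [← real_inner_self_eq_norm_sq, toL2, ContinuousMap.inner_toLp]
  simp [pow_two]

/-- Even continuous functions with mean zero. -/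
def evenZero (d : ℕ) : Submodule ℝ C(Sph d, ℝ) where
  carrier := {f | (∀ θ, f (-θ) = f θ) ∧ ∫ θ, f θ ∂(sig d) = 0}
  add_mem' := fun {a b} ha hb => ⟨fun θ => by simp [ha.1, hb.1], by
    have := integral_add (integrable_sph a.continuous) (integrable_sph b.continuous)
    simp only [ContinuousMap.add_apply]
    rw [this, ha.2, hb.2, add_zero]⟩
  zero_mem' := ⟨fun θ => rfl, by simp⟩
  smul_mem' := fun c a ha => ⟨fun θ => by simp [ha.1], by
    simp only [ContinuousMap.smul_apply, integral_smul, ha.2, smul_zero]⟩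

theorem opC_mem {h : Euc d → ℝ} (H : Adm h) (u : dzSub d) : opC H u ∈ evenZero d := by
  refine ⟨fun θ => ?_, H.integral_lap_mul_dens (u.2.cd.of_le two_le_top) u.2.hom⟩
  change dens h (-θ) * lap h u (-θ) = dens h θ * lap h u θ
  rw [dens_neg H.even, lap_neg H.even u.2.even]

/-- The Laplacian has dense range in the even square integrable functions with mean zero. -/
def RangeDense {h : Euc d → ℝ} (H : Adm h) : Prop :=
  ∀ f ∈ evenZero d, toL2 d f ∈ closure (Set.range fun u => toL2 d (opC H u))

/-- Density of the range is stable under relatively bounded perturbations. -/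
theorem RangeDense.perturb {h k : Euc d → ℝ} {H : Adm h} {K : Adm k} (hH : RangeDense H)
    (hle : ∀ u, ‖toL2 d (opC K u) - toL2 d (opC H u)‖ ≤ 2⁻¹ * ‖toL2 d (opC H u)‖) :
    RangeDense K := by
  intro f hf
  -- A Neumann iteration on the residual, which remains even with mean zero. Approximation by the
  -- first operator costs `1/8` of its norm and the change of operator at most `1/2 * 9/8`, so each
  -- step contracts by `11/16 ≤ 3/4`.
  have key : ∀ j : ℕ, ∃ u, ‖toL2 d f - toL2 d (opC K u)‖ ≤ (3 / 4) ^ j * ‖toL2 d f‖ := by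
    intro j
    induction j with
    | zero => exact ⟨0, by simp⟩
    | succ j ih =>
      obtain ⟨u, hu⟩ := ih
      set g := f - opC K u with hg
      have hgm : g ∈ evenZero d := (evenZero d).sub_mem hf (opC_mem K u)
      have hgn : toL2 d g = toL2 d f - toL2 d (opC K u) := map_sub _ _ _
      by_cases h0 : ‖toL2 d g‖ = 0
      · refine ⟨u, ?_⟩
        rw [← hgn, h0]; positivity
      · have hpos : 0 < ‖toL2 d g‖ := lt_of_le_of_ne (norm_nonneg _) (Ne.symm h0)
        obtain ⟨_, ⟨v, rfl⟩, hv⟩ := Metric.mem_closure_iff.1 (hH g hgm) (8⁻¹ * ‖toL2 d g‖)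
          (by positivity)
        rw [dist_eq_norm] at hv
        refine ⟨u + v, ?_⟩
        have e1 : toL2 d f - toL2 d (opC K (u + v)) = (toL2 d g - toL2 d (opC H v)) -
            (toL2 d (opC K v) - toL2 d (opC H v)) := by
          rw [map_add, map_add, hgn]; abel
        have e2 : ‖toL2 d (opC H v)‖ ≤ ‖toL2 d g‖ + ‖toL2 d g - toL2 d (opC H v)‖ := by
          have := norm_sub_le (toL2 d g) (toL2 d g - toL2 d (opC H v))
          rwa [sub_sub_cancel] at this
        calc _ ≤ ‖toL2 d g - toL2 d (opC H v)‖ + ‖toL2 d (opC K v) - toL2 d (opC H v)‖ := by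
              rw [e1]; exact norm_sub_le _ _
          _ ≤ 3 / 4 * ‖toL2 d g‖ := by
              have := hle v
              linarith
          _ ≤ _ := by
              rw [pow_succ, hgn]
              nlinarith
  rw [Metric.mem_closure_iff]
  intro ε hε
  have hlim : Tendsto (fun j : ℕ => (3 / 4 : ℝ) ^ j * ‖toL2 d f‖) atTop (𝓝 0) := by
    simpa using (tendsto_pow_atTop_nhds_zero_of_lt_one (by norm_num : (0 : ℝ) ≤ 3 / 4)
      (by norm_num)).mul_const ‖toL2 d f‖
  obtain ⟨j, hj⟩ := (hlim.eventually (gt_mem_nhds hε)).exists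
  obtain ⟨u, hu⟩ := key j
  exact ⟨_, ⟨u, rfl⟩, by rw [dist_eq_norm]; exact hu.trans_lt hj⟩

/-! ### Deformation along segments of support functions -/

/-- The coefficients of the Laplacian, multiplied by the density. -/
def coef (h : Euc d → ℝ) (y : Euc d) : Matrix (Fin (d + 1)) (Fin (d + 1)) ℝ :=
  h y ^ (1 - d : ℤ) • (gm h y).adjugate

theorem Adm.coef_isSymm {h : Euc d → ℝ} (H : Adm h) (hy : y ≠ 0) : (coef h y).IsSymm := by
  have : (gm h y).IsSymm := by ext i j; exact H.gm_symm hy j i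
  rw [coef, Matrix.IsSymm, Matrix.transpose_smul, Matrix.adjugate_transpose, this.eq]

/-- Since `adj G = det G • G⁻¹`, these coefficients equal `dens * h² * G⁻¹`. Written with the
adjugate they involve no inverse matrix, which makes their continuity along segments plain. -/
theorem Adm.dens_mul_lap {h F : Euc d → ℝ} (H : Adm h) (hF : CD 2 F) (hy : y ≠ 0) :
    dens h y * lap h F y = (coef h y * hm F y).trace := by
  have h1 : (gm h y).adjugate = gd h y • gi h y := by
    ext i j
    have := (H.gd_pos hy).ne'
    rw [Matrix.smul_apply, gi_eq]; simp only [smul_eq_mul]; field_simp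
  have h2 : h y ^ (1 - d : ℤ) = h y ^ 2 * h y ^ (-((d : ℤ) + 1)) := by
    rw [← zpow_natCast, ← zpow_add₀ (H.ne hy)]; congr 1; push_cast; ring
  rw [coef, h1, h2]
  simp only [Matrix.trace, Matrix.diag, Matrix.mul_apply, Matrix.smul_apply, smul_eq_mul, hm,
    Matrix.of_apply, dens, lap, Finset.mul_sum]
  refine Finset.sum_congr rfl fun i _ => Finset.sum_congr rfl fun j _ => ?_
  rw [pd_comm hF le_rfl hy i j]; ring

/-- Segments between support functions. -/
def segm (h k : Euc d → ℝ) (t : ℝ) (y : Euc d) : ℝ := (1 - t) * h y + t * k y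

section Segment

variable {h k : Euc d → ℝ} (H : Adm h) (K : Adm k)
include H K

theorem pd_segm (t : ℝ) (hy : y ≠ 0) (i) :
    pd i (segm h k t) y = (1 - t) * pd i h y + t * pd i k y := by
  have : pd i (segm h k t) y = _ := pd_add ((cd_const (1 - t)).mul H.cd) ((cd_const t).mul K.cd)
    one_le_top hy
  rw [this, pd_const_mul _ H.cd one_le_top hy, pd_const_mul _ K.cd one_le_top hy]

theorem pd_pd_segm (t : ℝ) (hy : y ≠ 0) (i j) :
    pd i (pd j (segm h k t)) y = (1 - t) * pd i (pd j h) y + t * pd i (pd j k) y := by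
  rw [pd_congr (fun z hz => pd_segm H K t hz j) hy,
    pd_add ((cd_const (1 - t)).mul (H.cd_pd j)) ((cd_const t).mul (K.cd_pd j)) one_le_top hy,
    pd_const_mul _ (H.cd_pd j) one_le_top hy, pd_const_mul _ (K.cd_pd j) one_le_top hy]

theorem adm_segm (t : unitInterval) : Adm (segm h k t) where
  cd := ((cd_const _).mul H.cd).add ((cd_const _).mul K.cd)
  pos := fun y hy => by
    have h1 := H.pos y hy
    have h2 := K.pos y hy
    have ht := t.2.1
    have ht' := t.2.2
    simp only [segm]
    rcases ht.lt_or_eq with h3 | h3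
    · nlinarith [mul_nonneg (sub_nonneg.2 ht') h1.le, mul_pos h3 h2]
    · rw [← h3]; linarith
  hom := ((((hom_const _).mul H.hom).cast (by ring)).add
    (((hom_const _).mul K.hom).cast (by ring)))
  even := fun y => by simp only [segm, H.even, K.even]
  convex := fun y v hy hv hyv => by
    have h1 := H.convex y v hy hv hyv
    have h2 := K.convex y v hy hv hyv
    have ht := t.2.1
    have ht' := t.2.2
    have e : ∑ i, ∑ j, v i * v j * pd i (pd j (segm h k t)) y =
        (1 - t) * ∑ i, ∑ j, v i * v j * pd i (pd j h) y +
          t * ∑ i, ∑ j, v i * v j * pd i (pd j k) y := by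
      simp only [pd_pd_segm H K _ hy, Finset.mul_sum, ← Finset.sum_add_distrib]
      exact Finset.sum_congr rfl fun i _ => Finset.sum_congr rfl fun j _ => by ring
    rw [e]
    rcases ht.lt_or_eq with h3 | h3
    · nlinarith [mul_nonneg (sub_nonneg.2 ht') h1.le, mul_pos h3 h2]
    · rw [← h3]; linarith

theorem continuous_gm_segm :
    Continuous fun p : unitInterval × Sph d => gm (segm h k p.1) (p.2 : Euc d) := by
  have c1 : Continuous fun p : unitInterval × Sph d => ((p.1 : ℝ)) :=
    continuous_subtype_val.comp continuous_fst
  have lift : ∀ {F : Euc d → ℝ}, CD ∞ F → Continuous fun p : unitInterval × Sph d => F p.2 :=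
    fun hF => hF.continuous_sph.comp continuous_snd
  refine continuous_matrix fun i j => ?_
  simp only [gm, Matrix.of_apply, pd_segm H K _ (sph_ne_zero _), pd_pd_segm H K _ (sph_ne_zero _),
    segm]
  have a1 := lift H.cd
  have a2 := lift K.cd
  have a3 := fun i => lift (H.cd_pd i)
  have a4 := fun i => lift (K.cd_pd i)
  have a5 := fun i j => lift (H.cd_pd2 i j)
  have a6 := fun i j => lift (K.cd_pd2 i j)
  have c2 : Continuous fun p : unitInterval × Sph d => 1 - ((p.1 : ℝ)) := continuous_const.sub c1
  exact (((c2.mul a1).add (c1.mul a2)).mul ((c2.mul (a5 i j)).add (c1.mul (a6 i j)))).add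
    (((c2.mul (a3 i)).add (c1.mul (a4 i))).mul ((c2.mul (a3 j)).add (c1.mul (a4 j))))

theorem continuous_coef_segm :
    Continuous fun p : unitInterval × Sph d => coef (segm h k p.1) (p.2 : Euc d) := by
  have c1 : Continuous fun p : unitInterval × Sph d => ((p.1 : ℝ)) :=
    continuous_subtype_val.comp continuous_fst
  have c2 : Continuous fun p : unitInterval × Sph d => segm h k p.1 (p.2 : Euc d) :=
    ((continuous_const.sub c1).mul (H.cd.continuous_sph.comp continuous_snd)).add
      (c1.mul (K.cd.continuous_sph.comp continuous_snd))
  exact (c2.zpow₀ _ fun p => Or.inl ((adm_segm H K p.1).ne (sph_ne_zero p.2))).smul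
    (continuous_gm_segm H K).matrix_adjugate

/-- Pointwise, Cauchy-Schwarz bounds the difference of the two operators by the size of the
coefficient difference times the Hessian norm at `t`. The first factor is uniformly small for `s`
near `t` by compactness of the sphere; the second is controlled in `L²` by the operator itself, by
`Adm.integral_hs_le`. -/
theorem eventually_relatively_bounded (hd : 1 ≤ d) (t : unitInterval) :
    ∀ᶠ s in 𝓝 t, ∀ u, ‖toL2 d (opC (adm_segm H K s) u) - toL2 d (opC (adm_segm H K t) u)‖ ≤
      3⁻¹ * ‖toL2 d (opC (adm_segm H K t) u)‖ := by
  set T := adm_segm H K t with hT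
  set ht := segm h k t with hht
  have hdc : Continuous fun θ : Sph d => dens ht θ := T.cd_dens.continuous_sph
  obtain ⟨μ, hμ0, hμ⟩ : ∃ μ : ℝ, 0 < μ ∧ ∀ θ : Sph d, μ ≤ dens ht θ := by
    have hne : (Set.univ : Set (Sph d)).Nonempty := ⟨⟨EuclideanSpace.single 0 1, by simp⟩, trivial⟩
    obtain ⟨θ₀, -, h0⟩ := isCompact_univ.exists_isMinOn hne hdc.continuousOn
    exact ⟨dens ht θ₀, T.dens_pos (sph_ne_zero _), fun θ => h0 (Set.mem_univ θ)⟩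
  let D : unitInterval → Sph d → Matrix (Fin (d + 1)) (Fin (d + 1)) ℝ := fun s θ =>
    coef (segm h k s) θ - coef ht θ
  let Q : unitInterval → Sph d → ℝ := fun s θ =>
    (D s θ * gm ht θ * D s θ * gm ht θ).trace * (ht θ ^ 4 * dens ht θ)⁻¹
  have hne : ∀ θ : Sph d, 0 < ht θ ^ 4 * dens ht θ := fun θ =>
    mul_pos (pow_pos (T.pos _ (sph_ne_zero θ)) 4) (T.dens_pos (sph_ne_zero θ))
  have hQc : Continuous fun p : unitInterval × Sph d => Q p.1 p.2 := by
    have cD : Continuous fun p : unitInterval × Sph d => D p.1 p.2 := by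
      refine (continuous_coef_segm H K).sub ?_
      exact (continuous_coef_segm H K).comp (continuous_const (y := t) |>.prodMk continuous_snd)
    have cG : Continuous fun p : unitInterval × Sph d => gm ht (p.2 : Euc d) :=
      (continuous_gm_segm H K).comp (continuous_const (y := t) |>.prodMk continuous_snd)
    have cd' : Continuous fun θ : Sph d => ht θ ^ 4 * dens ht θ :=
      (T.cd.continuous_sph.pow 4).mul hdc
    exact (((cD.mul cG).mul cD).mul cG).matrix_trace.mul
      ((cd'.comp continuous_snd).inv₀ fun p => (hne p.2).ne')
  -- With the factor `2` of the a priori bound and the lower bound `μ` of the density, the threshold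
  -- `μ / 18` yields `1/9 = (1/3)²`.
  have hev : ∀ᶠ s in 𝓝 t, ∀ θ ∈ (Set.univ : Set (Sph d)), Q s θ < μ / 18 := by
    refine isCompact_univ.eventually_forall_of_forall_eventually fun θ _ => ?_
    have h0 : Q t θ = 0 := by simp [Q, D, hht]
    have : Tendsto (fun p : unitInterval × Sph d => Q p.1 p.2) (𝓝 (t, θ)) (𝓝 0) := by
      have := hQc.tendsto (t, θ)
      simpa only [h0] using this
    exact this.eventually (gt_mem_nhds (by positivity))
  filter_upwards [hev] with s hs u
  have S := adm_segm H K s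
  have hu2 : CD 2 (u : Euc d → ℝ) := u.2.cd.of_le two_le_top
  have hpt : ∀ θ : Sph d, (opC (adm_segm H K s) u θ - opC T u θ) ^ 2 ≤
      μ / 18 * (CentroAffine.hs ht u u θ * dens ht θ) := by
    intro θ
    have hy := sph_ne_zero θ
    have e1 : opC (adm_segm H K s) u θ - opC T u θ = (D s θ * hm u θ).trace := by
      change dens _ _ * lap _ _ _ - dens _ _ * lap _ _ _ = _
      rw [S.dens_mul_lap hu2 hy, T.dens_mul_lap hu2 hy, ← Matrix.trace_sub, ← sub_mul]
    have hGs : (gm ht θ).IsSymm := by ext i j; exact T.gm_symm hy j i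
    have hDs : (D s θ).IsSymm := (S.coef_isSymm hy).sub (T.coef_isSymm hy)
    have cs := sq_trace_mul_le (T.gi_posDef hy).posSemidef (T.gi_mul_gm hy) hGs
      (hm_isSymm hu2 hy) hDs
    have tr0 := trace_quad_nonneg (T.gi_posDef hy).posSemidef (hm_isSymm hu2 hy)
    have e2 : (D s θ * gm ht θ * D s θ * gm ht θ).trace ≤ μ / 18 * (ht θ ^ 4 * dens ht θ) := by
      have := hs θ trivial
      simp only [Q] at this
      rw [← div_eq_mul_inv, div_lt_iff₀ (hne θ)] at this
      exact this.le
    rw [e1]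
    refine cs.trans ((mul_le_mul_of_nonneg_right e2 tr0).trans_eq ?_)
    simp only [CentroAffine.hs]; ring
  have hsq : ‖toL2 d (opC (adm_segm H K s) u) - toL2 d (opC T u)‖ ^ 2 ≤
      (3⁻¹ * ‖toL2 d (opC T u)‖) ^ 2 := by
    rw [← map_sub, norm_toL2_sq, mul_pow, norm_toL2_sq]
    have i1 := T.integrable_mul_dens (T.cd_hs hu2 hu2)
    have i2 := T.integrable_mul_dens ((T.cd_lap hu2).pow 2)
    have i3 : Integrable (fun θ => opC T u θ ^ 2) (sig d) :=
      integrable_sph ((opC T u).continuous.pow 2)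
    calc _ ≤ ∫ θ : Sph d, μ / 18 * (CentroAffine.hs ht u u θ * dens ht θ) ∂(sig d) := by
          refine integral_mono (integrable_sph (((opC (adm_segm H K s) u) -
            opC T u).continuous.pow 2)) (i1.const_mul _) fun θ => ?_
          simpa using hpt θ
      _ ≤ μ / 18 * (2 * ∫ θ : Sph d, lap ht u θ ^ 2 * dens ht θ ∂(sig d)) := by
          rw [integral_const_mul]
          exact mul_le_mul_of_nonneg_left (T.integral_hs_le hd u.2) (by positivity)
      _ = 9⁻¹ * ∫ θ : Sph d, μ * (lap ht u θ ^ 2 * dens ht θ) ∂(sig d) := by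
          rw [integral_const_mul]; ring
      _ ≤ 9⁻¹ * ∫ θ : Sph d, opC T u θ ^ 2 ∂(sig d) := by
          refine mul_le_mul_of_nonneg_left ?_ (by norm_num)
          refine integral_mono (i2.const_mul _) i3 fun θ => ?_
          have e : opC T u θ = dens ht θ * lap ht u θ := rfl
          have hd0 := T.dens_pos (sph_ne_zero θ)
          simp only [e]
          calc μ * (lap ht u θ ^ 2 * dens ht θ) ≤ dens ht θ * (lap ht u θ ^ 2 * dens ht θ) :=
                mul_le_mul_of_nonneg_right (hμ θ) (by positivity)
            _ = _ := by ring
      _ = _ := by norm_num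
  exact (sq_le_sq₀ (norm_nonneg _) (by positivity)).1 hsq

/-- The density of the range does not depend on the support function. -/
theorem RangeDense.transfer (hd : 1 ≤ d) (hH : RangeDense H) : RangeDense K := by
  have main : RangeDense (adm_segm H K 0) → RangeDense (adm_segm H K 1) := by
    -- The unit interval is connected, so it is enough that density passes between nearby parameters
    -- in both directions.
    refine PreconnectedSpace.induction₂' (α := unitInterval)
      (fun s t => RangeDense (adm_segm H K s) → RangeDense (adm_segm H K t)) (fun t => ?_)
      ⟨fun a b c hab hbc ha => hbc (hab ha)⟩ 0 1
    filter_upwards [eventually_relatively_bounded H K hd t] with s hs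
    refine ⟨fun ht => ht.perturb fun u => (hs u).trans ?_, fun hs' => hs'.perturb fun u => ?_⟩
    · have := norm_nonneg (toL2 d (opC (adm_segm H K t) u))
      linarith
    · have h1 := hs u
      have h2 := norm_sub_norm_le (toL2 d (opC (adm_segm H K t) u))
        (toL2 d (opC (adm_segm H K s) u))
      rw [norm_sub_rev] at h1 ⊢
      rw [norm_sub_rev] at h2
      rw [norm_sub_rev] at h1
      have h3 := norm_sub_rev (toL2 d (opC (adm_segm H K t) u)) (toL2 d (opC (adm_segm H K s) u))
      linarith
  have e0 : segm h k (0 : unitInterval) = h := by ext y; simp [segm]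
  have e1 : segm h k (1 : unitInterval) = k := by ext y; simp [segm]
  have cast : ∀ {f g : Euc d → ℝ} (hfg : f = g) (A : Adm f) (B : Adm g),
      RangeDense A → RangeDense B := by
    rintro f _ rfl A B h; exact h
  exact cast e1 _ _ (main (cast e0.symm _ _ hH))

end Segment

end

section


/-! ### Density of the range for the Euclidean ball -/

open MeasureTheory Filter

variable {m : WithTop ℕ∞} {y : Euc d}

/-- The linear form with coefficients `a`. -/
def linForm (a y : Euc d) : ℝ := ∑ i, a i * y i

theorem cd_linForm (a : Euc d) : CD m (linForm a) :=
  CD.sum fun i _ => (cd_const (a i)).mul (cd_coord i)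

theorem hom_linForm (a : Euc d) : Hom 1 (linForm a) :=
  Hom.sum fun i _ => ((hom_const (a i)).mul (hom_coord i)).cast (by ring)

theorem pd_linForm (a : Euc d) (hy : y ≠ 0) (i) : pd i (linForm a) y = a i := by
  have : pd i (linForm a) y = _ :=
    pd_sum (m := 1) (fun j _ => (cd_const (a j)).mul (cd_coord j)) le_rfl hy
  rw [this]
  simp only [pd_const_mul (m := 1) _ (cd_coord _) le_rfl hy, pd_coord]
  simp

theorem linForm_eq_inner (a y : Euc d) : linForm a y = ⟪y, a⟫ := by
  simp [linForm, PiLp.inner_apply]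

theorem hom_norm_zpow (e : ℤ) : Hom (d := d) e fun y => ‖y‖ ^ e := (hom_norm.zpow e).cast (by ring)

theorem cd_norm_zpow (e : ℤ) : CD (d := d) m fun y => ‖y‖ ^ e :=
  cd_norm.zpow (fun _ hy => norm_ne_zero_iff.2 hy) e

theorem pd_norm_zpow (hy : y ≠ 0) (i) (e : ℤ) :
    pd i (fun y : Euc d => ‖y‖ ^ e) y = e * (y i * ‖y‖ ^ (e - 2)) := by
  have h0 := norm_ne_zero_iff.2 hy
  rw [pd_zpow (m := 1) cd_norm le_rfl hy h0, pd_norm hy, show e - 2 = e - 1 - 1 by ring,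
    zpow_sub_one₀ h0 (e - 1)]
  ring

theorem pd_pd_norm (hy : y ≠ 0) (i j) : pd i (pd j fun y : Euc d => ‖y‖) y =
    (if i = j then 1 else 0) * ‖y‖⁻¹ - y i * y j * ‖y‖ ^ (-3 : ℤ) := by
  have e : ∀ z : Euc d, z ≠ 0 → pd j (fun y : Euc d => ‖y‖) z = z j * ‖z‖ ^ (-1 : ℤ) := by
    intro z hz; rw [pd_norm hz, zpow_neg_one]
  rw [pd_congr e hy, pd_mul (m := 1) (cd_coord j) (cd_norm_zpow _) le_rfl hy, pd_coord,
    pd_norm_zpow hy, zpow_neg_one]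
  push_cast
  ring_nf

theorem gm_norm (hy : y ≠ 0) : gm (fun y : Euc d => ‖y‖) y = 1 := by
  ext i j
  have h0 := norm_ne_zero_iff.2 hy
  rw [gm, Matrix.of_apply, pd_pd_norm hy, pd_norm hy, pd_norm hy, Matrix.one_apply, mul_sub,
    show (-3 : ℤ) = -((3 : ℕ) : ℤ) by norm_num, zpow_neg, zpow_natCast]
  field_simp
  ring

theorem adm_norm : Adm (d := d) fun y => ‖y‖ where
  cd := cd_norm
  pos := fun _ hy => norm_pos_iff.2 hy
  hom := hom_norm
  even := fun _ => norm_neg _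
  convex := fun y v hy hv hyv => by
    have h0 := norm_pos_iff.2 hy
    have e : ∑ i, ∑ j, v i * v j * pd i (pd j fun y : Euc d => ‖y‖) y =
        ‖v‖ ^ 2 * ‖y‖⁻¹ - (∑ i, v i * y i) * (∑ j, v j * y j) * ‖y‖ ^ (-3 : ℤ) := by
      have : ∀ i, ∑ j, v i * v j * pd i (pd j fun y : Euc d => ‖y‖) y =
          v i * v i * ‖y‖⁻¹ - v i * y i * (∑ j, v j * y j) * ‖y‖ ^ (-3 : ℤ) := by
        intro i
        simp only [pd_pd_norm hy, mul_sub, Finset.sum_sub_distrib, Finset.mul_sum, Finset.sum_mul]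
        congr 1
        · rw [Finset.sum_eq_single i (fun j _ hj => by simp [Ne.symm hj]) (by simp)]
          simp
        · exact Finset.sum_congr rfl fun j _ => by ring
      simp only [this, Finset.sum_sub_distrib, norm_sq_eq_sum, Finset.sum_mul]
    have h1 : ∑ i, v i * y i = 0 := (linForm_eq_inner v y).trans hyv
    rw [e, h1]
    have := norm_pos_iff.2 hv
    simp only [zero_mul, sub_zero]
    positivity

theorem lap_norm (F : Euc d → ℝ) (θ : Sph d) :
    lap (fun y : Euc d => ‖y‖) F θ = ∑ i, pd i (pd i F) θ := by
  rw [lap, gi, gm_norm (sph_ne_zero θ), inv_one, sph_norm]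
  simp [Matrix.one_apply]

theorem dens_norm (θ : Sph d) : dens (fun y : Euc d => ‖y‖) θ = 1 := by
  rw [dens, gd, gm_norm (sph_ne_zero θ), sph_norm]; simp

/-- Even powers of linear forms, made homogeneous of degree zero. -/
def zonal (a : Euc d) (k : ℕ) (y : Euc d) : ℝ := linForm a y ^ (2 * k) * ‖y‖ ^ (-(2 * k : ℤ))

theorem dz_zonal (a : Euc d) (k : ℕ) : DZ m (zonal a k) where
  cd := ((cd_linForm a).pow _).mul (cd_norm_zpow _)
  hom := by
    refine Hom.cast (Hom.mul (r := 2 * k) ?_ (hom_norm_zpow _)) (by ring)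
    intro c hc y hy
    beta_reduce
    rw [hom_linForm a c hc y hy, mul_pow, zpow_one, ← zpow_natCast c]; push_cast; rfl
  even := fun y => by
    have : linForm a (-y) = -linForm a y := by simp [linForm]
    rw [zonal, zonal, this, norm_neg, (even_two_mul k).neg_pow]

theorem pd_pow_mul_norm (a : Euc d) (k : ℕ) (e : ℤ) (hy : y ≠ 0) (i) :
    pd i (fun y => linForm a y ^ k * ‖y‖ ^ e) y =
      k * a i * (linForm a y ^ (k - 1) * ‖y‖ ^ e) +
        e * (y i * (linForm a y ^ k * ‖y‖ ^ (e - 2))) := by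
  rw [pd_mul (m := 1) ((cd_linForm a).pow _) (cd_norm_zpow _) le_rfl hy,
    pd_pow (m := 1) (cd_linForm a) le_rfl hy, pd_norm_zpow hy, pd_linForm a hy]
  ring

/-- For the extension of degree zero, the flat Laplacian at a point of the sphere is the spherical
one. The formula is triangular in the even powers of the linear form, and the coefficient of the top
power is never zero. -/
theorem laplacian_zonal (a : Euc d) (k : ℕ) (θ : Sph d) :
    ∑ i, pd i (pd i (zonal a (k + 1))) θ = (2 * k + 2) * (2 * k + 1) * ‖a‖ ^ 2 * linForm a θ ^ (2 * k)
      - (2 * k + 2) * (2 * k + 1 + d) * linForm a θ ^ (2 * (k + 1)) := by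
  have hy := sph_ne_zero θ
  set e : ℤ := -(2 * (k + 1 : ℕ)) with he
  have c : ∀ (j : ℕ) (e : ℤ), CD (d := d) 1 fun y => linForm a y ^ j * ‖y‖ ^ e :=
    fun j e => ((cd_linForm a).pow _).mul (cd_norm_zpow _)
  have h : ∀ i, pd i (pd i (zonal a (k + 1))) θ =
      (2 * k + 2) * (2 * k + 1) * linForm a θ ^ (2 * k) * (a i * a i)
      - 2 * (2 * k + 2) ^ 2 * linForm a θ ^ (2 * k + 1) * (a i * (θ : Euc d) i)
      - (2 * k + 2) * linForm a θ ^ (2 * k + 2)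
      + (2 * k + 2) * (2 * k + 4) * linForm a θ ^ (2 * k + 2) * (((θ : Euc d) i) ^ 2) := by
    intro i
    have h1 := pd_pow_mul_norm (y := (θ : Euc d)) a
    rw [pd_congr (F := pd i (zonal a (k + 1))) (fun z hz => pd_pow_mul_norm a _ _ hz i) hy,
      pd_add (m := 1) ((cd_const _).mul (c _ _)) ((cd_const _).mul ((cd_coord i).mul (c _ _)))
        le_rfl hy, pd_const_mul (m := 1) _ (c _ _) le_rfl hy,
      pd_const_mul (m := 1) _ ((cd_coord i).mul (c _ _)) le_rfl hy,
      pd_mul (m := 1) (cd_coord i) (c _ _) le_rfl hy, pd_coord, h1 _ _ hy, h1 _ _ hy]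
    simp only [sph_norm, one_zpow, mul_one, if_true]
    rw [show 2 * (k + 1) - 1 - 1 = 2 * k by omega, show 2 * (k + 1) - 1 = 2 * k + 1 by omega,
      show 2 * (k + 1) = 2 * k + 2 by ring]
    push_cast
    ring
  simp only [h, Finset.sum_add_distrib, Finset.sum_sub_distrib, ← Finset.mul_sum]
  have e1 : ∑ i, a i * a i = ‖a‖ ^ 2 := (norm_sq_eq_sum a).symm
  have e2 : ∑ i, a i * (θ : Euc d) i = linForm a θ := rfl
  have e3 : ∑ i, (θ : Euc d) i ^ 2 = 1 := by
    simpa [pow_two] using sph_sum_sq θ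
  rw [e1, e2, e3]
  simp only [Finset.sum_const, Finset.card_univ, Fintype.card_fin, nsmul_eq_mul]
  push_cast
  ring

/-- The closure of the sums of constants and functions in the range of the Laplacian of the
ball. -/
def ballRange (d : ℕ) : Submodule ℝ C(Sph d, ℝ) :=
  (LinearMap.range (opC (adm_norm (d := d))) ⊔ ℝ ∙ (1 : C(Sph d, ℝ))).topologicalClosure

/-- A linear form as a continuous function on the sphere. -/
def linC (a : Euc d) : C(Sph d, ℝ) := ⟨fun θ => linForm a θ, (cd_linForm (m := 0) a).continuous_sph⟩

/-- By induction: `laplacian_zonal` expresses the next even power through the previous one and an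
element of the range. The constants start the induction. -/
theorem linC_pow_even_mem (a : Euc d) (k : ℕ) : linC a ^ (2 * k) ∈ ballRange d := by
  induction k with
  | zero =>
    exact Submodule.le_topologicalClosure _ (Submodule.mem_sup_right (by
      simp [Submodule.mem_span_singleton_self]))
  | succ k ih =>
    let u : dzSub d := ⟨zonal a (k + 1), dz_zonal a (k + 1)⟩
    have hu : opC adm_norm u ∈ ballRange d :=
      Submodule.le_topologicalClosure _ (Submodule.mem_sup_left ⟨u, rfl⟩)
    have hc : ((2 * k + 2) * (2 * k + 1 + d) : ℝ) ≠ 0 := by positivity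
    have e : linC a ^ (2 * (k + 1)) = ((2 * k + 2) * (2 * k + 1 + d) : ℝ)⁻¹ •
        (((2 * k + 2) * (2 * k + 1) * ‖a‖ ^ 2) • linC a ^ (2 * k) - opC adm_norm u) := by
      rw [eq_inv_smul_iff₀ hc]
      ext θ
      have h1 : opC adm_norm u θ = dens (fun y : Euc d => ‖y‖) θ *
        lap (fun y : Euc d => ‖y‖) (zonal a (k + 1)) θ := rfl
      simp only [ContinuousMap.smul_apply, ContinuousMap.sub_apply, h1, dens_norm, lap_norm,
        laplacian_zonal, ContinuousMap.pow_apply, linC, ContinuousMap.coe_mk, smul_eq_mul]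
      ring
    rw [e]
    exact (ballRange d).smul_mem _ ((ballRange d).sub_mem ((ballRange d).smul_mem _ ih) hu)

/-- Composition with the antipodal map. -/
def antipode (d : ℕ) : C(Sph d, ℝ) →ₐ[ℝ] C(Sph d, ℝ) :=
  ContinuousMap.compRightAlgHom ℝ ℝ ⟨fun θ => -θ, continuous_neg⟩

theorem continuous_antipode : Continuous (antipode d) :=
  ContinuousMap.compRightAlgHom_continuous ℝ ℝ _

theorem antipode_linC (a : Euc d) : antipode d (linC a) = -linC a := by
  ext θ
  simp [antipode, linC, linForm]

/-- The functions whose even part lies in `ballRange`. -/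
def evenPartBall (d : ℕ) : Submodule ℝ C(Sph d, ℝ) :=
  (ballRange d).comap (LinearMap.id + (antipode d).toLinearMap)

theorem isClosed_evenPartBall : IsClosed (evenPartBall d : Set C(Sph d, ℝ)) :=
  (Submodule.isClosed_topologicalClosure _).preimage (continuous_id.add continuous_antipode)

theorem linC_pow_mem (a : Euc d) (k : ℕ) : linC a ^ k ∈ evenPartBall d := by
  change linC a ^ k + antipode d (linC a ^ k) ∈ ballRange d
  rw [map_pow, antipode_linC]
  rcases Nat.even_or_odd k with hk | hk
  · rw [hk.neg_pow]
    obtain ⟨j, rfl⟩ := hk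
    rw [← two_mul j]
    exact (ballRange d).add_mem (linC_pow_even_mem a j) (linC_pow_even_mem a j)
  · rw [hk.neg_pow, add_neg_cancel]
    exact (ballRange d).zero_mem

theorem exp_linC_mem (a : Euc d) : NormedSpace.exp (linC a) ∈ evenPartBall d := by
  have := NormedSpace.exp_series_hasSum_exp' (𝕂 := ℝ) (linC a)
  refine isClosed_evenPartBall.mem_of_tendsto this (Eventually.of_forall fun s => ?_)
  exact Submodule.sum_mem _ fun k _ => Submodule.smul_mem _ _ (linC_pow_mem a k)

/-- The exponentials of linear forms. -/
def expHom (d : ℕ) : Multiplicative (Euc d) →* C(Sph d, ℝ) where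
  toFun a := NormedSpace.exp (linC a.toAdd)
  map_one' := by
    have : linC (0 : Euc d) = 0 := by ext θ; simp [linC, linForm]
    simp [this]
  map_mul' a b := by
    have : linC (a.toAdd + b.toAdd) = linC a.toAdd + linC b.toAdd := by
      ext θ; simp [linC, linForm, add_mul, Finset.sum_add_distrib]
    rw [toAdd_mul, this, NormedSpace.exp_add]

/-- A product of powers of different linear forms need not be such a power, whereas exponentials of
linear forms are closed under multiplication. Their span is thus a subalgebra; it separates points,
and Stone-Weierstrass applies. -/
theorem evenPartBall_eq_top : evenPartBall d = ⊤ := by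
  let A : Subalgebra ℝ C(Sph d, ℝ) := Algebra.adjoin ℝ (MonoidHom.mrange (expHom d))
  have hA : Subalgebra.toSubmodule A ≤ evenPartBall d := by
    rw [Algebra.adjoin_eq_span, Submonoid.closure_eq, Submodule.span_le]
    rintro _ ⟨a, rfl⟩
    exact exp_linC_mem _
  have hsep : A.SeparatesPoints := by
    intro θ θ' hne
    obtain ⟨i, hi⟩ : ∃ i, (θ : Euc d) i ≠ (θ' : Euc d) i := by
      by_contra! hcon
      exact hne (Subtype.ext (by ext i; exact hcon i))
    refine ⟨_, ⟨expHom d (.ofAdd (EuclideanSpace.single i 1)),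
      Algebra.subset_adjoin ⟨_, rfl⟩, rfl⟩, ?_⟩
    have ev : ∀ θ : Sph d, (expHom d (.ofAdd (EuclideanSpace.single i 1))) θ =
        Real.exp ((θ : Euc d) i) := fun θ => by
      have h1 := NormedSpace.map_exp (ContinuousMap.evalAlgHom ℝ ℝ θ)
        (continuous_eval_const θ) (linC (EuclideanSpace.single i 1))
      rw [← Real.exp_eq_exp_ℝ] at h1
      refine h1.trans (congrArg Real.exp ?_)
      simp [linC, linForm]
    simpa [ev] using hi
  have htop := ContinuousMap.subalgebra_topologicalClosure_eq_top_of_separatesPoints A hsep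
  refine eq_top_iff.2 fun f _ => ?_
  have hf : f ∈ A.topologicalClosure := by rw [htop]; trivial
  exact closure_minimal hA isClosed_evenPartBall hf

/-- Even continuous functions are uniform limits of Laplacians plus constants. The map `Φ` removes
the `L²` projection to the constants: it leaves mean-zero functions alone and discards the unwanted
constant from each approximant. -/
theorem rangeDense_norm : RangeDense (adm_norm (d := d)) := by
  intro f hf
  have hfb : f ∈ ballRange d := by
    have h1 : f ∈ evenPartBall d := by rw [evenPartBall_eq_top]; trivial
    have h2 : f + antipode d f ∈ ballRange d := h1
    have h3 : antipode d f = f := by ext θ; exact hf.1 θ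
    rw [h3, ← two_smul ℝ f] at h2
    have := (ballRange d).smul_mem (2⁻¹ : ℝ) h2
    simpa [smul_smul] using this
  let e : Lp ℝ 2 (sig d) := toL2 d 1
  let c : ℝ := (⟪e, e⟫)⁻¹
  let Φ : C(Sph d, ℝ) → Lp ℝ 2 (sig d) := fun g => toL2 d g - (c * ⟪e, toL2 d g⟫) • e
  have hΦ : Continuous Φ := by
    have := (toL2 d).continuous
    fun_prop
  have hin : ∀ g : C(Sph d, ℝ), ⟪e, toL2 d g⟫ = ∫ θ, g θ ∂(sig d) := fun g => by
    simp only [e, toL2]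
    rw [ContinuousMap.inner_toLp]
    simp
  have hfix : ∀ g ∈ evenZero d, Φ g = toL2 d g := fun g hg => by
    simp [Φ, hin, hg.2]
  have he : ⟪e, e⟫ ≠ 0 := by
    have := (adm_norm (d := d)).integral_dens_pos
    simp only [dens_norm] at this
    rw [hin]
    exact this.ne'
  rw [← hfix f hf]
  refine closure_mono ?_ (image_closure_subset_closure_image hΦ ⟨f, hfb, rfl⟩)
  rintro _ ⟨g, hg, rfl⟩
  obtain ⟨_, ⟨u, rfl⟩, _, hk, rfl⟩ := Submodule.mem_sup.1 hg
  obtain ⟨b, rfl⟩ := Submodule.mem_span_singleton.1 hk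
  refine ⟨u, ?_⟩
  have h1 := (hin (opC adm_norm u)).trans (opC_mem adm_norm u).2
  simp only [Φ, map_add, map_smul, inner_add_right, inner_smul_right, h1]
  change _ = _ + b • e - (c * (0 + b * ⟪e, e⟫)) • e
  rw [zero_add, show c * (b * ⟪e, e⟫) = b by simp only [c]; field_simp]
  abel

/-- The Laplacian has dense range. -/
theorem rangeDense {h : Euc d → ℝ} (H : Adm h) (hd : 1 ≤ d) : RangeDense H :=
  RangeDense.transfer adm_norm H hd rangeDense_norm

end

section


/-! ### The support function of a smooth even body -/

open Filter

/-- The vector representing a linear form. -/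
def repr : (Euc d →L[ℝ] ℝ) →L[ℝ] Euc d :=
  ∑ i, (ContinuousLinearMap.apply ℝ ℝ (EuclideanSpace.single i (1 : ℝ))).smulRight
    (EuclideanSpace.single i (1 : ℝ))

theorem inner_repr (L : Euc d →L[ℝ] ℝ) (v : Euc d) : ⟪repr L, v⟫ = L v := by
  conv_rhs => rw [euc_eq_sum v]
  simp only [repr, sum_apply, sum_inner, map_sum, map_smul,
    ContinuousLinearMap.smulRight_apply, ContinuousLinearMap.apply_apply, inner_smul_left]
  refine Finset.sum_congr rfl fun i _ => ?_
  rw [EuclideanSpace.inner_single_left]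
  simp [mul_comm]

theorem supportFn_isGreatest {K : Set (Euc d)} (hK : IsCompact K) (h0 : K.Nonempty) (y : Euc d) :
    IsGreatest ((fun x : Euc d => ⟪y, x⟫) '' K) (supportFn K y) :=
  (hK.image (by fun_prop)).isGreatest_sSup (h0.image _)

theorem supportFn_eq {K : Set (Euc d)} {x y : Euc d} (hx : x ∈ K) (hm : ∀ z ∈ K, ⟪y, z⟫ ≤ ⟪y, x⟫) :
    supportFn K y = ⟪y, x⟫ :=
  IsGreatest.csSup_eq ⟨⟨x, hx, rfl⟩, by rintro _ ⟨z, hz, rfl⟩; exact hm z hz⟩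

/-- A linear form that is nonpositive on an open half space of another one is a nonnegative
multiple of it. -/
theorem eq_smul_of_halfspace {g y : Euc d} (hg : g ≠ 0) (h : ∀ v, ⟪g, v⟫ < 0 → ⟪y, v⟫ ≤ 0) :
    ∃ c : ℝ, 0 ≤ c ∧ y = c • g := by
  have hg2 : 0 < ⟪g, g⟫ := real_inner_self_pos.2 hg
  -- The closed half space is reached by pushing `v` slightly against `g` and letting the push tend
  -- to zero.
  have h' : ∀ v, ⟪g, v⟫ ≤ 0 → ⟪y, v⟫ ≤ 0 := by
    intro v hv
    have key : ∀ ε : ℝ, 0 < ε → ⟪y, v⟫ - ε * ⟪y, g⟫ ≤ 0 := fun ε hε => by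
      have := h (v - ε • g) (by
        rw [inner_sub_right, inner_smul_right]; nlinarith [mul_pos hε hg2])
      rwa [inner_sub_right, inner_smul_right] at this
    have lim : Tendsto (fun ε : ℝ => ⟪y, v⟫ - ε * ⟪y, g⟫) (𝓝[>] 0) (𝓝 (⟪y, v⟫ - 0 * ⟪y, g⟫)) :=
      (Continuous.tendsto (by fun_prop) 0).mono_left nhdsWithin_le_nhds
    have := le_of_tendsto lim (eventually_nhdsWithin_of_forall fun ε hε => key ε hε)
    linarith
  set c := ⟪g, y⟫ / ⟪g, g⟫ with hc
  have hv0 : ⟪g, y - c • g⟫ = 0 := by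
    rw [inner_sub_right, inner_smul_right, hc]; field_simp; ring
  have hv1 : ⟪y, y - c • g⟫ = 0 := by
    refine le_antisymm (h' _ hv0.le) ?_
    have := h' (-(y - c • g)) (by rw [inner_neg_right, hv0, neg_zero])
    rw [inner_neg_right] at this
    linarith
  refine ⟨c, ?_, ?_⟩
  · have := h (-g) (by rw [inner_neg_right]; linarith)
    rw [inner_neg_right, real_inner_comm] at this
    exact div_nonneg (by linarith) hg2.le
  · have : ⟪y - c • g, y - c • g⟫ = 0 := by
      rw [inner_sub_left, hv1, inner_smul_left, hv0]; simp
    exact sub_eq_zero.1 (inner_self_eq_zero.1 this)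

section Local

variable {K U : Set (Euc d)} {φ : Euc d → ℝ} {x y : Euc d}

theorem hasDerivAt_line {v : Euc d} (hφ : DifferentiableAt ℝ φ x) :
    HasDerivAt (fun t : ℝ => φ (x + t • v)) (fderiv ℝ φ x v) 0 := by
  have h1 : HasDerivAt (fun t : ℝ => x + t • v) v 0 := by
    simpa using ((hasDerivAt_id (0 : ℝ)).smul_const v).const_add x
  have h2 : HasFDerivAt φ (fderiv ℝ φ x) (x + (0 : ℝ) • v) := by simpa using hφ.hasFDerivAt
  exact h2.comp_hasDerivAt 0 h1

theorem tendsto_line (x v : Euc d) : Tendsto (fun t : ℝ => x + t • v) (𝓝[>] 0) (𝓝 x) := by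
  have : Tendsto (fun t : ℝ => x + t • v) (𝓝 0) (𝓝 (x + (0 : ℝ) • v)) :=
    Continuous.tendsto (by fun_prop) 0
  simpa using this.mono_left nhdsWithin_le_nhds

/-- The Lagrange multiplier rule for a linear form on a sublevel set. -/
theorem lagrange (hU : U ∈ 𝓝 x) (hφ : DifferentiableAt ℝ φ x)
    (hKU : ∀ z ∈ U, z ∈ K ↔ φ z ≤ 0) (hx0 : φ x = 0) (hg : fderiv ℝ φ x ≠ 0)
    (hm : ∀ z ∈ K, ⟪y, z⟫ ≤ ⟪y, x⟫) : ∃ c : ℝ, 0 ≤ c ∧ y = c • repr (fderiv ℝ φ x) := by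
  refine eq_smul_of_halfspace (fun h => hg ?_) fun v hv => ?_
  · ext v; rw [← inner_repr, h, inner_zero_left]; rfl
  rw [inner_repr] at hv
  -- A direction in which `φ` decreases leads into `K`, so the linear form cannot increase along it.
  have h1 : ∀ᶠ t in 𝓝[>] (0 : ℝ), φ (x + t • v) < 0 := by
    have hd := (hasDerivAt_line (v := v) hφ).hasDerivWithinAt (s := Set.Ioi 0)
    rw [hasDerivWithinAt_iff_tendsto_slope' (by simp)] at hd
    filter_upwards [hd.eventually (gt_mem_nhds hv), self_mem_nhdsWithin] with t ht ht0
    rw [slope_def_field] at ht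
    simp only [zero_smul, add_zero, hx0, sub_zero] at ht
    have := (div_lt_iff₀ (Set.mem_Ioi.1 ht0)).1 ht
    simpa using this
  obtain ⟨t, ht1, ht2, ht3⟩ :=
    (h1.and (((tendsto_line x v).eventually hU).and self_mem_nhdsWithin)).exists
  have := hm _ ((hKU _ ht2).2 ht1.le)
  rw [inner_add_right, inner_smul_right] at this
  have ht3 : (0 : ℝ) < t := ht3
  by_contra! hcon
  nlinarith [mul_pos ht3 hcon]

/-- A boundary point whose outer normal is `y` maximizes the linear form given by `y`. -/
theorem le_of_normal (hK : Convex ℝ K) (hU : U ∈ 𝓝 x) (hφ : DifferentiableAt ℝ φ x)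
    (hKU : ∀ z ∈ U, z ∈ K ↔ φ z ≤ 0) (hx0 : φ x = 0) {c : ℝ} (hc : 0 ≤ c)
    (hy : y = c • repr (fderiv ℝ φ x)) {z : Euc d} (hz : z ∈ K) : ⟪y, z⟫ ≤ ⟪y, x⟫ := by
  have hxK : x ∈ K := (hKU x (mem_of_mem_nhds hU)).2 hx0.le
  have h1 : fderiv ℝ φ x (z - x) ≤ 0 := by
    have hd := (hasDerivAt_line (v := z - x) hφ).hasDerivWithinAt (s := Set.Ioi 0)
    rw [hasDerivWithinAt_iff_tendsto_slope' (by simp)] at hd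
    refine le_of_tendsto hd ?_
    filter_upwards [(tendsto_line x (z - x)).eventually hU, Ioo_mem_nhdsGT (zero_lt_one' ℝ)]
      with t ht ht0
    have := (hKU _ ht).1 (hK.add_smul_sub_mem hxK hz ⟨ht0.1.le, ht0.2.le⟩)
    rw [slope_def_field]
    simp only [zero_smul, add_zero, hx0, sub_zero]
    exact div_nonpos_of_nonpos_of_nonneg this ht0.1.le
  have : ⟪y, z - x⟫ ≤ 0 := by
    rw [hy, inner_smul_left, inner_repr]
    exact mul_nonpos_of_nonneg_of_nonpos hc h1
  rw [inner_sub_right] at this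
  linarith

end Local

/-! ### Smoothness of the support function -/

/-- The Gauss map of a smooth even body is locally invertible. -/
theorem IsSmoothEvenBody.exists_local_position {K : Set (Euc d)} (hK : IsSmoothEvenBody K)
    {y₀ : Euc d} (hy₀ : y₀ ≠ 0) :
    ∃ X : Euc d → Euc d, ContDiffAt ℝ ∞ X y₀ ∧
      (∀ᶠ y in 𝓝 y₀, X y ∈ K ∧ ∀ z ∈ K, ⟪y, z⟫ ≤ ⟪y, X y⟫) ∧
      ∀ v, v ≠ 0 → ⟪y₀, v⟫ = 0 → 0 < ⟪fderiv ℝ X y₀ v, v⟫ := by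
  have hne : K.Nonempty := ⟨0, interior_subset hK.zero_mem_interior⟩
  obtain ⟨⟨x₀, hx₀, hx₀'⟩, hub⟩ := supportFn_isGreatest hK.isCompact hne y₀
  have hmax : ∀ z ∈ K, ⟪y₀, z⟫ ≤ ⟪y₀, x₀⟫ := fun z hz => by
    have := hub ⟨z, hz, rfl⟩
    rwa [← hx₀'] at this
  have hint : x₀ ∉ interior K := by
    intro hi
    have h1 := (tendsto_line x₀ y₀).eventually (mem_interior_iff_mem_nhds.1 hi)
    obtain ⟨t, ht, ht0⟩ := (h1.and self_mem_nhdsWithin).exists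
    have := hmax _ ht
    rw [inner_add_right, inner_smul_right] at this
    nlinarith [mul_pos (Set.mem_Ioi.1 ht0) (real_inner_self_pos.2 hy₀)]
  obtain ⟨U, φ, hU, hxU, hφ, hKU, hg, hconv⟩ := hK.boundary x₀ ⟨subset_closure hx₀, hint⟩
  have hdiff : ∀ x ∈ U, DifferentiableAt ℝ φ x := fun x hx =>
    (hφ.contDiffAt (hU.mem_nhds hx)).differentiableAt (by simp)
  have hφx : φ x₀ = 0 := by
    refine le_antisymm ((hKU _ hxU).1 hx₀) (not_lt.1 fun hlt => hint ?_)
    rw [mem_interior_iff_mem_nhds]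
    filter_upwards [hU.mem_nhds hxU, (hdiff _ hxU).continuousAt.eventually (gt_mem_nhds hlt)]
      with z hz hz'
    exact (hKU z hz).2 hz'.le
  obtain ⟨c₀, hc₀, hyc⟩ := lagrange (hU.mem_nhds hxU) (hdiff _ hxU) hKU hφx hg hmax
  have hc₀' : 0 < c₀ := lt_of_le_of_ne hc₀ fun h => hy₀ (by rw [hyc, ← h, zero_smul])
  -- A boundary point `x` with outer normal `y` and multiplier `c` solves `F (x, c) = (y, 0)`. The
  -- inverse function theorem solves this smoothly in `y`, and by convexity (`le_of_normal`) the
  -- solution found is a true maximizer.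
  let F : Euc d × ℝ → Euc d × ℝ := fun q => (q.2 • repr (fderiv ℝ φ q.1), φ q.1)
  have hφ1 : ContDiffAt ℝ ∞ φ x₀ := hφ.contDiffAt (hU.mem_nhds hxU)
  have hφ2 : ContDiffAt ℝ ∞ (fderiv ℝ φ) x₀ := hφ1.fderiv_right (m := ∞) le_rfl
  have hF : ContDiffAt ℝ ∞ F (x₀, c₀) :=
    (contDiffAt_snd.smul (repr.contDiff.contDiffAt.comp (x₀, c₀)
      (hφ2.comp (x₀, c₀) contDiffAt_fst))).prodMk (hφ1.comp (x₀, c₀) contDiffAt_fst)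
  let A := fderiv ℝ (fderiv ℝ φ) x₀
  let F' : Euc d × ℝ →L[ℝ] Euc d × ℝ :=
    (c₀ • (repr.comp (A.comp (ContinuousLinearMap.fst ℝ (Euc d) ℝ))) +
      (ContinuousLinearMap.snd ℝ (Euc d) ℝ).smulRight (repr (fderiv ℝ φ x₀))).prod
      ((fderiv ℝ φ x₀).comp (ContinuousLinearMap.fst ℝ (Euc d) ℝ))
  have hF' : HasFDerivAt F F' (x₀, c₀) := by
    have h1 : HasFDerivAt (fun q : Euc d × ℝ => repr (fderiv ℝ φ q.1))
        (repr.comp (A.comp (ContinuousLinearMap.fst ℝ (Euc d) ℝ))) (x₀, c₀) :=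
      repr.hasFDerivAt.comp (x₀, c₀)
        ((hφ2.differentiableAt (by simp)).hasFDerivAt.comp (x₀, c₀) hasFDerivAt_fst)
    have h2 : HasFDerivAt (fun q : Euc d × ℝ => φ q.1)
        ((fderiv ℝ φ x₀).comp (ContinuousLinearMap.fst ℝ (Euc d) ℝ)) (x₀, c₀) :=
      (hdiff _ hxU).hasFDerivAt.comp (x₀, c₀) hasFDerivAt_fst
    exact (hasFDerivAt_snd.smul h1).prodMk h2
  have hF'a : ∀ w μ, F' (w, μ) = (c₀ • repr (A w) + μ • repr (fderiv ℝ φ x₀), fderiv ℝ φ x₀ w) :=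
    fun _ _ => rfl
  have hpair : ∀ w μ, fderiv ℝ φ x₀ w = 0 → ⟪(F' (w, μ)).1, w⟫ = c₀ * A w w := by
    intro w μ hw
    rw [hF'a, inner_add_left, inner_smul_left, inner_smul_left, inner_repr, inner_repr, hw]
    simp
  -- For a vector in the kernel, `w` is tangent, and pairing the first component with `w` leaves `c₀
  -- D²φ(w, w)`; positive curvature forces `w = 0`.
  have hinj : Function.Injective F' := by
    refine (injective_iff_map_eq_zero F').2 ?_
    rintro ⟨w, μ⟩ h0
    have h1 : fderiv ℝ φ x₀ w = 0 := congrArg Prod.snd h0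
    have h2 := hpair w μ h1
    rw [h0, Prod.fst_zero, inner_zero_left] at h2
    have hw : w = 0 := by
      by_contra hw
      have := mul_pos hc₀' (hconv w hw h1)
      exact this.ne h2
    subst hw
    have h3 : μ • repr (fderiv ℝ φ x₀) = 0 := by
      have := congrArg Prod.fst h0
      rw [hF'a] at this
      simpa using this
    rcases smul_eq_zero.1 h3 with h4 | h4
    · rw [h4]; rfl
    · exact absurd (by ext v; rw [← inner_repr, h4, inner_zero_left]; rfl) hg
  let E : (Euc d × ℝ) ≃L[ℝ] (Euc d × ℝ) :=
    (LinearEquiv.ofInjectiveEndo (F' : Euc d × ℝ →ₗ[ℝ] Euc d × ℝ) hinj).toContinuousLinearEquiv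
  have hE : (E : Euc d × ℝ →L[ℝ] Euc d × ℝ) = F' := by ext q <;> rfl
  have hFE : HasFDerivAt F (E : Euc d × ℝ →L[ℝ] Euc d × ℝ) (x₀, c₀) := hE ▸ hF'
  have hstr : HasStrictFDerivAt F (E : Euc d × ℝ →L[ℝ] Euc d × ℝ) (x₀, c₀) :=
    hF.hasStrictFDerivAt' hFE (by simp)
  let Ψ := hF.localInverse hFE (by simp)
  have hF0 : F (x₀, c₀) = (y₀, 0) := by simp only [F, hφx, ← hyc]
  have hΨ : ContDiffAt ℝ ∞ Ψ (y₀, 0) := hF0 ▸ hF.to_localInverse hFE (by simp)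
  have hΨ0 : Ψ (y₀, 0) = (x₀, c₀) := hF0 ▸ hF.localInverse_apply_image hFE (by simp)
  have hΨ' : HasFDerivAt Ψ (E.symm : Euc d × ℝ →L[ℝ] Euc d × ℝ) (y₀, 0) :=
    hF0 ▸ hstr.to_localInverse.hasFDerivAt
  have hinv : ∀ᶠ q in 𝓝 (y₀, (0 : ℝ)), F (Ψ q) = q := hF0 ▸ hstr.eventually_right_inverse
  let ι : Euc d → Euc d × ℝ := fun y => (y, 0)
  have hι : HasFDerivAt ι (ContinuousLinearMap.inl ℝ (Euc d) ℝ) y₀ :=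
    (ContinuousLinearMap.inl ℝ (Euc d) ℝ).hasFDerivAt
  have hιc : ContDiffAt ℝ ∞ ι y₀ := (ContinuousLinearMap.inl ℝ (Euc d) ℝ).contDiff.contDiffAt
  have hX : ContDiffAt ℝ ∞ (fun y => (Ψ (ι y)).1) y₀ :=
    contDiffAt_fst.comp y₀ (ContDiffAt.comp y₀ hΨ hιc)
  refine ⟨fun y => (Ψ (ι y)).1, hX, ?_, ?_⟩
  · have hcont : Tendsto (fun y => Ψ (ι y)) (𝓝 y₀) (𝓝 (x₀, c₀)) := by
      have := (ContDiffAt.comp y₀ hΨ hιc).continuousAt.tendsto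
      change Tendsto (Ψ ∘ ι) _ (𝓝 (Ψ (y₀, 0))) at this
      rwa [hΨ0] at this
    have hc1 := (continuous_fst.tendsto _).comp hcont
    have hc2 := (continuous_snd.tendsto _).comp hcont
    filter_upwards [hc1.eventually (hU.mem_nhds hxU), hc2.eventually (lt_mem_nhds hc₀'),
      hι.continuousAt.eventually hinv] with y h1 h2 h3
    have e1 : (Ψ (ι y)).2 • repr (fderiv ℝ φ (Ψ (ι y)).1) = y := congrArg Prod.fst h3
    have e2 : φ (Ψ (ι y)).1 = 0 := congrArg Prod.snd h3
    exact ⟨(hKU _ h1).2 e2.le, fun z hz => le_of_normal hK.convex (hU.mem_nhds h1) (hdiff _ h1)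
      hKU e2 (le_of_lt h2) e1.symm hz⟩
  -- The derivative is the `w` with `F' (w, μ) = (v, 0)`, and its pairing with `v` is `c₀ D²φ(w,
  -- w)`. It is nonzero because `w = 0` would make `v` parallel to `y₀`, to which it is orthogonal.
  · intro v hv hyv
    have hd : fderiv ℝ (fun y => (Ψ (ι y)).1) y₀ v = (E.symm (v, 0)).1 := by
      have : HasFDerivAt (fun y => (Ψ (ι y)).1) _ y₀ := hasFDerivAt_fst.comp y₀ (hΨ'.comp y₀ hι)
      rw [this.fderiv]; rfl
    obtain ⟨⟨w, μ⟩, hwm⟩ : ∃ q, E.symm (v, 0) = q := ⟨_, rfl⟩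
    rw [hd, hwm]
    change 0 < ⟪w, v⟫
    have h1 : F' (w, μ) = (v, 0) := by
      have : E (w, μ) = (v, 0) := by rw [← hwm]; exact E.apply_symm_apply _
      exact this
    have h2 : fderiv ℝ φ x₀ w = 0 := congrArg Prod.snd h1
    have h3 := hpair w μ h2
    rw [h1] at h3
    rw [real_inner_comm, h3]
    refine mul_pos hc₀' (hconv w ?_ h2)
    rintro rfl
    have h4 : μ • repr (fderiv ℝ φ x₀) = v := by
      have := congrArg Prod.fst h1
      rw [hF'a] at this
      simpa using this
    have h5 : c₀ • v = μ • y₀ := by rw [hyc, ← h4, smul_comm]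
    have h6 : c₀ * ⟪v, v⟫ = 0 := by
      rw [← real_inner_smul_left, h5, real_inner_smul_left, hyv, mul_zero]
    rcases mul_eq_zero.1 h6 with h7 | h7
    · exact hc₀'.ne' h7
    · exact hv (inner_self_eq_zero.1 h7)

section SupportFn

variable {K : Set (Euc d)} (hK : IsSmoothEvenBody K) {y : Euc d}
include hK

/-- Locally `h(z) = ⟨z, X z⟩`, which gives smoothness. For the gradient at `z`: the function `h -
⟨·, X z⟩` is nonnegative and vanishes at `z`, so its derivative there is zero. -/
theorem IsSmoothEvenBody.supportFn_local {X : Euc d → Euc d} (hX : ContDiffAt ℝ ∞ X y)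
    (hm : ∀ᶠ z in 𝓝 y, X z ∈ K ∧ ∀ x ∈ K, ⟪z, x⟫ ≤ ⟪z, X z⟫) :
    ContDiffAt ℝ ∞ (supportFn K) y ∧
      fderiv ℝ (supportFn K) =ᶠ[𝓝 y] fun z => innerSL ℝ (X z) := by
  have h1 : ∀ᶠ z in 𝓝 y, supportFn K z = ⟪z, X z⟫ :=
    hm.mono fun z hz => supportFn_eq hz.1 hz.2
  have h2 : ContDiffAt ℝ ∞ (supportFn K) y :=
    (contDiffAt_id.inner ℝ hX).congr_of_eventuallyEq h1
  refine ⟨h2, ?_⟩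
  have h3 : ∀ᶠ z in 𝓝 y, DifferentiableAt ℝ (supportFn K) z := by
    filter_upwards [(h2.of_le one_le_top).eventually (by simp)] with z hz
    exact hz.differentiableAt (by simp)
  filter_upwards [h3, hm] with z hz hz'
  have hmin : IsLocalMin (fun w => supportFn K w - ⟪w, X z⟫) z := by
    refine Eventually.of_forall fun w => ?_
    have e := supportFn_eq hz'.1 hz'.2
    have := (supportFn_isGreatest hK.isCompact ⟨_, hz'.1⟩ w).2 ⟨X z, hz'.1, rfl⟩
    simp only [e, sub_self]
    simpa using this
  have hl : HasFDerivAt (fun w : Euc d => ⟪w, X z⟫) (innerSL ℝ (X z)) z := by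
    have := (innerSL ℝ (X z)).hasFDerivAt (x := z)
    refine this.congr_of_eventuallyEq (Eventually.of_forall fun w => ?_)
    simp [real_inner_comm]
  have := hmin.hasFDerivAt_eq_zero (hz.hasFDerivAt.sub hl)
  exact sub_eq_zero.1 this

/-- The support function of a smooth even body is smooth, with positive definite restricted
Hessian. -/
theorem IsSmoothEvenBody.adm : Adm (supportFn K) where
  cd := cd_of_contDiffAt fun y hy => by
    obtain ⟨X, hX, hm, -⟩ := hK.exists_local_position hy
    exact (hK.supportFn_local hX hm).1
  pos := fun y hy => by
    obtain ⟨t, ht, ht0⟩ := (((tendsto_line 0 y).eventually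
      (mem_interior_iff_mem_nhds.1 hK.zero_mem_interior)).and self_mem_nhdsWithin).exists
    have := (supportFn_isGreatest hK.isCompact ⟨_, ht⟩ y).2 ⟨_, ht, rfl⟩
    refine lt_of_lt_of_le ?_ this
    simp only [zero_add, inner_smul_right]
    exact mul_pos ht0 (real_inner_self_pos.2 hy)
  hom := fun c hc y _ => by
    have hne : K.Nonempty := ⟨0, interior_subset hK.zero_mem_interior⟩
    obtain ⟨⟨x, hx, hx'⟩, hub⟩ := supportFn_isGreatest hK.isCompact hne y
    rw [supportFn_eq (x := x) hx fun z hz => ?_, ← hx', inner_smul_left]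
    · simp
    · have := hub ⟨z, hz, rfl⟩
      rw [← hx'] at this
      simp only [inner_smul_left]
      exact mul_le_mul_of_nonneg_left this hc.le
  even := fun y => by
    have hne : K.Nonempty := ⟨0, interior_subset hK.zero_mem_interior⟩
    obtain ⟨⟨x, hx, hx'⟩, hub⟩ := supportFn_isGreatest hK.isCompact hne y
    rw [supportFn_eq (x := -x) (hK.neg_mem x hx) fun z hz => ?_, ← hx', inner_neg_neg]
    have := hub ⟨-z, hK.neg_mem z hz, rfl⟩
    rw [← hx'] at this
    rw [inner_neg_neg, inner_neg_left, ← inner_neg_right]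
    exact this
  convex := fun y v hy hv hyv => by
    obtain ⟨X, hX, hm, hpos⟩ := hK.exists_local_position hy
    obtain ⟨-, h2⟩ := hK.supportFn_local hX hm
    have hcd : CD ∞ (supportFn K) := cd_of_contDiffAt fun y hy => by
      obtain ⟨X, hX, hm, -⟩ := hK.exists_local_position hy
      exact (hK.supportFn_local hX hm).1
    rw [← fderiv_fderiv_eq_sum hcd two_le_top hy]
    have h3 : (fun z => fderiv ℝ (supportFn K) z v) =ᶠ[𝓝 y] fun z => ⟪X z, v⟫ :=
      h2.mono fun z hz => by simp [hz]
    have h4 : fderiv ℝ (fderiv ℝ (supportFn K)) y v v =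
        fderiv ℝ (fun z => fderiv ℝ (supportFn K) z v) y v := by
      rw [fderiv_clm_apply (hcd.diff_fderiv two_le_top hy) (differentiableAt_const v)]
      simp
    have hXd : DifferentiableAt ℝ X y := hX.differentiableAt (by simp)
    have h5 : fderiv ℝ (fun z => ⟪X z, v⟫) y v = ⟪fderiv ℝ X y v, v⟫ := by
      rw [fderiv_inner_apply ℝ hXd (differentiableAt_const v)]
      simp
    rw [h4, h3.fderiv_eq, h5]
    exact hpos v hv hyv

end SupportFn

end

section


/-! ### The structure equations -/

open Filter

variable {F h : Euc d → ℝ} {y : Euc d} {m : WithTop ℕ∞}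

theorem fderiv_fderiv_comm (hF : CD m F) (hm : 2 ≤ m) (hy : y ≠ 0) (u v : Euc d) :
    fderiv ℝ (fderiv ℝ F) y u v = fderiv ℝ (fderiv ℝ F) y v u := by
  rw [fderiv_fderiv_eq_sum hF hm hy, fderiv_fderiv_eq_sum hF hm hy, Finset.sum_comm]
  exact Finset.sum_congr rfl fun i _ => Finset.sum_congr rfl fun j _ => by
    rw [pd_comm hF hm hy]; ring

theorem fderiv_fderiv_apply (hF : CD m F) (hm : 2 ≤ m) (hy : y ≠ 0) (u v : Euc d) :
    fderiv ℝ (fun z => fderiv ℝ F z v) y u = fderiv ℝ (fderiv ℝ F) y u v := by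
  rw [fderiv_clm_apply (hF.diff_fderiv hm hy) (differentiableAt_const v)]
  simp

theorem Hom.fderiv_radial {r : ℤ} (hF : Hom r F) (hc : CD m F) (hm : 1 ≤ m) (hy : y ≠ 0) :
    fderiv ℝ F y y = r * F y := by
  rw [fderiv_eq_sum]; exact hF.euler hc hm hy

theorem Hom.hess_radial {r : ℤ} (hF : Hom r F) (hc : CD m F) (hm : 2 ≤ m) (hy : y ≠ 0)
    (v : Euc d) : fderiv ℝ (fderiv ℝ F) y v y = (r - 1 : ℤ) * fderiv ℝ F y v := by
  rw [fderiv_fderiv_comm hc hm hy, fderiv_fderiv_eq_sum hc hm hy, Finset.sum_comm, fderiv_eq_sum,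
    Finset.mul_sum]
  refine Finset.sum_congr rfl fun j _ => ?_
  have := (hF.pd j).euler (hc.pd (k := 1) (by rwa [one_add_one_eq_two]) j) le_rfl hy
  rw [mul_left_comm, ← this, Finset.mul_sum]
  exact Finset.sum_congr rfl fun i _ => by ring

theorem Adm.fderiv_radial (H : Adm h) (hy : y ≠ 0) : fderiv ℝ h y y = h y := by
  simpa using H.hom.fderiv_radial H.cd one_le_top hy

theorem Adm.hess_radial (H : Adm h) (hy : y ≠ 0) (v : Euc d) :
    fderiv ℝ (fderiv ℝ h) y v y = 0 := by
  simpa using H.hom.hess_radial H.cd two_le_top hy v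

theorem Adm.hess_radial_left (H : Adm h) (hy : y ≠ 0) (v : Euc d) :
    fderiv ℝ (fderiv ℝ h) y y v = 0 := by
  rw [fderiv_fderiv_comm H.cd two_le_top hy, H.hess_radial hy]

theorem DZ.fderiv_radial (hF : DZ m F) (hm : 1 ≤ m) (hy : y ≠ 0) : fderiv ℝ F y y = 0 := by
  simpa using hF.hom.fderiv_radial hF.cd hm hy

theorem DZ.hess_radial (hF : DZ m F) (hm : 2 ≤ m) (hy : y ≠ 0) (v : Euc d) :
    fderiv ℝ (fderiv ℝ F) y v y = -fderiv ℝ F y v := by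
  simpa using hF.hom.hess_radial hF.cd hm hy v

section Body

variable {K : Set (Euc d)}

theorem position_eq (K : Set (Euc d)) (y : Euc d) :
    position K y = repr (fderiv ℝ (supportFn K) y) := by
  refine ext_inner_right ℝ fun v => ?_
  rw [inner_repr, position, gradient, InnerProductSpace.toDual_symm_apply]

variable (H : Adm (supportFn K))
include H

theorem fderiv_position (hy : y ≠ 0) (v : Euc d) :
    fderiv ℝ (position K) y v = repr (fderiv ℝ (fderiv ℝ (supportFn K)) y v) := by
  rw [show position K = fun y => repr (fderiv ℝ (supportFn K) y) from funext (position_eq K)]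
  have := repr.hasFDerivAt.comp y (H.cd.diff_fderiv two_le_top hy).hasFDerivAt
  rw [show (fun y => repr (fderiv ℝ (supportFn K) y)) = repr ∘ fderiv ℝ (supportFn K) from rfl,
    this.fderiv]
  rfl

theorem hasFDerivAt_inv_supportFn (hy : y ≠ 0) :
    HasFDerivAt (fun z => (supportFn K z)⁻¹)
      (-(supportFn K y ^ 2)⁻¹ • fderiv ℝ (supportFn K) y) y :=
  (hasDerivAt_inv (H.ne hy)).comp_hasFDerivAt y (H.cd.diff one_le_top hy).hasFDerivAt

theorem fderiv_conormal (hy : y ≠ 0) (v : Euc d) : fderiv ℝ (conormal K) y v =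
    (supportFn K y)⁻¹ • v - ((supportFn K y ^ 2)⁻¹ * fderiv ℝ (supportFn K) y v) • y := by
  have := (hasFDerivAt_inv_supportFn H hy).smul (hasFDerivAt_id y)
  have e : fderiv ℝ (conormal K) y = _ := this.fderiv
  rw [e]
  simp [sub_eq_add_neg]

theorem metric_eq (θ : Sph d) (u v : Euc d) : metric K θ u v =
    (supportFn K θ)⁻¹ * fderiv ℝ (fderiv ℝ (supportFn K)) θ u v := by
  have hy := sph_ne_zero θ
  rw [metric, fderiv_conormal H hy, fderiv_position H hy, real_inner_comm, inner_repr, map_sub,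
    map_smul, map_smul, H.hess_radial hy, fderiv_fderiv_comm H.cd two_le_top hy]
  simp

/-- The conormal has degree zero, so its differential does not see the radial part that
`tangentField` projects away. -/
theorem fderiv_conormal_tangentField (hy : y ≠ 0) (v : Euc d) :
    fderiv ℝ (conormal K) y (tangentField v y) = fderiv ℝ (conormal K) y v := by
  have : fderiv ℝ (conormal K) y y = 0 := by
    rw [fderiv_conormal H hy, H.fderiv_radial hy, ← sub_smul]
    have := H.ne hy
    rw [show (supportFn K y)⁻¹ - (supportFn K y ^ 2)⁻¹ * supportFn K y = 0 by field_simp; ring,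
      zero_smul]
  rw [tangentField, map_sub, map_smul, this, smul_zero, sub_zero]

/-- Differentiating `v / h - (dh(v) / h²) z` once more and collecting terms puts the second
derivative in the shape of the Gauss equation: the tangential coefficient involves only `dh / h`,
and the coefficient of the conormal is `D²h(u, v) / h`, which is the metric. -/
theorem fderiv_fderiv_conormal (hy : y ≠ 0) (u v : Euc d) :
    fderiv ℝ (fun z => fderiv ℝ (conormal K) z (tangentField v z)) y u =
      fderiv ℝ (conormal K) y (-((fderiv ℝ (supportFn K) y u / supportFn K y) • v +
        (fderiv ℝ (supportFn K) y v / supportFn K y) • u)) -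
      (fderiv ℝ (fderiv ℝ (supportFn K)) y u v / supportFn K y) • conormal K y := by
  have h0 := H.ne hy
  have e : (fun z => fderiv ℝ (conormal K) z (tangentField v z)) =ᶠ[𝓝 y] fun z =>
      (supportFn K z)⁻¹ • v -
        ((supportFn K z)⁻¹ * (supportFn K z)⁻¹ * fderiv ℝ (supportFn K) z v) • z := by
    filter_upwards [compl_zero_mem_nhds hy] with z hz
    rw [fderiv_conormal_tangentField H hz, fderiv_conormal H hz, pow_two, mul_inv]
  have hi := hasFDerivAt_inv_supportFn H hy
  have hv : HasFDerivAt (fun z => fderiv ℝ (supportFn K) z v)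
      ((fderiv ℝ (fderiv ℝ (supportFn K)) y).flip v) y := by
    simpa using (H.cd.diff_fderiv two_le_top hy).hasFDerivAt.clm_apply (hasFDerivAt_const v y)
  have hd : fderiv ℝ (fun z => (supportFn K z)⁻¹ • v -
      ((supportFn K z)⁻¹ * (supportFn K z)⁻¹ * fderiv ℝ (supportFn K) z v) • z) y = _ :=
    ((hi.smul (hasFDerivAt_const v y)).sub
      (((hi.mul hi).mul hv).smul (hasFDerivAt_id y))).fderiv
  rw [e.fderiv_eq, hd, fderiv_conormal H hy, conormal]
  simp only [sub_apply, add_apply, smul_apply, ContinuousLinearMap.smulRight_apply, map_neg,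
    map_add, map_smul, smul_eq_mul, ContinuousLinearMap.flip_apply, Pi.mul_apply,
    ContinuousLinearMap.id_apply, id_eq, smul_zero, zero_add, smul_add, smul_neg, smul_smul]
  match_scalars
  · field_simp
  · field_simp
  · field_simp; ring

/-- `fderiv_fderiv_conormal` provides one solution. Two solutions differ by a tangent vector;
pairing the difference of their equations with that vector kills all multiples of `θ` and leaves its
squared length over `h`. -/
theorem conjConnection_eq (θ : Sph d) {u v : Euc d} (hu : u ∈ tangent θ) (hv : v ∈ tangent θ) :
    conjConnection K θ u (tangentField v) =
      -((fderiv ℝ (supportFn K) θ u / supportFn K θ) • v +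
        (fderiv ℝ (supportFn K) θ v / supportFn K θ) • u) := by
  have hy := sph_ne_zero θ
  have hex : ∃ w, ∃ c, ConormalGauss K θ u (tangentField v) w c :=
    ⟨_, _, (tangent θ).neg_mem ((tangent θ).add_mem ((tangent θ).smul_mem _ hv)
      ((tangent θ).smul_mem _ hu)), fderiv_fderiv_conormal H hy u v⟩
  rw [conjConnection, dif_pos hex]
  obtain ⟨c, hw, he⟩ := hex.choose_spec
  set w := hex.choose
  set w' := -((fderiv ℝ (supportFn K) θ u / supportFn K θ) • v +
        (fderiv ℝ (supportFn K) θ v / supportFn K θ) • u) with hw'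
  have hw'm : w' ∈ tangent θ := (tangent θ).neg_mem ((tangent θ).add_mem
    ((tangent θ).smul_mem _ hv) ((tangent θ).smul_mem _ hu))
  rw [fderiv_fderiv_conormal H hy u v, ← hw', fderiv_conormal H hy, fderiv_conormal H hy,
    conormal] at he
  have h2 : ⟪(θ : Euc d), w - w'⟫ = 0 :=
    Submodule.mem_orthogonal_singleton_iff_inner_right.1 ((tangent θ).sub_mem hw hw'm)
  have h3 := congrArg (fun x => ⟪x, w - w'⟫) he
  simp only [inner_sub_left, real_inner_smul_left, h2, mul_zero, sub_zero] at h3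
  have h4 : ⟪w - w', w - w'⟫ = 0 := by
    rw [inner_sub_left]
    have := inv_ne_zero (H.ne hy)
    have := mul_left_cancel₀ this h3
    linarith
  exact sub_eq_zero.1 (inner_self_eq_zero.1 h4)

theorem conjHess_eq {f : Sph d → ℝ} (hf : DZ 2 (radialExt f)) (θ : Sph d) {u v : Euc d}
    (hu : u ∈ tangent θ) (hv : v ∈ tangent θ) :
    conjHess K f θ u v = fderiv ℝ (fderiv ℝ (radialExt f)) θ u v +
      fderiv ℝ (supportFn K) θ u / supportFn K θ * fderiv ℝ (radialExt f) θ v +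
      fderiv ℝ (supportFn K) θ v / supportFn K θ * fderiv ℝ (radialExt f) θ u := by
  have hy := sph_ne_zero θ
  have e : (fun y => fderiv ℝ (radialExt f) y (tangentField v y)) =ᶠ[𝓝 (θ : Euc d)] fun y =>
      fderiv ℝ (radialExt f) y v := by
    filter_upwards [compl_zero_mem_nhds hy] with z hz
    rw [tangentField, map_sub, map_smul, hf.fderiv_radial one_le_two hz, smul_zero, sub_zero]
  rw [conjHess, conjConnection_eq H θ hu hv, e.fderiv_eq,
    fderiv_fderiv_apply hf.cd le_rfl hy]
  simp only [map_neg, map_add, map_smul, smul_eq_mul]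
  ring

end Body

end

section


/-! ### Adapted frames -/

open Filter Matrix

variable {F h : Euc d → ℝ} {y : Euc d} {m : WithTop ℕ∞}

/-- The index type of the frames. -/
abbrev FrameIdx (θ : Sph d) : Type := Fin (Module.finrank ℝ (tangent θ))

theorem finrank_tangent (θ : Sph d) : Module.finrank ℝ (tangent θ) = d :=
  haveI : Fact (Module.finrank ℝ (Euc d) = d + 1) := ⟨by simp⟩
  Submodule.finrank_orthogonal_span_singleton (sph_ne_zero θ)

theorem frame_mem (θ : Sph d) (i : FrameIdx θ) : frame θ i ∈ tangent θ :=
  (stdOrthonormalBasis ℝ (tangent θ) i).2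

theorem inner_frame (θ : Sph d) (i j : FrameIdx θ) :
    ⟪frame θ i, frame θ j⟫ = if i = j then 1 else 0 :=
  orthonormal_iff_ite.1 (stdOrthonormalBasis ℝ (tangent θ)).orthonormal i j

theorem inner_self_frame (θ : Sph d) (i : FrameIdx θ) : ⟪(θ : Euc d), frame θ i⟫ = 0 :=
  Submodule.mem_orthogonal_singleton_iff_inner_right.1 (frame_mem θ i)

/-- The matrix with given columns. -/
def colMatrix {ι : Type*} (c : ι → Euc d) : Matrix (Fin (d + 1)) ι ℝ := Matrix.of fun k a => c a k

theorem transpose_mul_colMatrix {ι κ : Type*} (c : ι → Euc d) (b : κ → Euc d) (a : ι) (a' : κ) :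
    ((colMatrix c)ᵀ * colMatrix b) a a' = ⟪c a, b a'⟫ := by
  simp [colMatrix, Matrix.mul_apply, PiLp.inner_apply, mul_comm]

theorem transpose_mul_mul_colMatrix {ι κ : Type*} (c : ι → Euc d) (b : κ → Euc d)
    (M : Matrix (Fin (d + 1)) (Fin (d + 1)) ℝ) (a : ι) (a' : κ) :
    ((colMatrix c)ᵀ * M * colMatrix b) a a' = ∑ i, ∑ j, c a i * b a' j * M i j := by
  simp only [colMatrix, Matrix.mul_apply, Matrix.transpose_apply, Matrix.of_apply, Finset.sum_mul]
  rw [Finset.sum_comm]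
  exact Finset.sum_congr rfl fun i _ => Finset.sum_congr rfl fun j _ => by ring

/-- The orthonormal frame completed by the normal of the sphere. -/
def fullFrame (θ : Sph d) : FrameIdx θ ⊕ Unit → Euc d := Sum.elim (frame θ) fun _ => θ

/-- The frame completed by the normal of the sphere, tilted so that `h` is constant along the
first vectors. -/
def tiltFrame (h : Euc d → ℝ) (θ : Sph d) : FrameIdx θ ⊕ Unit → Euc d :=
  Sum.elim (fun i => frame θ i - (fderiv ℝ h θ (frame θ i) / h θ) • (θ : Euc d)) fun _ => θ

/-- The transition matrix between the two frames. -/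
def tilt (h : Euc d → ℝ) (θ : Sph d) (s : ℝ) :
    Matrix (FrameIdx θ ⊕ Unit) (FrameIdx θ ⊕ Unit) ℝ :=
  fromBlocks 1 0 (Matrix.of fun _ j => s * (fderiv ℝ h θ (frame θ j) / h θ)) 1

theorem det_tilt (h : Euc d → ℝ) (θ : Sph d) (s : ℝ) : (tilt h θ s).det = 1 := by
  rw [tilt, det_fromBlocks_zero₁₂]; simp

theorem tilt_mul_tilt (h : Euc d → ℝ) (θ : Sph d) : tilt h θ 1 * tilt h θ (-1) = 1 := by
  rw [tilt, tilt, fromBlocks_multiply, ← fromBlocks_one]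
  congr 1
  · simp
  · simp
  · ext i j; simp
  · simp

theorem transpose_mul_fullFrame (θ : Sph d) :
    (colMatrix (fullFrame θ))ᵀ * colMatrix (fullFrame θ) = 1 := by
  ext a b
  rw [transpose_mul_colMatrix]
  rcases a with a | a <;> rcases b with b | b
  · simp [fullFrame, inner_frame, Matrix.one_apply]
  · simp [fullFrame, real_inner_comm, inner_self_frame]
  · simp [fullFrame, inner_self_frame]
  · simp [fullFrame]

theorem fullFrame_mul_transpose (θ : Sph d) :
    colMatrix (fullFrame θ) * (colMatrix (fullFrame θ))ᵀ = 1 :=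
  (mul_eq_one_comm_of_card_eq _ _ _ (by simp [finrank_tangent])).1 (transpose_mul_fullFrame θ)

theorem colMatrix_tiltFrame (h : Euc d → ℝ) (θ : Sph d) :
    colMatrix (tiltFrame h θ) = colMatrix (fullFrame θ) * tilt h θ (-1) := by
  ext k a
  rcases a with a | a
  · simp [colMatrix, Matrix.mul_apply, tilt, tiltFrame, fullFrame, Matrix.one_apply]
    ring
  · simp [colMatrix, Matrix.mul_apply, tilt, tiltFrame, fullFrame]

/-- The inverse of the matrix of the tilted frame. -/
def coframe (h : Euc d → ℝ) (θ : Sph d) : Matrix (FrameIdx θ ⊕ Unit) (Fin (d + 1)) ℝ :=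
  tilt h θ 1 * (colMatrix (fullFrame θ))ᵀ

theorem coframe_mul (h : Euc d → ℝ) (θ : Sph d) : coframe h θ * colMatrix (tiltFrame h θ) = 1 := by
  rw [coframe, colMatrix_tiltFrame, Matrix.mul_assoc, ← Matrix.mul_assoc (colMatrix _)ᵀ,
    transpose_mul_fullFrame, Matrix.one_mul, tilt_mul_tilt]

theorem mul_coframe (h : Euc d → ℝ) (θ : Sph d) : colMatrix (tiltFrame h θ) * coframe h θ = 1 :=
  (mul_eq_one_comm_of_card_eq _ _ _ (by simp [finrank_tangent])).1 (coframe_mul h θ)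

/-- The inverse of the metric matrix, completed by a unit normal. -/
def fullInverse (K : Set (Euc d)) (θ : Sph d) : Matrix (FrameIdx θ ⊕ Unit) (FrameIdx θ ⊕ Unit) ℝ :=
  fromBlocks (metricMatrix K θ)⁻¹ 0 0 1

/-- The metric matrix, completed by a unit normal. -/
def fullMetric (K : Set (Euc d)) (θ : Sph d) : Matrix (FrameIdx θ ⊕ Unit) (FrameIdx θ ⊕ Unit) ℝ :=
  fromBlocks (metricMatrix K θ) 0 0 1

theorem Adm.gm_quad {h : Euc d → ℝ} (H : Adm h) (hy : y ≠ 0) (u v : Euc d) :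
    ∑ i, ∑ j, u i * v j * gm h y i j =
      h y * fderiv ℝ (fderiv ℝ h) y u v + fderiv ℝ h y u * fderiv ℝ h y v := by
  rw [fderiv_fderiv_eq_sum H.cd two_le_top hy, fderiv_eq_sum, fderiv_eq_sum, Finset.sum_mul_sum]
  simp only [gm, Matrix.of_apply, Finset.mul_sum, ← Finset.sum_add_distrib]
  exact Finset.sum_congr rfl fun i _ => Finset.sum_congr rfl fun j _ => by ring

section Body

variable {K : Set (Euc d)} (H : Adm (supportFn K))
include H

theorem fderiv_tiltFrame (θ : Sph d) (i) :
    fderiv ℝ (supportFn K) θ (tiltFrame (supportFn K) θ (.inl i)) = 0 := by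
  have hy := sph_ne_zero θ
  have := H.ne hy
  simp only [tiltFrame, Sum.elim_inl, map_sub, map_smul, H.fderiv_radial hy, smul_eq_mul]
  field_simp; ring

/-- On the tilted vectors `dh` vanishes, and `D²h` annihilates `θ`, so `h D²h + dh ⊗ dh` has no
mixed block. -/
theorem transpose_mul_gm_mul (θ : Sph d) :
    (colMatrix (tiltFrame (supportFn K) θ))ᵀ * gm (supportFn K) θ *
      colMatrix (tiltFrame (supportFn K) θ) = supportFn K θ ^ 2 • fullMetric K θ := by
  have hy := sph_ne_zero θ
  have h0 := H.ne hy
  ext a b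
  rw [transpose_mul_mul_colMatrix, H.gm_quad hy]
  rcases a with a | a <;> rcases b with b | b
  · rw [fderiv_tiltFrame H, zero_mul, add_zero]
    simp only [tiltFrame, Sum.elim_inl, map_sub, map_smul, H.hess_radial hy, sub_zero,
      _root_.sub_apply, _root_.smul_apply, fullMetric, Matrix.smul_apply, fromBlocks_apply₁₁,
      metricMatrix, Matrix.of_apply, metric_eq H, smul_eq_mul, H.hess_radial_left hy, mul_zero]
    field_simp
  · rw [fderiv_tiltFrame H]
    simp [tiltFrame, H.hess_radial hy, fullMetric]
  · rw [fderiv_tiltFrame H, fderiv_fderiv_comm H.cd two_le_top hy]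
    simp [tiltFrame, H.hess_radial hy, fullMetric]
  · simp [tiltFrame, H.hess_radial hy, H.fderiv_radial hy, fullMetric, pow_two]

theorem gm_eq_coframe (θ : Sph d) : gm (supportFn K) θ =
    (coframe (supportFn K) θ)ᵀ * (supportFn K θ ^ 2 • fullMetric K θ) * coframe (supportFn K) θ := by
  have h1 := mul_coframe (supportFn K) θ
  have h2 : (coframe (supportFn K) θ)ᵀ * (colMatrix (tiltFrame (supportFn K) θ))ᵀ = 1 := by
    rw [← Matrix.transpose_mul, h1, Matrix.transpose_one]
  rw [← transpose_mul_gm_mul H]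
  simp only [Matrix.mul_assoc]
  rw [h1, Matrix.mul_one, ← Matrix.mul_assoc, h2, Matrix.one_mul]

/-- Orthonormal completion and the unipotent tilt do not change the determinant, so each of the `d +
1` dimensions contributes a factor `h²`. -/
theorem gd_eq_det (θ : Sph d) :
    gd (supportFn K) θ = supportFn K θ ^ (2 * (d + 1)) * (metricMatrix K θ).det := by
  rw [gd, gm_eq_coframe H, coframe]
  simp only [Matrix.transpose_mul, Matrix.transpose_transpose]
  have : colMatrix (fullFrame θ) * (tilt (supportFn K) θ 1)ᵀ * (supportFn K θ ^ 2 • fullMetric K θ) *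
      (tilt (supportFn K) θ 1 * (colMatrix (fullFrame θ))ᵀ) =
      colMatrix (fullFrame θ) * ((tilt (supportFn K) θ 1)ᵀ * (supportFn K θ ^ 2 • fullMetric K θ) *
      tilt (supportFn K) θ 1) * (colMatrix (fullFrame θ))ᵀ := by
    simp only [Matrix.mul_assoc]
  rw [this, det_conj_of_mul_eq_one (fullFrame_mul_transpose θ) (transpose_mul_fullFrame θ),
    det_mul, det_mul, det_transpose, det_tilt, det_smul, fullMetric, det_fromBlocks_zero₁₂]
  simp [finrank_tangent, ← pow_mul]

theorem isUnit_det_metricMatrix (θ : Sph d) : IsUnit (metricMatrix K θ).det := by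
  have h1 := gd_eq_det H θ
  have h2 := H.gd_pos (sph_ne_zero θ)
  refine isUnit_iff_ne_zero.2 fun h => ?_
  rw [h, mul_zero] at h1
  exact h2.ne' h1

theorem smul_gi_eq (θ : Sph d) : supportFn K θ ^ 2 • gi (supportFn K) θ =
    colMatrix (tiltFrame (supportFn K) θ) * fullInverse K θ *
      (colMatrix (tiltFrame (supportFn K) θ))ᵀ := by
  have hy := sph_ne_zero θ
  have h0 : supportFn K θ ^ 2 ≠ 0 := pow_ne_zero 2 (H.ne hy)
  have hB : fullMetric K θ * fullInverse K θ = 1 := by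
    rw [fullMetric, fullInverse, fromBlocks_multiply, mul_nonsing_inv _ (isUnit_det_metricMatrix H θ)]
    simp
  have h1 := coframe_mul (supportFn K) θ
  have h2 : (coframe (supportFn K) θ)ᵀ * (colMatrix (tiltFrame (supportFn K) θ))ᵀ = 1 := by
    rw [← Matrix.transpose_mul, mul_coframe, Matrix.transpose_one]
  have key : gm (supportFn K) θ * (colMatrix (tiltFrame (supportFn K) θ) *
      fullInverse K θ * (colMatrix (tiltFrame (supportFn K) θ))ᵀ) =
      supportFn K θ ^ 2 • (1 : Matrix _ _ ℝ) := by
    rw [gm_eq_coframe H]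
    calc _ = (coframe (supportFn K) θ)ᵀ * (supportFn K θ ^ 2 • fullMetric K θ) *
          (coframe (supportFn K) θ * colMatrix (tiltFrame (supportFn K) θ)) *
          fullInverse K θ * (colMatrix (tiltFrame (supportFn K) θ))ᵀ := by
          simp only [Matrix.mul_assoc]
      _ = _ := by
          rw [h1, Matrix.mul_one, Matrix.mul_smul, Matrix.smul_mul, Matrix.smul_mul,
            Matrix.mul_assoc _ (fullMetric K θ), hB, Matrix.mul_one, h2]
  calc _ = gi (supportFn K) θ * (supportFn K θ ^ 2 • (1 : Matrix _ _ ℝ)) := by simp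
    _ = _ := by rw [← key, ← Matrix.mul_assoc, H.gi_mul_gm hy, Matrix.one_mul]

/-- The vectors `dx(e_i)` and `x` are the columns of `h⁻¹ G P` with `P` the tilted frame. As `P` has
determinant `±1`, the Gram determinant is `h ^ (-2 (d + 1)) (det G)²`. -/
theorem volumeDensity_eq (θ : Sph d) : volumeDensity K θ = dens (supportFn K) θ := by
  have hy := sph_ne_zero θ
  have h0 := H.pos _ hy
  set P := colMatrix (tiltFrame (supportFn K) θ) with hP
  set Q := coframe (supportFn K) θ with hQ
  have hcol : ∀ a, (Sum.elim (fun i => fderiv ℝ (position K) θ (frame θ i))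
      (fun _ : Unit => position K θ)) a =
      (supportFn K θ)⁻¹ • WithLp.toLp 2 (gm (supportFn K) θ *ᵥ
        (tiltFrame (supportFn K) θ a : Euc d)) := by
    intro a
    refine ext_inner_right ℝ fun v => ?_
    have e : ⟪(WithLp.toLp 2 (gm (supportFn K) θ *ᵥ (tiltFrame (supportFn K) θ a : Euc d)) : Euc d),
        v⟫ = ∑ i, ∑ j, v i * (tiltFrame (supportFn K) θ a) j * gm (supportFn K) θ i j := by
      simp only [PiLp.inner_apply, Matrix.mulVec, dotProduct, RCLike.inner_apply, conj_trivial,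
        Finset.mul_sum]
      exact Finset.sum_congr rfl fun i _ => Finset.sum_congr rfl fun j _ => by ring
    rw [real_inner_smul_left, e, H.gm_quad hy]
    rcases a with a | a
    · rw [fderiv_tiltFrame H, Sum.elim_inl, fderiv_position H hy, inner_repr]
      simp only [tiltFrame, Sum.elim_inl, map_sub, map_smul, H.hess_radial hy]
      rw [fderiv_fderiv_comm H.cd two_le_top hy v]
      field_simp; simp [mul_comm]
    · simp only [Sum.elim_inr, position_eq, inner_repr, tiltFrame, H.hess_radial hy,
        H.fderiv_radial hy]
      field_simp; simp
  have hgram : Matrix.gram ℝ (Sum.elim (fun i : FrameIdx θ => fderiv ℝ (position K) θ (frame θ i))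
      (fun _ : Unit => position K θ)) =
      ((supportFn K θ)⁻¹ ^ 2) • ((gm (supportFn K) θ * P)ᵀ * (gm (supportFn K) θ * P)) := by
    ext a b
    rw [Matrix.gram_apply, hcol, hcol, real_inner_smul_left, real_inner_smul_right]
    simp only [PiLp.inner_apply, Matrix.smul_apply, Matrix.mul_apply, Matrix.transpose_apply,
      Matrix.mulVec, dotProduct, RCLike.inner_apply, conj_trivial, smul_eq_mul, hP, colMatrix,
      Matrix.of_apply]
    rw [pow_two, mul_assoc]
    congr 2
    exact Finset.sum_congr rfl fun i _ => mul_comm _ _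
  have hGP : gm (supportFn K) θ * P = Qᵀ * (supportFn K θ ^ 2 • fullMetric K θ) := by
    rw [gm_eq_coframe H, Matrix.mul_assoc _ _ P, coframe_mul, Matrix.mul_one]
  have hQQ : (Q * Qᵀ).det = 1 := by
    have : Q * Qᵀ = tilt (supportFn K) θ 1 * (tilt (supportFn K) θ 1)ᵀ := by
      rw [hQ, coframe, Matrix.transpose_mul, Matrix.transpose_transpose, Matrix.mul_assoc,
        ← Matrix.mul_assoc (colMatrix _)ᵀ, transpose_mul_fullFrame, Matrix.one_mul]
    rw [this, det_mul, det_transpose, det_tilt, one_mul]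
  have hdet : (Matrix.gram ℝ (Sum.elim (fun i : FrameIdx θ =>
      fderiv ℝ (position K) θ (frame θ i)) (fun _ : Unit => position K θ))).det =
      dens (supportFn K) θ ^ 2 := by
    have e : (Qᵀ * (supportFn K θ ^ 2 • fullMetric K θ))ᵀ *
        (Qᵀ * (supportFn K θ ^ 2 • fullMetric K θ)) = (supportFn K θ ^ 2 • fullMetric K θ)ᵀ *
        (Q * Qᵀ) * (supportFn K θ ^ 2 • fullMetric K θ) := by
      simp only [Matrix.transpose_mul, Matrix.transpose_transpose, Matrix.mul_assoc]
    rw [hgram, hGP, e, det_smul, det_mul, det_mul, hQQ, det_transpose, det_smul, fullMetric,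
      det_fromBlocks_zero₁₂, dens, gd_eq_det H]
    simp only [Fintype.card_sum, Fintype.card_fin, Fintype.card_unit, finrank_tangent, det_one,
      mul_one, ← pow_mul]
    rw [show (-((d : ℤ) + 1)) = -((d + 1 : ℕ) : ℤ) by push_cast; rfl, _root_.zpow_neg, zpow_natCast]
    have := h0.ne'
    rw [inv_pow]
    field_simp
    ring
  rw [volumeDensity, hdet, Real.sqrt_sq (H.dens_pos hy).le]

end Body

end

section


/-! ### The centro-affine operators in terms of homogeneous functions -/

open Filter Matrix

variable {F h : Euc d → ℝ} {y : Euc d} {m : WithTop ℕ∞}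

section Body

variable {K : Set (Euc d)} {f : Sph d → ℝ}

/-- The differential in the frame. -/
def frameDeriv (f : Sph d → ℝ) (θ : Sph d) (i : FrameIdx θ) : ℝ :=
  fderiv ℝ (radialExt f) θ (frame θ i)

theorem trace_fromBlocks {ι κ : Type*} [Fintype ι] [Fintype κ] (A : Matrix ι ι ℝ)
    (B : Matrix ι κ ℝ) (C : Matrix κ ι ℝ) (D : Matrix κ κ ℝ) :
    (fromBlocks A B C D).trace = A.trace + D.trace := by
  simp [Matrix.trace]

theorem trace_row_mul_mul_col {ι : Type*} [Fintype ι] (M : Matrix ι ι ℝ) (p : ι → ℝ) :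
    ((Matrix.of fun (_ : Unit) i => -p i) * (M * Matrix.of fun i (_ : Unit) => -p i)).trace =
      p ⬝ᵥ M *ᵥ p := by
  simp [Matrix.trace, Matrix.mul_apply, mulVec, dotProduct]

variable (H : Adm (supportFn K)) (hf : DZ 2 (radialExt f))
include H hf

/-- Since `D²F θ = -dF`, tilting the frame adds to the flat Hessian precisely the terms `dh ⊗ dF /
h` and `dF ⊗ dh / h` by which the conjugate connection differs from the flat derivative. -/
theorem transpose_mul_hm_mul (θ : Sph d) :
    (colMatrix (tiltFrame (supportFn K) θ))ᵀ * hm (radialExt f) θ *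
      colMatrix (tiltFrame (supportFn K) θ) =
    fromBlocks (hessMatrix K f θ) (Matrix.of fun i _ => -frameDeriv f θ i)
      (Matrix.of fun _ i => -frameDeriv f θ i) 0 := by
  have hy := sph_ne_zero θ
  have hq : ∀ u v : Euc d, ∑ i, ∑ j, u i * v j * hm (radialExt f) θ i j =
      fderiv ℝ (fderiv ℝ (radialExt f)) θ u v := fun u v => by
    rw [fderiv_fderiv_eq_sum hf.cd le_rfl hy]; rfl
  have hl : ∀ v : Euc d, fderiv ℝ (fderiv ℝ (radialExt f)) θ θ v = -fderiv ℝ (radialExt f) θ v :=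
    fun v => by rw [fderiv_fderiv_comm hf.cd le_rfl hy, hf.hess_radial le_rfl hy]
  ext a b
  rw [transpose_mul_mul_colMatrix, hq]
  rcases a with a | a <;> rcases b with b | b
  · simp only [tiltFrame, Sum.elim_inl, map_sub, map_smul, hf.hess_radial le_rfl hy, hl,
      _root_.sub_apply, _root_.smul_apply, fromBlocks_apply₁₁, hessMatrix, Matrix.of_apply,
      conjHess_eq H hf θ (frame_mem θ a) (frame_mem θ b), smul_eq_mul,
      hf.fderiv_radial one_le_two hy]
    ring
  · simp [tiltFrame, hf.hess_radial le_rfl hy, hf.fderiv_radial one_le_two hy, frameDeriv]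
  · simp [tiltFrame, hl, hf.fderiv_radial one_le_two hy, frameDeriv]
  · simp [tiltFrame, hl, hf.fderiv_radial one_le_two hy]

theorem laplacian_eq (θ : Sph d) : laplacian K f θ = lap (supportFn K) (radialExt f) θ := by
  have h1 : lap (supportFn K) (radialExt f) θ =
      (supportFn K θ ^ 2 • gi (supportFn K) θ * hm (radialExt f) θ).trace := by
    simp only [lap, hm, Matrix.trace, Matrix.diag, Matrix.mul_apply, Matrix.smul_apply,
      Matrix.of_apply, smul_eq_mul, Finset.mul_sum]
    exact Finset.sum_congr rfl fun i _ => Finset.sum_congr rfl fun j _ => by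
      rw [pd_comm hf.cd le_rfl (sph_ne_zero θ) i j]; ring
  rw [h1, smul_gi_eq H, Matrix.mul_assoc, Matrix.mul_assoc, trace_mul_comm, Matrix.mul_assoc,
    transpose_mul_hm_mul H hf, fullInverse, fromBlocks_multiply, trace_fromBlocks]
  simp [laplacian]

theorem gam_eq (θ : Sph d) : gam (supportFn K) (radialExt f) (radialExt f) θ =
    frameDeriv f θ ⬝ᵥ (metricMatrix K θ)⁻¹ *ᵥ frameDeriv f θ := by
  have hy := sph_ne_zero θ
  set p : Fin (d + 1) → ℝ := fun i => pd i (radialExt f) θ with hp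
  have h1 : gam (supportFn K) (radialExt f) (radialExt f) θ =
      p ⬝ᵥ (supportFn K θ ^ 2 • gi (supportFn K) θ) *ᵥ p := by
    simp only [gam, dotProduct, mulVec, Matrix.smul_apply, smul_eq_mul, Finset.mul_sum, hp]
    exact Finset.sum_congr rfl fun i _ => Finset.sum_congr rfl fun j _ => by ring
  have h2 : (colMatrix (tiltFrame (supportFn K) θ))ᵀ *ᵥ p = Sum.elim (frameDeriv f θ) 0 := by
    have e : ∀ a, ((colMatrix (tiltFrame (supportFn K) θ))ᵀ *ᵥ p) a =
        fderiv ℝ (radialExt f) θ (tiltFrame (supportFn K) θ a) := fun a => by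
      rw [fderiv_eq_sum]; rfl
    ext a
    rw [e]
    rcases a with a | a <;> simp [tiltFrame, hf.fderiv_radial one_le_two hy, frameDeriv]
  rw [h1, smul_gi_eq H, ← mulVec_mulVec, ← mulVec_mulVec, h2, dotProduct_mulVec,
    ← mulVec_transpose, h2, fullInverse, fromBlocks_mulVec]
  simp [dotProduct]

theorem gradSq_eq (θ : Sph d) :
    gradSq K f θ = gam (supportFn K) (radialExt f) (radialExt f) θ := by
  have e : gradVec K f θ = (metricMatrix K θ)⁻¹ *ᵥ frameDeriv f θ := rfl
  rw [gam_eq H hf, gradSq, e, mulVec_mulVec, mul_nonsing_inv _ (isUnit_det_metricMatrix H θ),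
    one_mulVec, dotProduct_comm]

theorem hessMatrix_isSymm (θ : Sph d) : (hessMatrix K f θ)ᵀ = hessMatrix K f θ := by
  ext i j
  simp only [hessMatrix, Matrix.transpose_apply, Matrix.of_apply,
    conjHess_eq H hf θ (frame_mem θ _) (frame_mem θ _),
    fderiv_fderiv_comm hf.cd le_rfl (sph_ne_zero θ) (frame θ i)]
  ring

/-- The squared norm of a symmetric block matrix counts its mixed block twice; here that block is
`-df`, and the radial block is zero. -/
theorem tensorNormSq_hess (θ : Sph d) : tensorNormSq K θ (hessMatrix K f θ) =
    hs (supportFn K) (radialExt f) (radialExt f) θ -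
      2 * gam (supportFn K) (radialExt f) (radialExt f) θ := by
  set A := (colMatrix (tiltFrame (supportFn K) θ))ᵀ * hm (radialExt f) θ *
      colMatrix (tiltFrame (supportFn K) θ) with hA
  set P := colMatrix (tiltFrame (supportFn K) θ) with hP
  have h1 : hs (supportFn K) (radialExt f) (radialExt f) θ =
      (fullInverse K θ * A * (fullInverse K θ * A)).trace := by
    have e : hs (supportFn K) (radialExt f) (radialExt f) θ =
        ((supportFn K θ ^ 2 • gi (supportFn K) θ) * hm (radialExt f) θ *
          (supportFn K θ ^ 2 • gi (supportFn K) θ) * hm (radialExt f) θ).trace := by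
      simp only [hs, Matrix.smul_mul, Matrix.mul_smul, trace_smul, smul_eq_mul]; ring
    rw [e, smul_gi_eq H, ← hP]
    have e2 : P * fullInverse K θ * Pᵀ * hm (radialExt f) θ * (P * fullInverse K θ * Pᵀ) *
        hm (radialExt f) θ = P * (fullInverse K θ * A * (fullInverse K θ *
          (Pᵀ * hm (radialExt f) θ))) := by
      simp only [hA, Matrix.mul_assoc]
    rw [e2, trace_mul_comm]
    simp only [hA, Matrix.mul_assoc]
  rw [h1, hA, transpose_mul_hm_mul H hf, fullInverse, fromBlocks_multiply, fromBlocks_multiply,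
    trace_fromBlocks, tensorNormSq, hessMatrix_isSymm H hf, gam_eq H hf]
  have e3 := trace_row_mul_mul_col (metricMatrix K θ)⁻¹ (frameDeriv f θ)
  have e4 := e3
  rw [trace_mul_comm, Matrix.mul_assoc] at e4
  simp only [Matrix.zero_mul, Matrix.mul_zero, Matrix.one_mul, add_zero, zero_add, trace_add, e3,
    e4, Matrix.mul_assoc]
  ring

theorem tensorNormSq_hess_add_smul (θ : Sph d) (c : ℝ) :
    tensorNormSq K θ (hessMatrix K f θ + c • metricMatrix K θ) =
      tensorNormSq K θ (hessMatrix K f θ) + 2 * (c * laplacian K f θ) + d * c ^ 2 := by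
  have hu := isUnit_det_metricMatrix H θ
  have hsymm : (metricMatrix K θ)ᵀ = metricMatrix K θ := by
    ext i j
    simp only [metricMatrix, Matrix.transpose_apply, Matrix.of_apply, metric_eq H,
      fderiv_fderiv_comm H.cd two_le_top (sph_ne_zero θ) (frame θ i)]
  have e : ∀ B : Matrix (FrameIdx θ) (FrameIdx θ) ℝ, Bᵀ = B → tensorNormSq K θ B =
      ((metricMatrix K θ)⁻¹ * B * ((metricMatrix K θ)⁻¹ * B)).trace := fun B hB => by
    rw [tensorNormSq, hB, Matrix.mul_assoc ((metricMatrix K θ)⁻¹ * B)]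
  rw [e _ (hessMatrix_isSymm H hf θ), e _ (by
    rw [Matrix.transpose_add, Matrix.transpose_smul, hsymm, hessMatrix_isSymm H hf]),
    Matrix.mul_add, Matrix.mul_smul, nonsing_inv_mul _ hu, laplacian]
  simp only [Matrix.add_mul, Matrix.mul_add, Matrix.smul_mul, Matrix.mul_smul, Matrix.one_mul,
    Matrix.mul_one, trace_add, trace_smul, trace_one, Fintype.card_fin, finrank_tangent,
    smul_eq_mul]
  ring

end Body

end

section


/-! ### Even functions on the sphere and homogeneous functions -/

open Filter MeasureTheory

variable {F G h : Euc d → ℝ} {m : WithTop ℕ∞}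

instance : Fact (Module.finrank ℝ (Euc d) = d + 1) := ⟨by simp⟩

theorem radialExt_sph (f : Sph d → ℝ) (θ : Sph d) : radialExt f θ = f θ := by
  rw [radialExt, dif_pos (sph_ne_zero θ)]
  congr 1
  ext1
  simp

/-- The complement of the origin as an open submanifold. -/
def punctured (d : ℕ) : TopologicalSpace.Opens (Euc d) := ⟨{0}ᶜ, isOpen_compl_singleton⟩

/-- The extension is `f` composed with the smooth retraction `y / ‖y‖`, viewed as a map from an open
submanifold to the sphere. -/
theorem cd_radialExt {f : Sph d → ℝ} (hf : ContMDiff (𝓡 d) 𝓘(ℝ, ℝ) m f) : CD m (radialExt f) := by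
  refine cd_of_contDiffAt fun y hy => ?_
  let g : punctured d → Euc d := fun z => ‖(z : Euc d)‖⁻¹ • (z : Euc d)
  have hg : ContMDiff 𝓘(ℝ, Euc d) 𝓘(ℝ, Euc d) m g := by
    intro z
    have hz : (z : Euc d) ≠ 0 := z.2
    refine contMDiffAt_subtype_iff (f := fun z : Euc d => ‖z‖⁻¹ • z).2 ?_
    exact (((contDiffAt_norm ℝ hz).inv (norm_ne_zero_iff.2 hz)).smul contDiffAt_id).contMDiffAt
  have hgs : ∀ z, g z ∈ Metric.sphere (0 : Euc d) 1 := fun z => by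
    have hz : (z : Euc d) ≠ 0 := z.2
    simp [g, norm_smul, hz]
  have h1 := hf.comp (hg.codRestrict_sphere (n := d) hgs)
  have h2 := h1 ⟨y, hy⟩
  have h3 : (f ∘ Set.codRestrict g (Metric.sphere 0 1) hgs) =
      fun z : punctured d => radialExt f z := by
    funext z
    have hz : (z : Euc d) ≠ 0 := z.2
    rw [radialExt, dif_pos hz]
    rfl
  rw [h3] at h2
  exact contMDiffAt_iff_contDiffAt.1 (contMDiffAt_subtype_iff.1 h2)

theorem IsC2Even.dz {f : Sph d → ℝ} (hf : IsC2Even f) : DZ 2 (radialExt f) where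
  cd := cd_radialExt hf.1
  hom := fun c hc y hy => by
    have hcy : c • y ≠ 0 := smul_ne_zero hc.ne' hy
    rw [radialExt, dif_pos hcy, radialExt, dif_pos hy, zpow_zero, one_mul]
    congr 2
    rw [norm_smul, Real.norm_of_nonneg hc.le, smul_smul]
    congr 1
    have := hc.ne'
    field_simp
  even := fun y => by
    by_cases hy : y = 0
    · rw [hy, neg_zero]
    · rw [radialExt, dif_pos (neg_ne_zero.2 hy), radialExt, dif_pos hy, ← hf.2]
      congr 1
      ext1
      simp

theorem DZ.isC2Even (hF : DZ 2 F) : IsC2Even fun θ : Sph d => F θ := by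
  refine ⟨fun θ => ?_, fun θ => hF.even θ⟩
  have h1 : ContMDiffAt 𝓘(ℝ, Euc d) 𝓘(ℝ, ℝ) 2 F θ :=
    (hF.cd.contDiffAt (sph_ne_zero θ)).contMDiffAt
  exact h1.comp θ (contMDiff_coe_sphere (n := d) (m := 2) θ)

theorem Hom.radialExt_eq (hF : Hom 0 F) {y : Euc d} (hy : y ≠ 0) :
    radialExt (fun θ : Sph d => F θ) y = F y := by
  rw [radialExt, dif_pos hy]
  have := hF ‖y‖⁻¹ (inv_pos.2 (norm_pos_iff.2 hy)) y hy
  simpa using this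

theorem pd_pd_congr (hFG : ∀ y, y ≠ 0 → F y = G y) {y : Euc d} (hy : y ≠ 0) (i j) :
    pd i (pd j F) y = pd i (pd j G) y :=
  pd_congr (fun _ hz => pd_congr hFG hz) hy

theorem lap_congr (hFG : ∀ y, y ≠ 0 → F y = G y) {y : Euc d} (hy : y ≠ 0) :
    lap h F y = lap h G y := by
  simp only [lap, pd_pd_congr hFG hy]

theorem gam_congr (hFG : ∀ y, y ≠ 0 → F y = G y) {y : Euc d} (hy : y ≠ 0) :
    gam h F F y = gam h G G y := by
  simp only [gam, pd_congr hFG hy]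

theorem hs_congr (hFG : ∀ y, y ≠ 0 → F y = G y) {y : Euc d} (hy : y ≠ 0) :
    hs h F F y = hs h G G y := by
  have : hm F y = hm G y := by ext i j; exact pd_pd_congr hFG hy i j
  simp only [hs, this]

theorem integral_nu {K : Set (Euc d)} (H : Adm (supportFn K)) (g : Sph d → ℝ) :
    ∫ θ, g θ ∂(nu K) = ∫ θ : Sph d, g θ * dens (supportFn K) θ ∂(sig d) := by
  have hv : ∀ θ : Sph d, volumeDensity K θ = dens (supportFn K) θ := volumeDensity_eq H
  have hm : Measurable fun θ : Sph d => (dens (supportFn K) θ).toNNReal :=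
    (H.cd_dens.continuous_sph.measurable).real_toNNReal
  have e : nu K = (sig d).withDensity fun θ => ((dens (supportFn K) θ).toNNReal : ENNReal) := by
    simp only [nu, hv]; rfl
  rw [e, integral_withDensity_eq_integral_smul hm]
  refine integral_congr_ae (Eventually.of_forall fun θ => ?_)
  simp only [NNReal.smul_def, Real.coe_toNNReal _ (H.dens_pos (sph_ne_zero θ)).le, smul_eq_mul]
  ring

/-- A function of degree zero and the extension of its restriction may differ at the origin; `hP`
asks that `P` ignore this. -/
theorem forall_isC2Even_iff {P : (Euc d → ℝ) → Prop}
    (hP : ∀ F G, DZ 2 F → (∀ y, y ≠ 0 → F y = G y) → P G → P F) :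
    (∀ f : Sph d → ℝ, IsC2Even f → P (radialExt f)) ↔ ∀ F, DZ 2 F → P F :=
  ⟨fun h F hF => hP F _ hF (fun _ hy => (hF.hom.radialExt_eq hy).symm) (h _ hF.isC2Even),
    fun h _ hf => h _ hf.dz⟩

section Transfer

variable {K : Set (Euc d)} (H : Adm (supportFn K)) (p : ℝ)
include H

/-- Green's formula makes the equality part of the statement automatic. -/
theorem localLp_iff : LocalLpBrunnMinkowski K p ↔ ∀ F : Euc d → ℝ, DZ 2 F →
    ∫ θ : Sph d, F θ * dens (supportFn K) θ ∂(sig d) = 0 →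
    (d + 1 - p) * ∫ θ : Sph d, F θ ^ 2 * dens (supportFn K) θ ∂(sig d) ≤
      ∫ θ : Sph d, gam (supportFn K) F F θ * dens (supportFn K) θ ∂(sig d) := by
  rw [← forall_isC2Even_iff fun F G hF h => ?_]
  · refine forall₂_congr fun f hf => ?_
    have hg := H.integral_gam_eq hf.dz.cd hf.dz.hom
    simp only [integral_nu H, gradSq_eq H hf.dz, laplacian_eq H hf.dz, ← radialExt_sph f]
    rw [← hg]
    push_cast
    simp
  · simp only [gam_congr h (sph_ne_zero _), h _ (sph_ne_zero _)]
    exact id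

theorem laplacianGrad_iff : LaplacianGradInequality K p ↔ ∀ F : Euc d → ℝ, DZ 2 F →
    (d + 1 - p) * ∫ θ : Sph d, gam (supportFn K) F F θ * dens (supportFn K) θ ∂(sig d) ≤
      ∫ θ : Sph d, lap (supportFn K) F θ ^ 2 * dens (supportFn K) θ ∂(sig d) := by
  rw [← forall_isC2Even_iff fun F G hF h => ?_]
  · refine forall₂_congr fun f hf => ?_
    have hg := H.integral_gam_eq hf.dz.cd hf.dz.hom
    simp only [integral_nu H, gradSq_eq H hf.dz, laplacian_eq H hf.dz]
    simp only [← radialExt_sph f]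
    rw [← hg]
    push_cast
    simp
  · simp only [gam_congr h (sph_ne_zero _), lap_congr h (sph_ne_zero _)]
    exact id

theorem hessLaplacian_iff : HessLaplacianInequality K p ↔ ∀ F : Euc d → ℝ, DZ 2 F →
    (2 - p) / (d + 1 - p) *
        ∫ θ : Sph d, lap (supportFn K) F θ ^ 2 * dens (supportFn K) θ ∂(sig d) ≤
      ∫ θ : Sph d, (hs (supportFn K) F F θ - 2 * gam (supportFn K) F F θ) *
        dens (supportFn K) θ ∂(sig d) := by
  rw [← forall_isC2Even_iff fun F G hF h => ?_]
  · refine forall₂_congr fun f hf => ?_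
    simp only [integral_nu H, tensorNormSq_hess H hf.dz, laplacian_eq H hf.dz]
    push_cast
    simp
  · simp only [gam_congr h (sph_ne_zero _), lap_congr h (sph_ne_zero _),
      hs_congr h (sph_ne_zero _)]
    exact id

theorem hessGrad_iff : HessGradInequality K p ↔ ∀ F : Euc d → ℝ, DZ 2 F →
    (2 - p) * ∫ θ : Sph d, gam (supportFn K) F F θ * dens (supportFn K) θ ∂(sig d) ≤
      ∫ θ : Sph d, (hs (supportFn K) F F θ - 2 * gam (supportFn K) F F θ) *
        dens (supportFn K) θ ∂(sig d) := by
  rw [← forall_isC2Even_iff fun F G hF h => ?_]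
  · refine forall₂_congr fun f hf => ?_
    simp only [integral_nu H, tensorNormSq_hess H hf.dz, gradSq_eq H hf.dz]
  · simp only [gam_congr h (sph_ne_zero _), hs_congr h (sph_ne_zero _)]
    exact id

/-- The shifted Hessian inequality is the Hessian inequality for `p = 0`, since the shift changes
the integral by `d ∫ f² - 2 ∫ |grad f|²`. -/
theorem shiftedHess_iff : ShiftedHessInequality K ↔ HessGradInequality K 0 := by
  refine forall₂_congr fun f hf => ?_
  have hF := hf.dz
  have hg := H.integral_gam_eq hF.cd hF.hom
  have h0 : CD 0 (radialExt f) := hF.cd.of_le zero_le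
  have i1 := H.integrable_mul_dens ((H.cd_hs hF.cd hF.cd).sub
    ((cd_const 2).mul ((H.cd_gam (hF.cd.of_le one_le_two) (hF.cd.of_le one_le_two)).of_le zero_le)))
  have i2 := H.integrable_mul_dens ((H.cd_lap hF.cd).neg.mul h0)
  have i3 := H.integrable_mul_dens (h0.pow 2)
  have e : ∀ θ : Sph d, tensorNormSq K θ (hessMatrix K f θ + f θ • metricMatrix K θ) *
      dens (supportFn K) θ =
      (hs (supportFn K) (radialExt f) (radialExt f) θ -
        2 * gam (supportFn K) (radialExt f) (radialExt f) θ) * dens (supportFn K) θ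
      - 2 * (-lap (supportFn K) (radialExt f) θ * radialExt f θ * dens (supportFn K) θ)
      + d * (radialExt f θ ^ 2 * dens (supportFn K) θ) := fun θ => by
    rw [tensorNormSq_hess_add_smul H hF, tensorNormSq_hess H hF, laplacian_eq H hF,
      ← radialExt_sph f θ]
    ring
  simp only [integral_nu H, e, tensorNormSq_hess H hF, gradSq_eq H hF]
  rw [integral_sub_add i1 i2 i3, ← hg]
  simp only [← radialExt_sph f]
  push_cast
  constructor <;> intro h <;> linarith

end Transfer

end

section


/-! ### Integral inequalities -/

open Filter MeasureTheory

variable {F G h u : Euc d → ℝ} {y : Euc d}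

/-- The integral with respect to the centro-affine volume. -/
def mean (h g : Euc d → ℝ) : ℝ := ∫ θ : Sph d, g θ * dens h θ ∂(sig d)

theorem gam_sub_sub (H : Adm h) (hF : CD 1 F) (hu : CD 1 u) (hy : y ≠ 0) :
    gam h (fun z => F z - u z) (fun z => F z - u z) y =
      gam h F F y - 2 * gam h u F y + gam h u u y := by
  have e : ∀ i, pd i (fun z => F z - u z) y = 1 * pd i F y + (-1) * pd i u y := fun i => by
    rw [pd_sub hF hu le_rfl hy]; ring
  rw [Adm.gam_congr_left e, H.gam_comm hy (F := F), Adm.gam_congr_left e,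
    H.gam_comm hy (F := u) (K := fun z => F z - u z), Adm.gam_congr_left e,
    H.gam_comm hy (F := F) (K := u)]
  ring

theorem hs_comm : hs h F G y = hs h G F y := by
  simp only [hs]
  rw [Matrix.mul_assoc (gi h y * hm F y), Matrix.trace_mul_comm]
  simp only [Matrix.mul_assoc]

theorem hs_sub_sub (hF : CD 2 F) (hu : CD 2 u) (hy : y ≠ 0) :
    hs h (fun z => F z - u z) (fun z => F z - u z) y =
      hs h F F y - 2 * hs h u F y + hs h u u y := by
  have e : hm (fun z => F z - u z) y = hm F y - hm u y := by
    ext i j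
    have h1 : ∀ {f : Euc d → ℝ}, CD 2 f → CD 1 (pd j f) := fun hf => hf.pd (by norm_num) j
    change pd i (pd j fun z => F z - u z) y = pd i (pd j F) y - pd i (pd j u) y
    rw [pd_congr (fun z hz => pd_sub hF hu one_le_two hz) hy, pd_sub (h1 hF) (h1 hu) le_rfl hy]
  have c := hs_comm (h := h) (F := F) (G := u) (y := y)
  simp only [hs] at c ⊢
  rw [e]
  simp only [Matrix.mul_sub, Matrix.sub_mul, Matrix.trace_sub]
  linarith

/-- The spectral gap, for functions with mean zero. -/
def Poincare (h : Euc d → ℝ) (l : ℝ) : Prop := ∀ F : Euc d → ℝ, DZ 2 F →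
  mean h F = 0 → l * mean h (fun y => F y ^ 2) ≤ mean h (gam h F F)

namespace Adm

variable (H : Adm h)
include H

theorem mean_add (hF : CD 0 F) (hG : CD 0 G) : mean h (fun y => F y + G y) = mean h F + mean h G := by
  rw [mean, mean, mean, ← integral_add (H.integrable_mul_dens hF) (H.integrable_mul_dens hG)]
  exact integral_congr_ae (Eventually.of_forall fun θ => add_mul _ _ _)

theorem mean_sub (hF : CD 0 F) (hG : CD 0 G) : mean h (fun y => F y - G y) = mean h F - mean h G := by
  rw [mean, mean, mean, ← integral_sub (H.integrable_mul_dens hF) (H.integrable_mul_dens hG)]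
  exact integral_congr_ae (Eventually.of_forall fun θ => sub_mul _ _ _)

omit H in
theorem mean_const_mul (c : ℝ) : mean h (fun y => c * F y) = c * mean h F := by
  rw [mean, mean, ← integral_const_mul]
  exact integral_congr_ae (Eventually.of_forall fun θ => mul_assoc _ _ _)

omit H in
theorem mean_congr (hFG : ∀ y, y ≠ 0 → F y = G y) : mean h F = mean h G :=
  integral_congr_ae (Eventually.of_forall fun θ => by simp only [hFG _ (sph_ne_zero θ)])

theorem mean_nonneg (hF : ∀ y, y ≠ 0 → 0 ≤ F y) : 0 ≤ mean h F :=
  integral_nonneg fun θ => mul_nonneg (hF _ (sph_ne_zero θ)) (H.dens_pos (sph_ne_zero θ)).le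

theorem mean_sq_sub (hF : CD 0 F) (hG : CD 0 G) : mean h (fun y => (F y - G y) ^ 2) =
    mean h (fun y => F y ^ 2) - 2 * mean h (fun y => F y * G y) + mean h (fun y => G y ^ 2) := by
  rw [← mean_const_mul, ← H.mean_sub (hF.pow 2) ((cd_const 2).mul (hF.mul hG)),
    ← H.mean_add ((hF.pow 2).sub ((cd_const 2).mul (hF.mul hG))) (hG.pow 2)]
  exact mean_congr fun y _ => by ring

/-- Density is applied to `F * dens`, whose integral vanishes by hypothesis. The residual is then
`dens * (F - lap h u)`, and a positive lower bound `μ` of the density converts the unweighted norm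
into the weighted one. -/
theorem exists_lap_approx (hd : 1 ≤ d) (hF : CD 0 F) (he : ∀ y, F (-y) = F y) (h0 : mean h F = 0)
    {ε : ℝ} (hε : 0 < ε) : ∃ u, DZ ∞ u ∧ mean h (fun y => (F y - lap h u y) ^ 2) ≤ ε := by
  have hdc : Continuous fun θ : Sph d => dens h θ := H.cd_dens.continuous_sph
  obtain ⟨μ, hμ0, hμ⟩ : ∃ μ : ℝ, 0 < μ ∧ ∀ θ : Sph d, μ ≤ dens h θ := by
    have hne : (Set.univ : Set (Sph d)).Nonempty := ⟨⟨EuclideanSpace.single 0 1, by simp⟩, trivial⟩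
    obtain ⟨θ₀, -, h0⟩ := isCompact_univ.exists_isMinOn hne hdc.continuousOn
    exact ⟨dens h θ₀, H.dens_pos (sph_ne_zero _), fun θ => h0 (Set.mem_univ θ)⟩
  let f : C(Sph d, ℝ) := ⟨fun θ => F θ * dens h θ, hF.continuous_sph.mul hdc⟩
  have hf : f ∈ evenZero d := ⟨fun θ => by
    change F (-(θ : Euc d)) * dens h (-(θ : Euc d)) = F θ * dens h θ
    rw [he, dens_neg H.even], h0⟩
  obtain ⟨_, ⟨u, rfl⟩, hu⟩ := Metric.mem_closure_iff.1 (rangeDense H hd f hf) (Real.sqrt (μ * ε))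
    (Real.sqrt_pos.2 (by positivity))
  refine ⟨u, u.2, ?_⟩
  have hu2 : CD 2 (u : Euc d → ℝ) := u.2.cd.of_le two_le_top
  rw [dist_eq_norm, ← map_sub] at hu
  have h1 := (Real.lt_sqrt (norm_nonneg _)).1 hu
  rw [norm_toL2_sq] at h1
  have h2 : μ * mean h (fun y => (F y - lap h u y) ^ 2) ≤
      ∫ θ, (f - opC H u) θ ^ 2 ∂(sig d) := by
    rw [mean, ← integral_const_mul]
    refine integral_mono ((H.integrable_mul_dens ((hF.sub (H.cd_lap hu2)).pow 2)).const_mul _)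
      (integrable_sph ((f - opC H u).continuous.pow 2)) fun θ => ?_
    have e : (f - opC H u) θ = dens h θ * (F θ - lap h u θ) := by
      change F θ * dens h θ - dens h θ * lap h u θ = _
      ring
    have hd0 := H.dens_pos (sph_ne_zero θ)
    simp only [e]
    calc μ * ((F θ - lap h u θ) ^ 2 * dens h θ) ≤ dens h θ * ((F θ - lap h u θ) ^ 2 * dens h θ) :=
          mul_le_mul_of_nonneg_right (hμ θ) (by positivity)
      _ = _ := by ring
  exact le_of_mul_le_mul_left (h2.trans h1.le) hμ0

/-- The Bochner inequality for functions that are only twice continuously differentiable. -/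
theorem bochner_le (hd : 1 ≤ d) (hF : DZ 2 F) :
    mean h (fun y => lap h F y ^ 2) - (d - 1) * mean h (gam h F F) ≤
      mean h (fun y => hs h F F y - 2 * gam h F F y) := by
  have hlF := H.cd_lap hF.cd
  have hF1 := hF.cd.of_le one_le_two
  have hgF := (H.cd_gam hF1 hF1).of_le (k := 0) zero_le
  have hhF := H.cd_hs hF.cd hF.cd
  have h0 : mean h (lap h F) = 0 := by
    have := H.integral_lap_mul_dens hF.cd hF.hom
    simpa only [mean, mul_comm] using this
  -- `F` has too few derivatives for the identity on the pair `(F, F)`. It is used for `(u, F)` and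
  -- `(u, u)`, with `u` smooth and `lap h u` close to `lap h F`. What remains are the energies `hs -
  -- 2 gam` and `(d - 1) gam` of `F - u`, both nonnegative, so only the Laplacian error `ε` is lost.
  refine le_of_forall_pos_le_add fun ε hε => ?_
  obtain ⟨u, hu, hE⟩ := H.exists_lap_approx hd hlF (lap_neg H.even hF.even) h0 hε
  have hu2 : CD 2 u := hu.cd.of_le two_le_top
  have hu1 : CD 1 u := hu.cd.of_le one_le_top
  have hlu := H.cd_lap hu2
  have hgu := (H.cd_gam hu1 hu1).of_le (k := 0) zero_le
  have hguF := (H.cd_gam hu1 hF1).of_le (k := 0) zero_le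
  have hhu := H.cd_hs hu2 hu2
  have hhuF := H.cd_hs hu2 hF.cd
  have b1 : mean h (hs h u F) = mean h (fun y => lap h u y * lap h F y) +
      (3 - d) * mean h (gam h u F) := H.integral_hs hu.cd hu.hom hF.cd hF.hom
  have b2 : mean h (hs h u u) = mean h (fun y => lap h u y ^ 2) +
      (3 - d) * mean h (gam h u u) := by
    simp only [pow_two]
    exact H.integral_hs hu.cd hu.hom hu2 hu.hom
  rw [H.mean_sq_sub hlF hlu] at hE
  have b3 : mean h (fun y => lap h F y * lap h u y) = mean h (fun y => lap h u y * lap h F y) :=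
    mean_congr fun y _ => mul_comm _ _
  have g0 : 0 ≤ mean h (gam h F F) - 2 * mean h (gam h u F) + mean h (gam h u u) := by
    rw [← mean_const_mul, ← H.mean_sub hgF ((cd_const 2).mul hguF),
      ← H.mean_add (hgF.sub ((cd_const 2).mul hguF)) hgu]
    refine H.mean_nonneg fun y hy => ?_
    rw [← gam_sub_sub H hF1 hu1 hy]
    exact H.gam_self_nonneg hy
  have s0 : 0 ≤ mean h (hs h F F) - 2 * mean h (hs h u F) + mean h (hs h u u) -
      2 * (mean h (gam h F F) - 2 * mean h (gam h u F) + mean h (gam h u u)) := by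
    have c1 := hgF.sub ((cd_const 2).mul hguF)
    have c2 := hhF.sub ((cd_const 2).mul hhuF)
    rw [← mean_const_mul (F := gam h u F), ← H.mean_sub hgF ((cd_const 2).mul hguF),
      ← H.mean_add c1 hgu, ← mean_const_mul (F := hs h u F),
      ← H.mean_sub hhF ((cd_const 2).mul hhuF), ← H.mean_add c2 hhu,
      ← mean_const_mul, ← H.mean_sub (c2.add hhu) ((cd_const 2).mul (c1.add hgu))]
    refine H.mean_nonneg fun y hy => ?_
    rw [← gam_sub_sub H hF1 hu1 hy, ← hs_sub_sub hF.cd hu2 hy, sub_nonneg]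
    exact H.two_gam_le_hs (hF.cd.sub hu2) (hF.hom.sub (hu.hom)) hy
  have hd' : (0 : ℝ) ≤ d - 1 := by
    have : (1 : ℝ) ≤ d := by exact_mod_cast hd
    linarith
  have g1 := mul_nonneg hd' g0
  rw [H.mean_sub hhF ((cd_const 2).mul hgF), mean_const_mul]
  linarith

/-- The Bochner formula. -/
theorem bochner (hF : DZ ∞ F) :
    mean h (fun y => hs h F F y - 2 * gam h F F y) =
      mean h (fun y => lap h F y ^ 2) - (d - 1) * mean h (gam h F F) := by
  have hF2 : CD 2 F := hF.cd.of_le two_le_top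
  have hF1 : CD 1 F := hF.cd.of_le one_le_top
  have hgF := (H.cd_gam hF1 hF1).of_le (k := 0) zero_le
  have b : mean h (hs h F F) = mean h (fun y => lap h F y ^ 2) +
      (3 - d) * mean h (gam h F F) := by
    simp only [pow_two]
    exact H.integral_hs hF.cd hF.hom hF2 hF.hom
  rw [H.mean_sub (H.cd_hs hF2 hF2) ((cd_const 2).mul hgF), mean_const_mul, b]
  ring

/-- A Poincaré inequality implies an inequality between the gradient and the Laplacian. -/
theorem gam_le_of_poincare {l : ℝ} (hl : 0 < l) (hP : Poincare h l) (hF : DZ 2 F) :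
    l * mean h (gam h F F) ≤ mean h fun y => lap h F y ^ 2 := by
  set M := mean h fun _ => 1 with hM
  have hM0 : 0 < M := by
    have := H.integral_dens_pos
    simpa [hM, mean] using this
  set a := mean h F / M with ha
  have hF' : DZ 2 fun y => F y - a := hF.sub (DZ.const_mem a)
  have hF0 : CD 0 F := hF.cd.of_le zero_le
  have hm : mean h (fun y => F y - a) = 0 := by
    rw [H.mean_sub hF0 (cd_const a)]
    have : mean h (fun _ => a) = a * M := by
      rw [hM, ← mean_const_mul]; simp
    rw [this, ha]; field_simp; ring
  have hpd : ∀ {y : Euc d}, y ≠ 0 → ∀ j, pd j (fun y => F y - a) y = pd j F y := fun hy j => by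
    rw [pd_sub hF.cd (cd_const a) one_le_two hy, pd_const, sub_zero]
  have hgam : ∀ y, y ≠ 0 → gam h (fun y => F y - a) (fun y => F y - a) y = gam h F F y :=
    fun y hy => by simp only [gam, hpd hy]
  have hlap : ∀ y, y ≠ 0 → lap h (fun y => F y - a) y = lap h F y := fun y hy => by
    simp only [lap, pd_congr (fun z hz => hpd hz _) hy]
  have h1 := hP _ hF' hm
  rw [mean_congr hgam] at h1
  have h2 : mean h (gam h F F) = mean h fun y => -lap h F y * (F y - a) := by
    rw [← mean_congr hgam]
    refine (H.integral_gam_eq hF'.cd hF'.hom).trans ?_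
    exact mean_congr (F := fun y => -lap h (fun y => F y - a) y * (F y - a)) fun y hy => by
      rw [hlap y hy]
  have c0 : CD 0 fun y => F y - a := hF'.cd.of_le zero_le
  have hlF := H.cd_lap hF.cd
  -- Expanding the square of `ΔF + l (F - a)` gives `∫ (ΔF)² ≥ 2 l E - l² ∫ (F - a)²`, where `E` is
  -- the Dirichlet energy; the Poincaré inequality bounds the last term by `l E`.
  have h3 := H.mean_nonneg (F := fun y => (lap h F y - -l * (F y - a)) ^ 2) fun y _ => sq_nonneg _
  rw [H.mean_sq_sub hlF ((cd_const (-l)).mul c0)] at h3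
  have e1 : mean h (fun y => lap h F y * (-l * (F y - a))) = l * mean h (gam h F F) := by
    rw [h2, ← mean_const_mul]; exact mean_congr fun y _ => by ring
  have e2 : mean h (fun y => (-l * (F y - a)) ^ 2) = l ^ 2 * mean h (fun y => (F y - a) ^ 2) := by
    rw [← mean_const_mul]; exact mean_congr fun y _ => by ring
  rw [e1, e2] at h3
  nlinarith [mul_le_mul_of_nonneg_left h1 hl.le]

/-- An inequality between the gradient and the Laplacian of smooth functions implies a Poincaré
inequality, since the range of the Laplacian is dense. -/
theorem poincare_of_gam_le (hd : 1 ≤ d) {l : ℝ} (hl : 0 < l)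
    (hG : ∀ u, DZ ∞ u → l * mean h (gam h u u) ≤ mean h fun y => lap h u y ^ 2) :
    Poincare h l := by
  intro F hF hm
  have hF0 : CD 0 F := hF.cd.of_le zero_le
  have hF1 := hF.cd.of_le one_le_two
  refine le_of_forall_pos_le_add fun ε hε => ?_
  obtain ⟨u, hu, hE⟩ := H.exists_lap_approx hd hF0 hF.even hm (ε := ε / l) (by positivity)
  have hu2 : CD 2 u := hu.cd.of_le two_le_top
  have hu1 : CD 1 u := hu.cd.of_le one_le_top
  have hlu := H.cd_lap hu2
  rw [H.mean_sq_sub hF0 hlu] at hE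
  have h1 : mean h (fun y => F y * lap h u y) = -mean h (gam h F u) :=
    H.integral_mul_lap hu2 hu.hom hF1 hF.hom
  have h2 := hG u hu
  have hgF := (H.cd_gam hF1 hF1).of_le (k := 0) zero_le
  have hgu := (H.cd_gam hu1 hu1).of_le (k := 0) zero_le
  have hgFu := (H.cd_gam hF1 hu1).of_le (k := 0) zero_le
  -- The Dirichlet energy of `F + l u` is nonnegative. If `F` were `Δu`, Green's formula and the
  -- hypothesis on `u` would give the claim at once; `hE` is the same computation with the error `ε
  -- / l`.
  have h3 : 0 ≤ mean h (gam h F F) + l ^ 2 * mean h (gam h u u) - 2 * -l * mean h (gam h F u) := by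
    rw [← mean_const_mul, ← mean_const_mul, ← H.mean_add hgF ((cd_const _).mul hgu),
      ← H.mean_sub (hgF.add ((cd_const _).mul hgu)) ((cd_const _).mul hgFu)]
    refine H.mean_nonneg fun y hy => ?_
    have := H.two_mul_gam_le hy (F := F) (K := u) (-l)
    linarith
  have h4 := (le_div_iff₀ hl).1 hE
  nlinarith [mul_le_mul_of_nonneg_left h2 hl.le]

end Adm

end

section


/-! ### The equivalences -/

open Filter MeasureTheory

theorem pos_spectral_gap {p : ℝ} (hd : 1 ≤ d) (hp : p ≤ 1) : (0 : ℝ) < d + 1 - p := by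
  have : (1 : ℝ) ≤ d := by exact_mod_cast hd
  linarith

section Equivalences

variable {K : Set (Euc d)} (hK : IsSmoothEvenBody K) (hd : 1 ≤ d) {p : ℝ} (hp : p ≤ 1)
include hK

theorem localLp_iff_poincare :
    LocalLpBrunnMinkowski K p ↔ Poincare (supportFn K) (d + 1 - p) :=
  localLp_iff hK.adm p

include hd hp

theorem LocalLpBrunnMinkowski.laplacianGrad (h : LocalLpBrunnMinkowski K p) :
    LaplacianGradInequality K p :=
  (laplacianGrad_iff hK.adm p).2 fun _ hF =>
    hK.adm.gam_le_of_poincare (pos_spectral_gap hd hp) ((localLp_iff_poincare hK).1 h) hF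

theorem localLp_of_smooth (h : ∀ u : Euc d → ℝ, DZ ∞ u →
    (d + 1 - p) * mean (supportFn K) (gam (supportFn K) u u) ≤
      mean (supportFn K) fun y => lap (supportFn K) u y ^ 2) : LocalLpBrunnMinkowski K p :=
  (localLp_iff_poincare hK).2
    (hK.adm.poincare_of_gam_le hd (pos_spectral_gap hd hp) h)

omit hp in
-- Bochner subtracts `(n - 2) ∫ |grad f|²`, and `(n - p) - (n - 2) = 2 - p`.
theorem LaplacianGradInequality.hessGrad (h : LaplacianGradInequality K p) :
    HessGradInequality K p := (hessGrad_iff hK.adm p).2 fun F hF => by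
  have h1 : (d + 1 - p) * mean (supportFn K) (gam (supportFn K) F F) ≤
    mean (supportFn K) fun y => lap (supportFn K) F y ^ 2 := (laplacianGrad_iff hK.adm p).1 h F hF
  have h2 := hK.adm.bochner_le hd hF
  change (2 - p) * mean (supportFn K) (gam (supportFn K) F F) ≤ mean (supportFn K) fun y =>
    hs (supportFn K) F F y - 2 * gam (supportFn K) F F y
  linarith

/-- For the way back smooth functions suffice, and for them Bochner is an identity. -/
theorem HessGradInequality.localLp (h : HessGradInequality K p) : LocalLpBrunnMinkowski K p :=
  localLp_of_smooth hK hd hp fun u hu => by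
    have h1 : (2 - p) * mean (supportFn K) (gam (supportFn K) u u) ≤ mean (supportFn K) fun y =>
      hs (supportFn K) u u y - 2 * gam (supportFn K) u u y :=
      (hessGrad_iff hK.adm p).1 h u (hu.of_le two_le_top)
    rw [hK.adm.bochner hu] at h1
    linarith

/-- The gradient term in Bochner is at most `(n - 2) / (n - p) ∫ (Δ f)²`, and `1 - (n - 2) / (n - p)
= (2 - p) / (n - p)`. -/
theorem LaplacianGradInequality.hessLaplacian (h : LaplacianGradInequality K p) :
    HessLaplacianInequality K p := (hessLaplacian_iff hK.adm p).2 fun F hF => by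
  have h1 : (d + 1 - p) * mean (supportFn K) (gam (supportFn K) F F) ≤
    mean (supportFn K) fun y => lap (supportFn K) F y ^ 2 := (laplacianGrad_iff hK.adm p).1 h F hF
  have h2 := hK.adm.bochner_le hd hF
  have hl := pos_spectral_gap hd hp
  have hd' : (0 : ℝ) ≤ d - 1 := by
    have : (1 : ℝ) ≤ d := by exact_mod_cast hd
    linarith
  change (2 - p) / (d + 1 - p) * mean (supportFn K) (fun y => lap (supportFn K) F y ^ 2) ≤
    mean (supportFn K) fun y => hs (supportFn K) F F y - 2 * gam (supportFn K) F F y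
  rw [div_mul_eq_mul_div, div_le_iff₀ hl]
  nlinarith [mul_le_mul_of_nonneg_left h1 hd', mul_le_mul_of_nonneg_right h2 hl.le]

/-- The reverse computation requires division by `n - 2`, which is why the plane is excluded. -/
theorem HessLaplacianInequality.localLp_of_two_le (hd2 : 2 ≤ d) (h : HessLaplacianInequality K p) :
    LocalLpBrunnMinkowski K p := localLp_of_smooth hK hd hp fun u hu => by
  have h1 : (2 - p) / (d + 1 - p) *
      mean (supportFn K) (fun y => lap (supportFn K) u y ^ 2) ≤ mean (supportFn K) fun y =>
      hs (supportFn K) u u y - 2 * gam (supportFn K) u u y :=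
    (hessLaplacian_iff hK.adm p).1 h u (hu.of_le two_le_top)
  have hl := pos_spectral_gap hd hp
  have hd' : (0 : ℝ) < d - 1 := by
    have : (2 : ℝ) ≤ d := by exact_mod_cast hd2
    linarith
  rw [hK.adm.bochner hu, div_mul_eq_mul_div, div_le_iff₀ hl] at h1
  refine le_of_mul_le_mul_left ?_ hd'
  linarith

omit hd hp in
/-- In the plane, the inequality holds for all `p ≥ 0`. -/
theorem localLp_of_planar (hd1 : d = 1) (hp0 : 0 ≤ p) : LocalLpBrunnMinkowski K p := by
  subst hd1
  refine (localLp_iff_poincare hK).2 fun F hF hm => le_trans ?_ (hK.adm.planar hF hm)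
  refine mul_le_mul_of_nonneg_right (by push_cast; linarith) ?_
  exact hK.adm.mean_nonneg fun y _ => sq_nonneg _

/-- For `d = 1` the factor `(2 - p) / (n - p)` is `1` and the Hessian inequality holds for every
body by Bochner, so it implies nothing. There the conclusion comes from the planar inequality, at
the price of `p ≥ 0`. -/
theorem HessLaplacianInequality.localLp (hnp : 2 ≤ d ∨ 0 ≤ p) (h : HessLaplacianInequality K p) :
    LocalLpBrunnMinkowski K p := by
  rcases hd.lt_or_eq with h1 | h1
  · exact h.localLp_of_two_le hK hd hp h1
  · exact localLp_of_planar hK h1.symm (hnp.resolve_left (by omega))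

end Equivalences

end

end CentroAffine

end

theorem theorem5p5 (n d : ℕ) (hnd : n = d + 1) (hn : 2 ≤ n)
    (K : Set (CentroAffine.Euc d)) (hK : CentroAffine.IsSmoothEvenBody K)
    (p : ℝ) (hp : p ≤ 1) :
    [CentroAffine.LocalLpBrunnMinkowski K p,
      CentroAffine.LaplacianGradInequality K p,
      CentroAffine.HessGradInequality K p].TFAE ∧
    ((3 ≤ n ∨ 0 ≤ p) →
      [CentroAffine.LocalLpBrunnMinkowski K p,
        CentroAffine.LaplacianGradInequality K p,
        CentroAffine.HessLaplacianInequality K p,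
        CentroAffine.HessGradInequality K p].TFAE) ∧
    (p = 0 →
      [CentroAffine.LocalLpBrunnMinkowski K p,
        CentroAffine.LaplacianGradInequality K p,
        CentroAffine.HessLaplacianInequality K p,
        CentroAffine.HessGradInequality K p,
        CentroAffine.ShiftedHessInequality K].TFAE) := by
  have hd : 1 ≤ d := by omega
  have h12 := CentroAffine.LocalLpBrunnMinkowski.laplacianGrad hK hd hp
  have h24 := CentroAffine.LaplacianGradInequality.hessGrad hK hd (p := p)
  have h41 := CentroAffine.HessGradInequality.localLp hK hd hp
  have h23 := CentroAffine.LaplacianGradInequality.hessLaplacian hK hd hp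
  have h31 := CentroAffine.HessLaplacianInequality.localLp hK hd hp
  refine ⟨?_, fun h => ?_, fun h => ?_⟩
  · tfae_have 1 → 2 := h12
    tfae_have 2 → 3 := h24
    tfae_have 3 → 1 := h41
    tfae_finish
  · have h31' := h31 (h.imp_left (by omega))
    tfae_have 1 → 2 := h12
    tfae_have 2 → 4 := h24
    tfae_have 4 → 1 := h41
    tfae_have 2 → 3 := h23
    tfae_have 3 → 1 := h31'
    tfae_finish
  · subst h
    have h31' := h31 (.inr le_rfl)
    have h54 := CentroAffine.shiftedHess_iff hK.adm
    tfae_have 1 → 2 := h12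
    tfae_have 2 → 4 := h24
    tfae_have 4 → 1 := h41
    tfae_have 2 → 3 := h23
    tfae_have 3 → 1 := h31'
    tfae_have 5 ↔ 4 := h54
    tfae_finish
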